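/- Let $\mathbf{k}$ be a field and let $\mathcal{A}$ be a strictly unital $A_\infty$-category over $\mathbf{k}$, graded by $\mathbb{Z}$ (or by $\mathbb{Z}/N$ with $N$ even). Let $\mathrm{Tw}(\mathcal{A})$ be the $A_\infty$-category of twisted complexes over $\mathcal{A}$ (finite formal sums of shifted objects with a strictly triangular degree-one endomorphism $\delta$ satisfying $\sum_r\mu^r(\delta,\dots,\delta)=0$), with shift functor $[1]$. The cone of a $\mu^1_{\mathrm{Tw}}$-closed $\alpha\in\hom^0(X,Y)$ is $\mathrm{Cone}(\alpha)=X[1]\oplus Y$, with differential given by those of $X[1]$ and $Y$ and by $-\alpha[1]\colon X[1]\to Y$. A twisted complex $K$ is a *Koszul twisted complex built out of* $K'$ if there are $n\ge 0$, twisted complexes $K_0=K',K_1,\dots,K_n=K$, integers $s_0,\dots,s_{n-1}$, and $\mu^1_{\mathrm{Tw}}$-closed morphisms $a_{i,j}\in\hom^0(K_j[s_i],K_j)$ for $0\le j\le i\le n-1$, such that 1. $K_{j+1}=\mathrm{Cone}(x_j)$ for $0\le j<n$, where $x_j:=a_{j,j}\colon K_j[s_j]\to K_j$; 2. for $0\le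 j<i\le n-1$ there is $c_{i,j}\in\hom^0(K_j[s_i+s_j+1],K_j)$ such that $a_{i,j+1}\colon \mathrm{Cone}(x_j)[s_i]\to\mathrm{Cone}(x_j)$ has components $a_{i,j}[s_j+1]\colon K_j[s_i+s_j+1]\to K_j[s_j+1]$, $c_{i,j}\colon K_j[s_i+s_j+1]\to K_j$, $a_{i,j}\colon K_j[s_i]\to K_j$, and zero from $K_j[s_i]$ to $K_j[s_j+1]$. The morphisms $a_{i,0}$, $0\le i\le n-1$, are its *edges*. For $a\in\hom^0(X[s],X)$ put $a^1=a$ and $a^{m+1}=\mu^2_{\mathrm{Tw}}(a,a^m[s])\in\hom^0(X[(m+1)s],X)$; call $a$ *nilpotent* if $(\cdots((a^{m_1})^{m_2})\cdots)^{m_r}=0$ for some integers $m_1,\dots,m_r\ge1$ (for instance, if $a^m=0$ for some $m\ge 1$). Say that $K$ *split-generates* $K'$ if $K'$ can be obtained from $K$ by finitely many operations of taking shifts, cones of closed degree-zero morphisms between objects already obtained, and direct summands in $H^0(\mathrm{Tw}(\mathcal{A}))$ (in particular, quasi-isomorphic objects). **Corollary.** Let $K$ be a Koszul twisted complex built out of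 $K'$, with a fixed choice of the data above. - If every edge $a_{i,0}$, $0\le i\le n-1$, is nilpotent, then $K$ split-generates $K'$. - If some edge $a_{i,0}$ is a quasi-isomorphism (its class is invertible in $H^0(\mathrm{Tw}(\mathcal{A}))$), then $K$ is quasi-isomorphic to the zero object. -/

import Mathlib

namespace Ainf

universe u v w

/-! ### Signs -/

/-- The sign `(-1)^g` of a degree `g : ZMod N`; meaningful when `N` is even. -/
def sgn {N : ℕ} (g : ZMod N) : ℤ := (-1) ^ g.val

theorem sgn_eq_intCast {N : ℕ} (hN : Even N) (m : ℤ) :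
    sgn (m : ZMod N) = ((Int.negOnePow m : ℤˣ) : ℤ) := by
  unfold sgn
  have key : ((((m : ZMod N).val : ℕ) : ℤ) - m) % 2 = 0 := by
    obtain ⟨t, rfl⟩ := hN
    cases t with
    | zero =>
      change (((m : ℤ).natAbs : ℤ) - m) % 2 = 0
      omega
    | succ t =>
      rw [ZMod.val_intCast]
      have h2 := Int.emod_add_mul_ediv m ((t + 1 + (t + 1) : ℕ) : ℤ)
      generalize m / ((t + 1 + (t + 1) : ℕ) : ℤ) = c at h2
      generalize m % ((t + 1 + (t + 1) : ℕ) : ℤ) = r at h2 ⊢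
      have : r - m = 2 * (-(((t : ℤ) + 1) * c)) := by
        rw [← h2]; push_cast; ring
      omega
  have h : Int.negOnePow m = Int.negOnePow (((m : ZMod N).val : ℕ) : ℤ) := by
    rw [Int.negOnePow_eq_iff, Int.even_iff]; omega
  rw [h, Int.negOnePow_def]
  simp

theorem exists_intCast {N : ℕ} (g : ZMod N) : ∃ m : ℤ, (m : ZMod N) = g :=
  ZMod.intCast_surjective g

theorem sgn_add {N : ℕ} (hN : Even N) (g h : ZMod N) : sgn (g + h) = sgn g * sgn h := by
  obtain ⟨a, rfl⟩ := exists_intCast g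
  obtain ⟨b, rfl⟩ := exists_intCast h
  rw [← Int.cast_add, sgn_eq_intCast hN, sgn_eq_intCast hN, sgn_eq_intCast hN, Int.negOnePow_add]
  simp

theorem sgn_mul_self {N : ℕ} (g : ZMod N) : sgn g * sgn g = 1 := by
  unfold sgn; rw [← mul_pow]; simp

theorem sgn_neg {N : ℕ} (hN : Even N) (g : ZMod N) : sgn (-g) = sgn g := by
  have h := sgn_add hN g (-g)
  rw [add_neg_cancel] at h
  have h0 : sgn (0 : ZMod N) = 1 := by simp [sgn]
  have h1 := sgn_mul_self g
  calc sgn (-g) = sgn g * sgn g * sgn (-g) := by rw [h1, one_mul]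
    _ = sgn g * (sgn g * sgn (-g)) := by ring
    _ = sgn g := by rw [← h, h0, mul_one]

theorem sgn_sub {N : ℕ} (hN : Even N) (g h : ZMod N) : sgn (g - h) = sgn g * sgn h := by
  rw [sub_eq_add_neg, sgn_add hN, sgn_neg hN]

/-! ### Composable chains -/

/-- `Chain E X Y`: composable sequences `(a₁, …, a_d)`, `d ≥ 0`, of elements `aᵢ ∈ E Xᵢ₋₁ Xᵢ` with
`X₀ = X` and `X_d = Y`. The element applied first is the head. -/
inductive Chain {O : Type u} (E : O → O → Type v) : O → O → Type (max u v)
  | nil (X : O) : Chain E X X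
  | cons {X Y Z : O} (a : E X Y) (c : Chain E Y Z) : Chain E X Z

namespace Chain

variable {O : Type u} {E : O → O → Type v}

def append : {X Y Z : O} → Chain E X Y → Chain E Y Z → Chain E X Z
  | _, _, _, nil _, d => d
  | _, _, _, cons a c, d => cons a (append c d)

def length : {X Y : O} → Chain E X Y → ℕ
  | _, _, nil _ => 0
  | _, _, cons _ c => length c + 1

/-- The chain with the single entry `a`. -/
def single {X Y : O} (a : E X Y) : Chain E X Y := cons a (nil Y)

/-- The sum of `F p q` over all ways to cut a chain `c` into a beginning `p` and an end `q`, both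
possibly empty. -/
def sumSplits {V : Type w} [Add V] : {X Z : O} → Chain E X Z →
    (∀ {Y : O}, Chain E X Y → Chain E Y Z → V) → V
  | X, _, nil _, F => F (nil X) (nil X)
  | X, _, cons a c, F => F (nil X) (cons a c) + sumSplits c (fun p q => F (cons a p) q)

end Chain

/-! ### `A_∞`-categories -/

/-- Objects together with graded vector spaces `hom(X, Y) = ⨁ hom^g(X, Y)`; the degrees lie in
`ZMod N`, that is in `ℤ` when `N = 0`. -/
structure GradedQuiver (k : Type w) [Field k] (N : ℕ) where
  Ob : Type u
  Hom : Ob → Ob → Type v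
  [addCommGroup : ∀ X Y, AddCommGroup (Hom X Y)]
  [module : ∀ X Y, Module k (Hom X Y)]
  /-- the subspace `hom^g(X, Y)` -/
  gr : ∀ X Y, ZMod N → Submodule k (Hom X Y)
  isInternal : ∀ X Y, DirectSum.IsInternal (gr X Y)

attribute [instance] GradedQuiver.addCommGroup GradedQuiver.module

namespace GradedQuiver

variable {k : Type w} [Field k] {N : ℕ} (Q : GradedQuiver.{u, v, w} k N)

/-- Homogeneous morphisms, with their degree. -/
def Elt (X Y : Q.Ob) : Type v := Σ g : ZMod N, Q.gr X Y g

variable {Q}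

def elt {X Y : Q.Ob} {g : ZMod N} {x : Q.Hom X Y} (hx : x ∈ Q.gr X Y g) : Q.Elt X Y := ⟨g, x, hx⟩

/-- The sum `(|a₁| - 1) + ⋯ + (|a_d| - 1)` of the reduced degrees of a chain. -/
def rdeg : {X Y : Q.Ob} → Chain Q.Elt X Y → ZMod N
  | _, _, .nil _ => 0
  | _, _, .cons a c => (a.1 - 1) + rdeg c

end GradedQuiver

open GradedQuiver in
/-- An `A_∞`-category over `k` (possibly without units), graded by `ℤ` (`N = 0`) or by `ℤ/N` with
`N` even. Here `mu (a₁, …, a_d)` is the composition `μ^d(a_d, …, a₁)`. -/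
structure AInfCategory (k : Type w) [Field k] (N : ℕ) extends GradedQuiver.{u, v, w} k N where
  even_period : Even N
  mu : ∀ {X Y : Ob}, Chain toGradedQuiver.Elt X Y → Hom X Y
  /-- `μ^d` has degree `2 - d`. -/
  mu_mem : ∀ {X Y : Ob} (c : Chain toGradedQuiver.Elt X Y), mu c ∈ gr X Y (rdeg c + 2)
  /-- There is no curvature term `μ^0`. -/
  mu_nil : ∀ X : Ob, mu (.nil X) = 0
  mu_add : ∀ {W X Y Z : Ob} (p : Chain toGradedQuiver.Elt W X) (g : ZMod N) (a b : gr X Y g)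
    (q : Chain toGradedQuiver.Elt Y Z),
    mu (p.append (.cons ⟨g, a + b⟩ q)) =
      mu (p.append (.cons ⟨g, a⟩ q)) + mu (p.append (.cons ⟨g, b⟩ q))
  mu_smul : ∀ {W X Y Z : Ob} (p : Chain toGradedQuiver.Elt W X) (g : ZMod N) (t : k) (a : gr X Y g)
    (q : Chain toGradedQuiver.Elt Y Z),
    mu (p.append (.cons ⟨g, t • a⟩ q)) = t • mu (p.append (.cons ⟨g, a⟩ q))
  /-- `∑ (-1)^(|a₁| + ⋯ + |aₙ| - n) μ(a_d, …, aₙ₊ₘ₊₁, μ^m(aₙ₊ₘ, …, aₙ₊₁), aₙ, …, a₁) = 0`. -/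
  relation : ∀ {X Y : Ob} (c : Chain toGradedQuiver.Elt X Y),
    c.sumSplits (fun p c' => c'.sumSplits (fun q r =>
      sgn (rdeg p) • mu (p.append (.cons (elt (mu_mem q)) r)))) = 0

/-- Strict units `e_X`. They are unique if they exist. -/
structure AInfCategory.StrictUnits {k : Type w} [Field k] {N : ℕ}
    (A : AInfCategory.{u, v, w} k N) where
  e : ∀ X : A.Ob, A.gr X X 0
  closed : ∀ X, A.mu (.single ⟨0, e X⟩) = 0
  /-- `μ²(a, e_X) = a` -/
  mu_e_right : ∀ {X Y : A.Ob} (a : A.Elt X Y), A.mu (.cons ⟨0, e X⟩ (.single a)) = a.2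
  /-- `(-1)^|a| μ²(e_Y, a) = a` -/
  mu_e_left : ∀ {X Y : A.Ob} (a : A.Elt X Y),
    sgn a.1 • A.mu (.cons a (.single ⟨0, e Y⟩)) = a.2
  /-- `μ^d(…, e_X, …) = 0` for `d ≥ 3` -/
  mu_e_higher : ∀ {W X Z : A.Ob} (p : Chain A.Elt W X) (q : Chain A.Elt X Z),
    2 ≤ p.length + q.length → A.mu (p.append (.cons ⟨0, e X⟩ q)) = 0

/-! ### Twisted complexes -/

/-- A formal direct sum `⨁ᵢ (ob i)[sh i]` over a finite index set with an endomorphism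
`δ = (δᵢⱼ)`, `δᵢⱼ ∈ hom¹((ob i)[sh i], (ob j)[sh j])`, that is strictly triangular for some
filtration. Here `hom^g(X[s], Y[t]) = hom^(g - s + t)(X, Y)`. -/
structure PreTw {k : Type w} [Field k] {N : ℕ} (A : AInfCategory.{u, v, w} k N) where
  I : Type
  [fintype : Fintype I]
  ob : I → A.Ob
  sh : I → ℤ
  δ : ∀ i j, A.Hom (ob i) (ob j)
  δ_mem : ∀ i j, δ i j ∈ A.gr (ob i) (ob j) (1 - (sh i : ZMod N) + (sh j : ZMod N))
  triangular : ∃ rank : I → ℕ, ∀ i j, δ i j ≠ 0 → rank i < rank j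

attribute [instance] PreTw.fintype

noncomputable section

namespace PreTw

variable {k : Type w} [Field k] {N : ℕ} {A : AInfCategory.{u, v, w} k N}

/-- `hom^g(X, Y)` for formal direct sums of shifts: matrices `f` with entries `f i j` of degree `g`
from `(X.ob i)[X.sh i]` to `(Y.ob j)[Y.sh j]`. -/
def Hom (X Y : PreTw A) (g : ZMod N) : Submodule k (∀ i j, A.Hom (X.ob i) (Y.ob j)) where
  carrier := {f | ∀ i j, f i j ∈ A.gr (X.ob i) (Y.ob j) (g - (X.sh i : ZMod N) + (Y.sh j : ZMod N))}
  add_mem' hf hf' i j := add_mem (hf i j) (hf' i j)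
  zero_mem' _ _ := zero_mem _
  smul_mem' t _ hf i j := Submodule.smul_mem _ t (hf i j)

/-- Homogeneous morphisms between formal direct sums, with their degree. -/
def Elt (X Y : PreTw A) : Type v := Σ g : ZMod N, X.Hom Y g

def toElt {X Y : PreTw A} {g : ZMod N} (f : X.Hom Y g) : Elt X Y := ⟨g, f⟩

/-- The entry `f i j` with its degree as a morphism of `A`. -/
def entry {X Y : PreTw A} (f : Elt X Y) (i : X.I) (j : Y.I) : A.Elt (X.ob i) (Y.ob j) :=
  ⟨f.1 - (X.sh i : ZMod N) + (Y.sh j : ZMod N), f.2.1 i j, f.2.2 i j⟩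

open Classical in
/-- For a chain of matrices `(f₁, …, f_d)` and an index `i₀ = i`, the family (in `j = i_d`) of the
sums over all `i₁, …, i_(d-1)` of
`(-1)^◁ F (x₁, …, x_d)` with `x_q = f_q i_(q-1) i_q` and `◁ = ∑_{p < q} |φ_p| (|x_q| - 1)`, where
`|φ_p| = s_(p-1) - s_p` is the difference of the shifts of the source and the target of `x_p`. -/
def expand : {X Y : PreTw A} → {V : Y.I → Type v} → [∀ j, AddCommGroup (V j)] →
    Chain (O := PreTw A) Elt X Y → (i : X.I) →
    (∀ j, Chain A.Elt (X.ob i) (Y.ob j) → V j) → ∀ j, V j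
  | _, _, _, _, .nil _, i, F => Pi.single i (F i (.nil _))
  | X, _, _, _, .cons (Y := X₁) f c, i, F => ∑ i₁ : X₁.I, expand c i₁ (fun j p =>
      sgn (((X.sh i : ZMod N) - (X₁.sh i₁ : ZMod N)) * GradedQuiver.rdeg p) •
        F j (.cons (entry f i i₁) p))

/-- The composition `μ^d` of the additive enlargement: matrices of morphisms are composed as
matrices, with the sign `◁`. -/
def muSum {X Y : PreTw A} (c : Chain (O := PreTw A) Elt X Y) (i : X.I) (j : Y.I) :
    A.Hom (X.ob i) (Y.ob j) :=
  expand c i (fun _ p => A.mu p) j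

def δElt (X : PreTw A) : Elt X X := ⟨1, X.δ, X.δ_mem⟩

/-- The chain `(δ_X, …, δ_X)` of length `r`. -/
def δChain (X : PreTw A) : ℕ → Chain (O := PreTw A) Elt X X
  | 0 => .nil X
  | r + 1 => .cons X.δElt (δChain X r)

/-- The sum of `F` over all ways to insert copies of the `δ`'s before, between and after the
entries of a chain. At most `card I - 1` consecutive copies of `δ_X` can contribute, because `δ_X`
is strictly triangular. -/
def insertδ {V : Type v} [AddCommMonoid V] : {X Y : PreTw A} → Chain (O := PreTw A) Elt X Y →
    (Chain (O := PreTw A) Elt X Y → V) → V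
  | X, _, .nil _, F => ∑ r ∈ Finset.range (Fintype.card X.I), F (X.δChain r)
  | X, _, .cons f c, F => ∑ r ∈ Finset.range (Fintype.card X.I),
      insertδ c (fun c' => F ((X.δChain r).append (.cons f c')))

/-- The composition `μ^d_Tw(a_d, …, a₁) = ∑ μ^•(δ, …, δ, a_d, δ, …, δ, a₁, δ, …, δ)`. For `d = 0`
this is the sum `∑ μ^r(δ, …, δ)`. -/
def muTw {X Y : PreTw A} (c : Chain (O := PreTw A) Elt X Y) (i : X.I) (j : Y.I) :
    A.Hom (X.ob i) (Y.ob j) :=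
  insertδ c (fun c' => muSum c' i j)

/-- The Maurer-Cartan equation `∑_r μ^r(δ, …, δ) = 0`. -/
def MaurerCartan (X : PreTw A) : Prop := ∀ i j, muTw (.nil X) i j = 0

/-- `μ¹_Tw` -/
def muTw₁ {X Y : PreTw A} {g : ZMod N} (f : X.Hom Y g) : ∀ i j, A.Hom (X.ob i) (Y.ob j) :=
  muTw (.single (toElt f))

def IsClosed {X Y : PreTw A} {g : ZMod N} (f : X.Hom Y g) : Prop := muTw₁ f = 0

/-! The following facts show that shifts and cones of twisted complexes are twisted complexes. -/

section Facts

theorem elt_ext {X Y : A.Ob} {a b : A.Elt X Y} (h : a.1 = b.1)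
    (h' : (a.2 : A.Hom X Y) = b.2) : a = b := by
  obtain ⟨g, x, hx⟩ := a
  obtain ⟨g', y, hy⟩ := b
  dsimp only at h h'
  subst h
  subst h'
  rfl

theorem mem_gr {X Y : A.Ob} {g g' : ZMod N} {x : A.Hom X Y} (hx : x ∈ A.gr X Y g) (h : g = g') :
    x ∈ A.gr X Y g' := h ▸ hx

/-- Additivity in each entry of a chain. -/
def IsAdditive {X Y : A.Ob} {V : Type v} [AddCommGroup V] (F : Chain A.Elt X Y → V) : Prop :=
  ∀ ⦃W Z : A.Ob⦄ (p : Chain A.Elt X W) (g : ZMod N) (a b : A.gr W Z g) (q : Chain A.Elt Z Y),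
    F (p.append (.cons ⟨g, a + b⟩ q)) =
      F (p.append (.cons ⟨g, a⟩ q)) + F (p.append (.cons ⟨g, b⟩ q))

theorem isAdditive_mu (X Y : A.Ob) : IsAdditive (fun p : Chain A.Elt X Y => A.mu p) :=
  fun _ _ p g a b q => A.mu_add p g a b q

theorem IsAdditive.cons {X X' Y : A.Ob} {V : Type v} [AddCommGroup V]
    {F : Chain A.Elt X Y → V} (hF : IsAdditive F) (a : A.Elt X X') (m : ℤ) :
    IsAdditive (fun p : Chain A.Elt X' Y => m • F (.cons a p)) := by
  intro W Z p g x y q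
  have := hF (.cons a p) g x y q
  simp only [Chain.append] at this
  simp only [this, smul_add]

theorem rdeg_append {X Y Z : A.Ob} (p : Chain A.Elt X Y) (q : Chain A.Elt Y Z) :
    GradedQuiver.rdeg (p.append q) = GradedQuiver.rdeg p + GradedQuiver.rdeg q := by
  induction p with
  | nil => simp [Chain.append, GradedQuiver.rdeg]
  | cons a c ih => simp [Chain.append, GradedQuiver.rdeg, ih, add_assoc]

theorem IsAdditive.cons_sgn {X X' Y : A.Ob} {V : Type v} [AddCommGroup V]
    {F : Chain A.Elt X Y → V} (hF : IsAdditive F) (a : A.Elt X X') (t : ZMod N) :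
    IsAdditive (fun p : Chain A.Elt X' Y =>
      sgn (t * GradedQuiver.rdeg p) • F (.cons a p)) := by
  intro W Z p g x y q
  have := hF (.cons a p) g x y q
  simp only [Chain.append] at this
  simp only [this, smul_add, rdeg_append, GradedQuiver.rdeg]

theorem IsAdditive.head_zsmul {X X' Y : A.Ob} {V : Type v} [AddCommGroup V]
    {F : Chain A.Elt X Y → V} (hF : IsAdditive F) (m : ℤ) (a b : A.Elt X X')
    (h : a.1 = b.1) (h' : (a.2 : A.Hom X X') = m • (b.2 : A.Hom X X')) (p : Chain A.Elt X' Y) :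
    F (.cons a p) = m • F (.cons b p) := by
  obtain ⟨g, x⟩ := a
  obtain ⟨g', y⟩ := b
  dsimp only at h
  subst h
  have hx : x = m • y := Subtype.ext (by simpa using h')
  subst hx
  let φ : A.gr X X' g →+ V := AddMonoidHom.mk' (fun z => F (.cons ⟨g, z⟩ p))
    (fun z z' => hF (.nil X) g z z' p)
  exact map_zsmul φ m y

theorem IsAdditive.head_zero {X X' Y : A.Ob} {V : Type v} [AddCommGroup V]
    {F : Chain A.Elt X Y → V} (hF : IsAdditive F) (a : A.Elt X X')
    (h' : (a.2 : A.Hom X X') = 0) (p : Chain A.Elt X' Y) : F (.cons a p) = 0 := by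
  have := hF.head_zsmul 0 a a rfl (by simp [h']) p
  simpa using this

/-- The sum of the reduced degrees of a chain of matrices. -/
def wdeg : {X Y : PreTw A} → Chain (O := PreTw A) Elt X Y → ZMod N
  | _, _, .nil _ => 0
  | _, _, .cons f c => (f.1 - 1) + wdeg c

theorem wdeg_append {X Y Z : PreTw A} (p : Chain (O := PreTw A) Elt X Y)
    (q : Chain (O := PreTw A) Elt Y Z) : wdeg (p.append q) = wdeg p + wdeg q := by
  induction p with
  | nil => simp [Chain.append, wdeg]
  | cons a c ih => simp [Chain.append, wdeg, ih, add_assoc]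

theorem wdeg_δChain (X : PreTw A) (r : ℕ) : wdeg (X.δChain r) = 0 := by
  induction r with
  | zero => rfl
  | succ r ih => simp [δChain, wdeg, ih, δElt]

theorem expand_congr {X Y : PreTw A} (c : Chain (O := PreTw A) Elt X Y) :
    ∀ {V : Y.I → Type v} [∀ j, AddCommGroup (V j)] (i : X.I)
    (F F' : ∀ j, Chain A.Elt (X.ob i) (Y.ob j) → V j)
    (_ : ∀ j p, GradedQuiver.rdeg p = wdeg c - (X.sh i : ZMod N) + (Y.sh j : ZMod N) →
      F j p = F' j p), expand c i F = expand c i F' := by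
  induction c with
  | nil X =>
    intro V _ i F F' h
    simp only [expand]
    rw [h i (.nil _) (by simp [GradedQuiver.rdeg, wdeg])]
  | cons f c ih =>
    intro V _ i F F' h
    simp only [expand]
    refine Finset.sum_congr rfl fun i₁ _ => ih i₁ _ _ fun j p hp => ?_
    rw [h]
    simp only [GradedQuiver.rdeg, wdeg, entry, hp]
    ring

theorem expand_hom {X Y : PreTw A} (c : Chain (O := PreTw A) Elt X Y) :
    ∀ {V V' : Y.I → Type v} [∀ j, AddCommGroup (V j)] [∀ j, AddCommGroup (V' j)] (i : X.I)
    (F : ∀ j, Chain A.Elt (X.ob i) (Y.ob j) → V j) (φ : ∀ j, V j →+ V' j) (j : Y.I),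
    expand c i (fun j p => φ j (F j p)) j = φ j (expand c i F j) := by
  induction c with
  | nil X =>
    intro V V' _ _ i F φ j
    simp only [expand]
    classical
    by_cases h : j = i
    · subst h; simp
    · simp [Pi.single_eq_of_ne h]
  | cons f c ih =>
    intro V V' _ _ i F φ j
    simp only [expand, Finset.sum_apply, map_sum]
    refine Finset.sum_congr rfl fun i₁ _ => ?_
    rw [← ih]
    simp

theorem expand_zsmul {X Y : PreTw A} (c : Chain (O := PreTw A) Elt X Y)
    {V : Y.I → Type v} [∀ j, AddCommGroup (V j)] (i : X.I)
    (F : ∀ j, Chain A.Elt (X.ob i) (Y.ob j) → V j) (m : Y.I → ℤ) (j : Y.I) :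
    expand c i (fun j p => m j • F j p) j = m j • expand c i F j :=
  expand_hom c i F (fun j => DistribSMul.toAddMonoidHom (V j) (m j)) j

theorem expand_zero {X Y : PreTw A} (c : Chain (O := PreTw A) Elt X Y)
    {V : Y.I → Type v} [∀ j, AddCommGroup (V j)] (i : X.I)
    (F : ∀ j, Chain A.Elt (X.ob i) (Y.ob j) → V j) (h : ∀ j p, F j p = 0) :
    expand c i F = 0 := by
  have hF : F = fun j p => (0 : ℤ) • F j p := by
    funext j p; rw [h, smul_zero]
  funext j
  rw [hF, expand_zsmul c i F (fun _ => 0) j]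
  simp

theorem expand_mem {X Y : PreTw A} (c : Chain (O := PreTw A) Elt X Y) :
    ∀ {V : Y.I → Type v} [∀ j, AddCommGroup (V j)] (i : X.I)
    (F : ∀ j, Chain A.Elt (X.ob i) (Y.ob j) → V j) (S : ∀ j, AddSubgroup (V j))
    (_ : ∀ j p, GradedQuiver.rdeg p = wdeg c - (X.sh i : ZMod N) + (Y.sh j : ZMod N) →
      F j p ∈ S j) (j : Y.I), expand c i F j ∈ S j := by
  induction c with
  | nil X =>
    intro V _ i F S h j
    simp only [expand]
    classical
    by_cases hj : j = i
    · subst hj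
      simp only [Pi.single_eq_same]
      exact h j _ (by simp [GradedQuiver.rdeg, wdeg])
    · rw [Pi.single_eq_of_ne hj]; exact zero_mem _
  | cons f c ih =>
    intro V _ i F S h j
    simp only [expand, Finset.sum_apply]
    refine sum_mem fun i₁ _ => ih i₁ _ S (fun j p hp => zsmul_mem (h _ _ ?_) _) j
    simp only [GradedQuiver.rdeg, wdeg, entry, hp]
    ring

theorem insertδ_mem {V : Type v} [AddCommGroup V] (S : AddSubgroup V) {X Y : PreTw A}
    (c : Chain (O := PreTw A) Elt X Y) :
    ∀ (F : Chain (O := PreTw A) Elt X Y → V) (_ : ∀ c', wdeg c' = wdeg c → F c' ∈ S),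
      insertδ c F ∈ S := by
  induction c with
  | nil X =>
    intro F h
    exact sum_mem fun r _ => h _ (by rw [wdeg_δChain]; rfl)
  | cons f c ih =>
    intro F h
    refine sum_mem fun r _ => ih _ fun c' hc' => h _ ?_
    rw [wdeg_append, wdeg_δChain, zero_add, wdeg, wdeg, hc']

/-- `μ^d_Tw` has degree `2 - d`. -/
theorem muTw_mem {X Y : PreTw A} (c : Chain (O := PreTw A) Elt X Y) :
    muTw c ∈ X.Hom Y (wdeg c + 2) := by
  intro i j
  refine insertδ_mem (A.gr (X.ob i) (Y.ob j)
    (wdeg c + 2 - (X.sh i : ZMod N) + (Y.sh j : ZMod N))).toAddSubgroup c _ fun c' hc' => ?_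
  refine expand_mem c' i (fun _ p => A.mu p) (fun j => (A.gr (X.ob i) (Y.ob j)
    (wdeg c + 2 - (X.sh i : ZMod N) + (Y.sh j : ZMod N))).toAddSubgroup) (fun j p hp => ?_) j
  have := A.mu_mem p
  rw [hp, hc'] at this
  change A.mu p ∈ A.gr _ _ _
  convert this using 2
  ring

theorem expand_append_zero {X Y Z : PreTw A} (c : Chain (O := PreTw A) Elt X Y)
    (c' : Chain (O := PreTw A) Elt Y Z) {V : Z.I → Type v} [∀ j, AddCommGroup (V j)]
    (h : ∀ (i : Y.I) (F : ∀ j, Chain A.Elt (Y.ob i) (Z.ob j) → V j),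
      (∀ j, IsAdditive (F j)) → expand c' i F = 0) :
    ∀ (i : X.I) (F : ∀ j, Chain A.Elt (X.ob i) (Z.ob j) → V j),
      (∀ j, IsAdditive (F j)) → expand (c.append c') i F = 0 := by
  induction c with
  | nil X => exact h
  | cons f c ih =>
    intro i F hF
    simp only [Chain.append, expand]
    exact Finset.sum_eq_zero fun i₁ _ => ih c' h i₁ _ fun j => (hF j).cons_sgn _ _

/-- Chains with too many consecutive copies of `δ` do not contribute. -/
theorem expand_δChain_append_zero {X Z : PreTw A} (c : Chain (O := PreTw A) Elt X Z) {r : ℕ}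
    (hr : Fintype.card X.I ≤ r) {V : Z.I → Type v} [∀ j, AddCommGroup (V j)] (i : X.I)
    (F : ∀ j, Chain A.Elt (X.ob i) (Z.ob j) → V j) (hF : ∀ j, IsAdditive (F j)) :
    expand ((X.δChain r).append c) i F = 0 := by
  classical
  obtain ⟨rank, hrank⟩ := X.triangular
  have key : ∀ (r : ℕ) (i : X.I), (Finset.univ.filter fun j => rank i < rank j).card < r →
      ∀ (F : ∀ j, Chain A.Elt (X.ob i) (Z.ob j) → V j), (∀ j, IsAdditive (F j)) →
      expand ((X.δChain r).append c) i F = 0 := by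
    intro r
    induction r with
    | zero => intro i h; omega
    | succ r ih =>
      intro i h F hF
      simp only [δChain, Chain.append, expand]
      refine Finset.sum_eq_zero fun i₁ _ => ?_
      by_cases h0 : X.δ i i₁ = 0
      · refine expand_zero _ _ _ fun j p => ?_
        rw [(hF j).head_zero _ h0, smul_zero]
      · refine ih i₁ ?_ _ fun j => (hF j).cons_sgn _ _
        have hlt := hrank _ _ h0
        have : (Finset.univ.filter fun j => rank i₁ < rank j) ⊂
            (Finset.univ.filter fun j => rank i < rank j) := by
          rw [Finset.ssubset_iff_of_subset]
          · exact ⟨i₁, by simp [hlt], by simp⟩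
          · intro j; simp only [Finset.mem_filter_univ]; omega
        have := Finset.card_lt_card this
        omega
  refine key r i ?_ F hF
  refine lt_of_lt_of_le ?_ hr
  rw [← Finset.card_univ]
  exact Finset.card_lt_card (Finset.filter_ssubset.2 ⟨i, by simp, by simp⟩)

theorem append_nil {O : Type u} {E : O → O → Type v} {X Y : O} (c : Chain E X Y) :
    c.append (.nil Y) = c := by
  induction c with
  | nil => rfl
  | cons a c ih => simp [Chain.append, ih]

theorem expand_δChain_zero {X : PreTw A} {r : ℕ}
    (hr : Fintype.card X.I ≤ r) {V : X.I → Type v} [∀ j, AddCommGroup (V j)] (i : X.I)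
    (F : ∀ j, Chain A.Elt (X.ob i) (X.ob j) → V j) (hF : ∀ j, IsAdditive (F j)) :
    expand (X.δChain r) i F = 0 := by
  have := expand_δChain_append_zero (.nil X) hr i F hF
  rwa [append_nil] at this

end Facts

/-! ### Shifts and cones -/

/-- The shift `X[m]`. It acts on entries `φ ⊗ x` as `id ⊗ φ ⊗ x`, with the Koszul sign
`(-1)^(m |φ|)`. -/
@[reducible]
def shift (X : PreTw A) (m : ℤ) : PreTw A where
  I := X.I
  ob := X.ob
  sh i := X.sh i + m
  δ i j := sgn ((m : ZMod N) * ((X.sh i : ZMod N) - (X.sh j : ZMod N))) • X.δ i j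
  δ_mem i j := zsmul_mem (mem_gr (X.δ_mem i j) (by push_cast; ring)) _
  triangular := by
    obtain ⟨r, hr⟩ := X.triangular
    exact ⟨r, fun i j h => hr i j fun h0 => h (by rw [h0, smul_zero])⟩

/-- The shift `f[m] ∈ hom^g(X[m], Y[m])` of `f ∈ hom^g(X, Y)`. -/
def shiftHom {X Y : PreTw A} {g : ZMod N} (f : X.Hom Y g) (m : ℤ) :
    (X.shift m).Hom (Y.shift m) g :=
  ⟨fun i j => sgn ((m : ZMod N) * ((X.sh i : ZMod N) - (Y.sh j : ZMod N))) • f.1 i j,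
    fun i j => zsmul_mem (mem_gr (f.2 i j) (by push_cast; ring)) _⟩

/-- The cone on `α ∈ hom⁰(X, Y)`: the sum `X[1] ⊕ Y` with differential given by `δ_{X[1]}`, `δ_Y`
and `-α[1] ∈ hom¹(X[1], Y)`. -/
@[reducible]
def cone {X Y : PreTw A} (α : X.Hom Y 0) : PreTw A where
  I := X.I ⊕ Y.I
  ob := Sum.elim X.ob Y.ob
  sh := Sum.elim (X.shift 1).sh Y.sh
  δ
    | .inl i, .inl j => (X.shift 1).δ i j
    | .inl i, .inr j => -(sgn ((X.sh i : ZMod N) - (Y.sh j : ZMod N)) • α.1 i j)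
    | .inr _, .inl _ => 0
    | .inr i, .inr j => Y.δ i j
  δ_mem
    | .inl i, .inl j => (X.shift 1).δ_mem i j
    | .inl i, .inr j => neg_mem (zsmul_mem (mem_gr (α.2 i j) (by
        simp only [Sum.elim_inl, Sum.elim_inr]; push_cast; ring)) _)
    | .inr _, .inl _ => zero_mem _
    | .inr i, .inr j => Y.δ_mem i j
  triangular := by
    obtain ⟨r, hr⟩ : ∃ r : X.I → ℕ, ∀ i j, (X.shift 1).δ i j ≠ 0 → r i < r j :=
      (X.shift 1).triangular
    obtain ⟨r', hr'⟩ := Y.triangular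
    refine ⟨Sum.elim r (fun j => Finset.univ.sup r + 1 + r' j), ?_⟩
    rintro (i | i) (j | j) h
    · exact hr i j h
    · have : r i ≤ Finset.univ.sup r := Finset.le_sup (Finset.mem_univ i)
      simp only [Sum.elim_inl, Sum.elim_inr]
      omega
    · exact absurd rfl h
    · have := hr' i j h
      simp only [Sum.elim_inr]
      omega

/-- The zero object. -/
def zero (A : AInfCategory.{u, v, w} k N) : PreTw A where
  I := Empty
  ob := Empty.elim
  sh := Empty.elim
  δ i := i.elim
  δ_mem i := i.elim
  triangular := ⟨Empty.elim, fun i => i.elim⟩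

section Facts

theorem sgn_zero : sgn (0 : ZMod N) = 1 := by simp [sgn]

theorem expand_shift_δChain (X : PreTw A) (m : ℤ) (r : ℕ) :
    ∀ {V : X.I → Type v} [∀ j, AddCommGroup (V j)] (i : X.I)
    (F : ∀ j, Chain A.Elt (X.ob i) (X.ob j) → V j) (_ : ∀ j, IsAdditive (F j)) (j : X.I),
    expand ((X.shift m).δChain r) i F j =
      sgn ((m : ZMod N) * ((X.sh i : ZMod N) - (X.sh j : ZMod N))) • expand (X.δChain r) i F j := by
  induction r with
  | zero =>
    intro V _ i F hF j
    simp only [δChain, expand]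
    classical
    by_cases h : j = i
    · subst h
      change (Pi.single j _ : ∀ j, V j) j = _
      rw [sub_self, mul_zero, sgn_zero, one_smul]
    · change (Pi.single i _ : ∀ j, V j) j = _
      rw [Pi.single_eq_of_ne h, smul_zero]
  | succ r ih =>
    intro V _ i F hF j
    simp only [δChain, expand, Finset.sum_apply, Finset.smul_sum]
    refine Finset.sum_congr rfl fun i₁ _ => ?_
    rw [← sub_add_sub_cancel (X.sh i : ZMod N) (X.sh i₁ : ZMod N) (X.sh j : ZMod N), mul_add,
      sgn_add A.even_period, mul_comm, mul_smul, ← expand_zsmul _ _ _ (fun _ => _)]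
    rw [← ih i₁ _ (fun j => by
      intro W Z p g x y q
      have := (hF j).cons_sgn (entry X.δElt i i₁)
        ((X.sh i : ZMod N) - (X.sh i₁ : ZMod N)) p g x y q
      simp only [this, smul_add]) j]
    congr 1
    funext j p
    have e1 := (hF j).head_zsmul (sgn ((m : ZMod N) * ((X.sh i : ZMod N) - (X.sh i₁ : ZMod N))))
      (entry (X.shift m).δElt i i₁) (entry X.δElt i i₁)
      (by simp only [entry, δElt, shift]; push_cast; ring) rfl p
    rw [e1, smul_comm]
    congr 2
    push_cast
    ring_nf

theorem MaurerCartan.shift {X : PreTw A} (h : X.MaurerCartan) (m : ℤ) :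
    (X.shift m).MaurerCartan := by
  intro i j
  have h' := h i j
  simp only [muTw, insertδ, muSum] at h' ⊢
  have : ∀ r, expand ((X.shift m).δChain r) i (fun j p => A.mu p) j =
      sgn ((m : ZMod N) * ((X.sh i : ZMod N) - (X.sh j : ZMod N))) •
        expand (X.δChain r) i (fun j p => A.mu p) j :=
    fun r => expand_shift_δChain X m r i _ (fun j => isAdditive_mu _ _) j
  calc _ = ∑ r ∈ Finset.range (Fintype.card X.I),
      sgn ((m : ZMod N) * ((X.sh i : ZMod N) - (X.sh j : ZMod N))) •
        expand (X.δChain r) i (fun j p => A.mu p) j :=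
          Finset.sum_congr rfl fun r _ => this r
    _ = 0 := by rw [← Finset.smul_sum, h', smul_zero]

/-- One step of `expand`. -/
def step {X X₁ Z : PreTw A} {V : Z.I → Type v} [∀ j, AddCommGroup (V j)] (f : Elt X X₁)
    (i : X.I) (i₁ : X₁.I) (F : ∀ j, Chain A.Elt (X.ob i) (Z.ob j) → V j) :
    ∀ j, Chain A.Elt (X₁.ob i₁) (Z.ob j) → V j := fun j p =>
  sgn (((X.sh i : ZMod N) - (X₁.sh i₁ : ZMod N)) * GradedQuiver.rdeg p) •
    F j (.cons (entry f i i₁) p)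

theorem isAdditive_step {X X₁ Z : PreTw A} {V : Z.I → Type v} [∀ j, AddCommGroup (V j)]
    (f : Elt X X₁) (i : X.I) (i₁ : X₁.I) {F : ∀ j, Chain A.Elt (X.ob i) (Z.ob j) → V j}
    (hF : ∀ j, IsAdditive (F j)) (j : Z.I) : IsAdditive (step f i i₁ F j) :=
  (hF j).cons_sgn _ _

theorem expand_cons {X X₁ Z : PreTw A} {V : Z.I → Type v} [∀ j, AddCommGroup (V j)]
    (f : Elt X X₁) (c : Chain (O := PreTw A) Elt X₁ Z) (i : X.I)
    (F : ∀ j, Chain A.Elt (X.ob i) (Z.ob j) → V j) (j : Z.I) :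
    expand (.cons f c) i F j = ∑ i₁, expand c i₁ (step f i i₁ F) j := by
  simp only [expand, Finset.sum_apply]
  rfl

theorem expand_nil_self {X : PreTw A} {V : X.I → Type v} [∀ j, AddCommGroup (V j)] (i : X.I)
    (F : ∀ j, Chain A.Elt (X.ob i) (X.ob j) → V j) : expand (.nil X) i F i = F i (.nil _) := by
  simp [expand]

theorem expand_nil_ne {X : PreTw A} {V : X.I → Type v} [∀ j, AddCommGroup (V j)] {i j : X.I}
    (h : j ≠ i) (F : ∀ j, Chain A.Elt (X.ob i) (X.ob j) → V j) : expand (.nil X) i F j = 0 := by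
  classical
  simp only [expand]
  rw [Pi.single_eq_of_ne h]

variable {X Y : PreTw A} (α : X.Hom Y 0) {V : (cone α).I → Type v} [∀ j, AddCommGroup (V j)]

/-- The part of `F` that concerns chains of `Y` in the cone. -/
def onY {j : Y.I} (F : ∀ l, Chain A.Elt ((cone α).ob (.inr j)) ((cone α).ob l) → V l) :
    ∀ l : Y.I, Chain A.Elt (Y.ob j) (Y.ob l) → V (.inr l) := fun l => F (.inr l)

/-- The part of `F` that concerns chains of `X[1]` in the cone. -/
def onX {i : X.I} (F : ∀ l, Chain A.Elt ((cone α).ob (.inl i)) ((cone α).ob l) → V l) :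
    ∀ l : (X.shift 1).I, Chain A.Elt ((X.shift 1).ob i) ((X.shift 1).ob l) → V (.inl l) :=
  fun l => F (.inl l)

/-- The part of `F` that concerns chains from `X` to `Y` in the cone. -/
def onXY {i : X.I} (F : ∀ l, Chain A.Elt ((cone α).ob (.inl i)) ((cone α).ob l) → V l) :
    ∀ l : Y.I, Chain A.Elt (X.ob i) (Y.ob l) → V (.inr l) := fun l => F (.inr l)

theorem onY_step {j j₁ : Y.I}
    (F : ∀ l, Chain A.Elt ((cone α).ob (.inr j)) ((cone α).ob l) → V l) :
    onY α (step (cone α).δElt (.inr j) (.inr j₁) F) =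
      step (V := fun l => V (.inr l)) Y.δElt j j₁ (onY α F) := rfl

theorem onX_step {i i₁ : X.I}
    (F : ∀ l, Chain A.Elt ((cone α).ob (.inl i)) ((cone α).ob l) → V l) :
    onX α (step (cone α).δElt (.inl i) (.inl i₁) F) =
      step (X := X.shift 1) (X₁ := X.shift 1) (Z := X.shift 1) (V := fun l => V (.inl l))
        (X.shift 1).δElt i i₁ (onX α F) := rfl

theorem expand_cone_succ (r : ℕ) (x y : (cone α).I)
    (F : ∀ l, Chain A.Elt ((cone α).ob x) ((cone α).ob l) → V l) :
    expand ((cone α).δChain (r + 1)) x F y =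
      (∑ i₁ : X.I, expand ((cone α).δChain r) (.inl i₁) (step (cone α).δElt x (.inl i₁) F) y) +
      ∑ j₁ : Y.I, expand ((cone α).δChain r) (.inr j₁) (step (cone α).δElt x (.inr j₁) F) y :=
  (expand_cons _ _ _ _ _).trans (Fintype.sum_sum_type _)

theorem expand_cone_inr (r : ℕ) :
    ∀ (j : Y.I) (F : ∀ l, Chain A.Elt ((cone α).ob (.inr j)) ((cone α).ob l) → V l)
    (_ : ∀ l, IsAdditive (F l)),
    (∀ l, expand ((cone α).δChain r) (.inr j) F (.inr l) =
      expand (V := fun l => V (.inr l)) (Y.δChain r) j (onY α F) l) ∧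
    ∀ l, expand ((cone α).δChain r) (.inr j) F (.inl l) = 0 := by
  induction r with
  | zero =>
    intro j F hF
    refine ⟨fun l => ?_, fun l => ?_⟩
    · by_cases h : l = j
      · subst h
        exact (expand_nil_self (X := cone α) _ F).trans
          (expand_nil_self (V := fun l => V (.inr l)) l (onY α F)).symm
      · exact (expand_nil_ne (X := cone α) (fun h' => h (Sum.inr_injective h')) F).trans
          (expand_nil_ne (V := fun l => V (.inr l)) h (onY α F)).symm
    · exact expand_nil_ne (X := cone α) (by simp) F
  | succ r ih =>
    intro j F hF
    have hl : ∀ (i₁ : X.I) y, expand ((cone α).δChain r) (.inl i₁)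
        (step (cone α).δElt (.inr j) (.inl i₁) F) y = 0 := fun i₁ y =>
      congrFun (expand_zero _ _ _ fun l p => (congrArg (_ • ·)
        ((hF l).head_zero (entry (cone α).δElt (.inr j) (.inl i₁)) rfl p)).trans
        (smul_zero _)) y
    have hr := fun j₁ : Y.I => ih j₁ (step (cone α).δElt (.inr j) (.inr j₁) F)
        (isAdditive_step _ _ _ hF)
    refine ⟨fun l => ?_, fun l => ?_⟩
    · rw [expand_cone_succ, Finset.sum_eq_zero fun i₁ _ => hl i₁ _, zero_add]
      rw [Finset.sum_congr rfl fun j₁ _ => (hr j₁).1 l, δChain, expand_cons]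
      rfl
    · rw [expand_cone_succ, Finset.sum_eq_zero fun i₁ _ => hl i₁ _, zero_add]
      exact Finset.sum_eq_zero fun j₁ _ => (hr j₁).2 l

theorem expand_cone_inl_inl (r : ℕ) :
    ∀ (i : X.I) (F : ∀ l, Chain A.Elt ((cone α).ob (.inl i)) ((cone α).ob l) → V l)
    (_ : ∀ l, IsAdditive (F l)) (l : X.I),
    expand ((cone α).δChain r) (.inl i) F (.inl l) =
      expand (X := X.shift 1) (Y := X.shift 1) (V := fun l => V (.inl l))
        ((X.shift 1).δChain r) i (onX α F) l := by
  induction r with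
  | zero =>
    intro i F hF l
    by_cases h : l = i
    · subst h
      exact (expand_nil_self (X := cone α) _ F).trans
        (expand_nil_self (X := X.shift 1) (V := fun l => V (.inl l)) l (onX α F)).symm
    · exact (expand_nil_ne (X := cone α) (fun h' => h (Sum.inl_injective h')) F).trans
        (expand_nil_ne (X := X.shift 1) (V := fun l => V (.inl l)) h (onX α F)).symm
  | succ r ih =>
    intro i F hF l
    rw [expand_cone_succ, Finset.sum_eq_zero (s := (Finset.univ : Finset Y.I)) fun j₁ _ =>
      (expand_cone_inr α r j₁ _ (isAdditive_step _ _ _ hF)).2 l, add_zero]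
    rw [Finset.sum_congr rfl fun i₁ _ => ih i₁ _ (isAdditive_step _ _ _ hF) l]
    exact (expand_cons (X := X.shift 1) (X₁ := X.shift 1) (Z := X.shift 1)
      (V := fun l => V (.inl l)) (X.shift 1).δElt ((X.shift 1).δChain r) i (onX α F) l).symm

theorem expand_cone_inl_inr (r : ℕ) :
    ∀ (i : X.I) (F : ∀ l, Chain A.Elt ((cone α).ob (.inl i)) ((cone α).ob l) → V l)
    (_ : ∀ l, IsAdditive (F l)) (l : Y.I),
    expand ((cone α).δChain r) (.inl i) F (.inr l) =
      -(sgn ((X.sh i : ZMod N) - (Y.sh l : ZMod N)) • ∑ a ∈ Finset.range r,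
        expand (V := fun l => V (.inr l))
          ((X.δChain a).append (.cons (toElt α) (Y.δChain (r - 1 - a)))) i
          (onXY α F) l) := by
  induction r with
  | zero =>
    intro i F hF l
    rw [Finset.sum_range_zero, smul_zero, neg_zero]
    exact expand_nil_ne (X := cone α) (by simp) F
  | succ r ih =>
    intro i F hF l
    have hr := fun j₁ : Y.I => (expand_cone_inr α r j₁ _
      (isAdditive_step (cone α).δElt (.inl i) (.inr j₁) hF)).1 l
    have hl := fun i₁ : X.I => ih i₁ _
      (isAdditive_step (cone α).δElt (.inl i) (.inl i₁) hF) l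
    rw [expand_cone_succ, Finset.sum_congr rfl (fun j₁ _ => hr j₁),
      Finset.sum_congr rfl (fun i₁ _ => hl i₁), Finset.sum_range_succ', smul_add, neg_add]
    congr 1
    · -- the first step stays in `X`
      rw [Finset.smul_sum, ← Finset.sum_neg_distrib]
      simp only [δChain, Chain.append, expand_cons, Finset.smul_sum, ← Finset.sum_neg_distrib]
      rw [Finset.sum_comm]
      refine Finset.sum_congr rfl fun a ha => Finset.sum_congr rfl fun i₁ _ => ?_
      have ea : r + 1 - 1 - (a + 1) = r - 1 - a := by omega
      rw [ea]
      congr 1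
      rw [← sub_add_sub_cancel (X.sh i : ZMod N) (X.sh i₁ : ZMod N) (Y.sh l : ZMod N),
        sgn_add A.even_period, mul_comm, mul_smul]
      congr 1
      rw [← expand_zsmul (V := fun l => V (.inr l)) _ _ _ (fun _ => _)]
      refine congrFun (expand_congr (V := fun l => V (.inr l)) _ _ _ _ fun l p _ => ?_) l
      have e1 := (hF (.inr l)).head_zsmul (sgn ((X.sh i : ZMod N) - (X.sh i₁ : ZMod N)))
        (entry (cone α).δElt (.inl i) (.inl i₁)) (entry X.δElt i i₁)
        (by simp only [entry, δElt, Sum.elim_inl]; push_cast; ring)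
        (by simp only [entry, δElt]; push_cast; rw [one_mul]; rfl) p
      refine (congrArg (_ • ·) e1).trans ((smul_comm _ _ _).trans ?_)
      refine congrArg (_ • ·) (congrArg (· • _) (congrArg (fun z => sgn (z * _)) ?_))
      simp only [Sum.elim_inl]
      push_cast
      ring
    · -- the first step goes to `Y`
      simp only [δChain, Chain.append, Nat.sub_zero, Nat.add_sub_cancel]
      refine Eq.trans ?_ (congrArg (fun z => -(_ • z)) (expand_cons (V := fun l => V (.inr l))
        (toElt α) (Y.δChain r) i (onXY α F) l)).symm
      rw [Finset.smul_sum, ← Finset.sum_neg_distrib]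
      refine Finset.sum_congr rfl fun j₁ _ => ?_
      rw [← neg_smul, ← expand_zsmul (V := fun l => V (.inr l)) _ _ _
        (fun l => -sgn ((X.sh i : ZMod N) - (Y.sh l : ZMod N)))]
      refine congrFun (expand_congr (V := fun l => V (.inr l)) _ _ _ _ fun l p hp => ?_) l
      have e1 := (hF (.inr l)).head_zsmul (-sgn ((X.sh i : ZMod N) - (Y.sh j₁ : ZMod N)))
        (entry (cone α).δElt (.inl i) (.inr j₁)) (entry (toElt α) i j₁)
        (by simp only [entry, δElt, toElt, Sum.elim_inl, Sum.elim_inr]; push_cast; ring)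
        (by simp only [entry, δElt, toElt]; exact (neg_smul _ _).symm) p
      refine (congrArg (_ • ·) e1).trans ?_
      refine (smul_smul _ _ _).trans (Eq.trans ?_ (smul_smul _ _ _).symm)
      refine congrArg (· • _) ?_
      rw [wdeg_δChain, zero_sub] at hp
      simp only [Sum.elim_inl, Sum.elim_inr, hp]
      have h1 : ((((X.sh i + 1 : ℤ)) : ZMod N) - (Y.sh j₁ : ZMod N)) *
          (-(Y.sh j₁ : ZMod N) + (Y.sh l : ZMod N)) =
          ((X.sh i : ZMod N) - (Y.sh j₁ : ZMod N)) * (-(Y.sh j₁ : ZMod N) + (Y.sh l : ZMod N)) +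
            ((Y.sh l : ZMod N) - (Y.sh j₁ : ZMod N)) := by push_cast; ring
      rw [h1, sgn_add A.even_period, sgn_sub A.even_period (Y.sh l : ZMod N),
        sgn_sub A.even_period (X.sh i : ZMod N) (Y.sh l : ZMod N),
        sgn_sub A.even_period (X.sh i : ZMod N) (Y.sh j₁ : ZMod N)]
      have h2 := sgn_mul_self (Y.sh j₁ : ZMod N)
      linear_combination (-(sgn (((X.sh i : ZMod N) - (Y.sh j₁ : ZMod N)) *
        (-(Y.sh j₁ : ZMod N) + (Y.sh l : ZMod N)))) * sgn (Y.sh l : ZMod N) *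
        sgn (X.sh i : ZMod N)) * h2

/-- Reindexing of a double sum by the total number of insertions. -/
theorem sum_range_split {M : Type v} [AddCommMonoid M] (m n : ℕ) (T : ℕ → ℕ → M)
    (h : ∀ a b, m ≤ a ∨ n ≤ b → T a b = 0) :
    ∑ r ∈ Finset.range (m + n), ∑ a ∈ Finset.range r, T a (r - 1 - a) =
      ∑ a ∈ Finset.range m, ∑ b ∈ Finset.range n, T a b := by
  rw [Finset.sum_sigma', ← Finset.sum_product']
  refine Finset.sum_bij_ne_zero (fun x _ _ => (x.2, x.1 - 1 - x.2)) ?_ ?_ ?_ ?_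
  · rintro ⟨r, a⟩ hra h0
    simp only [Finset.mem_product, Finset.mem_range]
    by_contra hc
    exact h0 (h _ _ (by simp only at hc ⊢; omega))
  · rintro ⟨r, a⟩ h1 _ ⟨r', a'⟩ h2 _ h3
    simp only [Finset.mem_sigma, Finset.mem_range, Prod.mk.injEq] at h1 h2 h3
    obtain ⟨rfl, h3⟩ := h3
    obtain rfl : r = r' := by omega
    rfl
  · rintro ⟨a, b⟩ hab h0
    simp only [Finset.mem_product, Finset.mem_range] at hab
    have e : a + b + 1 - 1 - a = b := by omega
    refine ⟨⟨a + b + 1, a⟩, by simp only [Finset.mem_sigma, Finset.mem_range]; omega, ?_, ?_⟩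
    · simpa only [e] using h0
    · simp only [e]
  · rintro ⟨r, a⟩ _ _; rfl

theorem sum_range_add_eq_zero {M : Type v} [AddCommMonoid M] (f : ℕ → M) (m n : ℕ)
    (h : ∑ r ∈ Finset.range m, f r = 0) (h' : ∀ r, m ≤ r → f r = 0) :
    ∑ r ∈ Finset.range (m + n), f r = 0 := by
  rw [Finset.sum_range_add, h, zero_add]
  exact Finset.sum_eq_zero fun r _ => h' _ (Nat.le_add_right _ _)

theorem neg_zsmul_eq_zero {M : Type v} [AddCommGroup M] (m : ℤ) {x : M} (h : x = 0) :
    -(m • x) = 0 := by rw [h, smul_zero, neg_zero]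

theorem MaurerCartan.cone (hX : X.MaurerCartan) (hY : Y.MaurerCartan) (hα : IsClosed α) :
    (PreTw.cone α).MaurerCartan := by
  have hadd : ∀ i l, IsAdditive (fun p : Chain A.Elt i l => A.mu p) := isAdditive_mu
  have hcard : Fintype.card (PreTw.cone α).I = Fintype.card X.I + Fintype.card Y.I :=
    Fintype.card_sum
  rintro (i | i) (l | l)
  · have h := hX.shift 1 i l
    simp only [muTw, insertδ, muSum] at h ⊢
    rw [hcard, Finset.sum_congr rfl (fun r _ => expand_cone_inl_inl α r i (fun _ p => A.mu p)
      (fun _ => hadd _ _) l)]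
    exact sum_range_add_eq_zero _ _ _ h fun r hr => congrFun (expand_δChain_zero
      (X := X.shift 1) hr i (fun _ p => A.mu p) (fun _ => hadd _ _)) l
  · have h := congrFun (congrFun hα i) l
    simp only [muTw₁, muTw, Chain.single, insertδ, muSum, Pi.zero_apply] at h
    simp only [muTw, insertδ, muSum]
    rw [hcard, Finset.sum_congr rfl (fun r _ => expand_cone_inl_inr α r i (fun _ p => A.mu p)
      (fun _ => hadd _ _) l), Finset.sum_neg_distrib, ← Finset.smul_sum]
    have h' := sum_range_split (Fintype.card X.I) (Fintype.card Y.I) (fun a b =>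
      expand ((X.δChain a).append (.cons (toElt α) (Y.δChain b))) i
        (fun _ p => A.mu p) l) (by
      rintro a b (hab | hab)
      · exact congrFun (expand_δChain_append_zero _ hab i _ fun _ => hadd _ _) l
      · refine congrFun (expand_append_zero (X.δChain a) _ (fun i F hF => ?_) i _
          fun _ => hadd _ _) l
        exact Finset.sum_eq_zero fun i₁ _ =>
          expand_δChain_zero hab i₁ _ fun j => (hF j).cons_sgn _ _)
    exact neg_zsmul_eq_zero _ (h'.trans h)
  · simp only [muTw, insertδ, muSum]
    exact Finset.sum_eq_zero fun r _ =>
      (expand_cone_inr α r i (fun _ p => A.mu p) (fun _ => hadd _ _)).2 l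
  · have h := hY i l
    simp only [muTw, insertδ, muSum] at h ⊢
    rw [hcard, Finset.sum_congr rfl (fun r _ => (expand_cone_inr α r i (fun _ p => A.mu p)
      (fun _ => hadd _ _)).1 l), add_comm]
    exact sum_range_add_eq_zero _ _ _ h fun r hr => congrFun (expand_δChain_zero
      hr i (fun _ p => A.mu p) (fun _ => hadd _ _)) l

end Facts

end PreTw

/-- Twisted complexes over `A`, the objects of `Tw(A)`. -/
structure Tw {k : Type w} [Field k] {N : ℕ} (A : AInfCategory.{u, v, w} k N) extends PreTw A where
  maurerCartan : toPreTw.MaurerCartan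

namespace Tw

open PreTw

variable {k : Type w} [Field k] {N : ℕ} {A : AInfCategory.{u, v, w} k N}

/-- `hom^g_Tw(X, Y)` -/
abbrev Hom (X Y : Tw A) (g : ZMod N) : Submodule k (∀ i j, A.Hom (X.ob i) (Y.ob j)) :=
  PreTw.Hom X.toPreTw Y.toPreTw g

/-- The shift `X[m]`. -/
@[reducible]
def shift (X : Tw A) (m : ℤ) : Tw A := ⟨X.toPreTw.shift m, X.maurerCartan.shift m⟩

/-- The shift `f[m]`. -/
def shiftHom {X Y : Tw A} {g : ZMod N} (f : X.Hom Y g) (m : ℤ) :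
    (X.shift m).Hom (Y.shift m) g := PreTw.shiftHom f m

/-- The mapping cone of a closed morphism `α` of degree zero. -/
@[reducible]
def cone {X Y : Tw A} (α : X.Hom Y 0) (hα : IsClosed α) : Tw A :=
  ⟨PreTw.cone α, X.maurerCartan.cone α Y.maurerCartan hα⟩

/-- The zero object of `Tw(A)`. -/
def zero (A : AInfCategory.{u, v, w} k N) : Tw A := ⟨PreTw.zero A, fun i => i.elim⟩

/-- `comp b a = μ²_Tw(b, a)` for morphisms of degree zero. Its class in `H⁰(Tw(A))` is the
composition `[b] ∘ [a]`. -/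
def comp {X Y Z : Tw A} (b : Y.Hom Z 0) (a : X.Hom Y 0) : X.Hom Z 0 :=
  ⟨muTw (.cons (toElt a) (.single (toElt b))), by
    have h := muTw_mem (.cons (toElt a) (.single (toElt b)))
    have e : wdeg (.cons (toElt a) (.single (toElt b))) + 2 = 0 := by
      simp only [wdeg, toElt, Chain.single]; ring
    rwa [e] at h⟩

open Classical in
/-- The identity of `X`: the diagonal matrix of the strict units. -/
def id (U : A.StrictUnits) (X : Tw A) : X.Hom X 0 :=
  ⟨fun i => Pi.single i (U.e (X.ob i)).1, fun i j => by
    change (Pi.single i (U.e (X.ob i)).1 : ∀ l, A.Hom (X.ob i) (X.ob l)) j ∈ _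
    by_cases h : j = i
    · subst h
      rw [Pi.single_eq_same]
      exact mem_gr (U.e _).2 (by ring)
    · rw [Pi.single_eq_of_ne h]
      exact zero_mem _⟩

/-- Equality of classes in cohomology: `f - f' = μ¹_Tw(h)` for some `h` of degree `-1`. -/
def Homotopic {X Y : Tw A} (f f' : X.Hom Y 0) : Prop :=
  ∃ h : X.Hom Y (-1), f.1 - f'.1 = muTw₁ h

/-- `f` is closed and its class is invertible in `H⁰(Tw(A))`. -/
def IsQuasiIso (U : A.StrictUnits) {X Y : Tw A} (f : X.Hom Y 0) : Prop :=
  IsClosed f ∧ ∃ g : Y.Hom X 0, IsClosed g ∧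
    Homotopic (comp g f) (id U X) ∧ Homotopic (comp f g) (id U Y)

def QuasiIsomorphic (U : A.StrictUnits) (X Y : Tw A) : Prop :=
  ∃ f : X.Hom Y 0, IsQuasiIso U f

/-- `X` is a direct summand (a retract) of `Y` in `H⁰(Tw(A))`. -/
def IsDirectSummand (U : A.StrictUnits) (X Y : Tw A) : Prop :=
  ∃ (i : X.Hom Y 0) (p : Y.Hom X 0), IsClosed i ∧ IsClosed p ∧ Homotopic (comp p i) (id U X)

/-- `K` split-generates an object if the object is obtained from `K` by taking shifts, cones of
closed morphisms of degree zero and direct summands (in particular, quasi-isomorphic objects)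
finitely many times. -/
inductive SplitGenerates (U : A.StrictUnits) (K : Tw A) : Tw A → Prop
  | self : SplitGenerates U K K
  | shift {X : Tw A} (hX : SplitGenerates U K X) (m : ℤ) : SplitGenerates U K (X.shift m)
  | cone {X Y : Tw A} (hX : SplitGenerates U K X) (hY : SplitGenerates U K Y) (α : X.Hom Y 0)
      (hα : IsClosed α) : SplitGenerates U K (Tw.cone α hα)
  | summand {X Y : Tw A} (hY : SplitGenerates U K Y) (hX : IsDirectSummand U X Y) :
      SplitGenerates U K X

/-- The successive powers of `a ∈ hom⁰(X[s], X)`: `powSucc a m` is `a^(m+1) ∈ hom⁰(X[(m+1)s], X)`,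
where `a¹ = a` and `a^(m+1) = μ²(a, a^m[s])`; the source `X[ms][s]` is `X[(m+1)s]`. -/
def powSucc {X : Tw A} {s : ℤ} (a : (X.shift s).Hom X 0) :
    ∀ m : ℕ, (X.shift (((m + 1 : ℕ) : ℤ) * s)).Hom X 0
  | 0 => ⟨a.1, fun i j => mem_gr (a.2 i j) (by push_cast; ring)⟩
  | m + 1 =>
    let b : ((X.shift (((m + 1 : ℕ) : ℤ) * s)).shift s).Hom X 0 :=
      comp a (shiftHom (powSucc a m) s)
    ⟨b.1, fun i j => mem_gr (b.2 i j) (by push_cast; ring)⟩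

/-- `a^(m₁ ⊙ m₂ ⊙ ⋯ ⊙ m_r) = (⋯((a^m₁)^m₂)⋯)^m_r` for the list `(m₁ - 1, …, m_r - 1)`, as a pair
`(t, b)` with `b ∈ hom⁰(X[t], X)`. -/
def odot {X : Tw A} (a : Σ s : ℤ, (X.shift s).Hom X 0) : List ℕ → Σ s : ℤ, (X.shift s).Hom X 0
  | [] => a
  | m :: ms => odot ⟨_, powSucc a.2 m⟩ ms

/-- `a^(m₁ ⊙ ⋯ ⊙ m_r) = 0` for some `m₁, …, m_r ≥ 1`. -/
def IsNilpotent {X : Tw A} {s : ℤ} (a : (X.shift s).Hom X 0) : Prop :=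
  ∃ ms : List ℕ, (odot ⟨s, a⟩ ms).2 = 0

/-- The morphism `Cone(x)[t] → Cone(x)` of degree zero, for `x : P[s] → P`, with the entries
`a[s+1] : P[s+t+1] → P[s+1]`, `c : P[s+t+1] → P`, `a : P[t] → P`, and zero from `P[t]` to `P[s+1]`.
-/
def koszulMatrix {P : Tw A} {s t : ℤ} (x : (P.shift s).Hom P 0) (hx : IsClosed x)
    (a : (P.shift t).Hom P 0) (c : (P.shift (t + s + 1)).Hom P 0) :
    ((cone x hx).shift t).Hom (cone x hx) 0 :=
  ⟨fun
    | .inl i, .inl j => (shiftHom a (s + 1)).1 i j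
    | .inl i, .inr j => c.1 i j
    | .inr _, .inl _ => 0
    | .inr i, .inr j => a.1 i j,
  fun
    | .inl i, .inl j => mem_gr ((shiftHom a (s + 1)).2 i j) (by
        simp only [Sum.elim_inl]; push_cast; ring)
    | .inl i, .inr j => mem_gr (c.2 i j) (by
        simp only [Sum.elim_inl, Sum.elim_inr]; push_cast; ring)
    | .inr _, .inl _ => zero_mem _
    | .inr i, .inr j => mem_gr (a.2 i j) (by simp only [Sum.elim_inr])⟩

/-- The data exhibiting `K` as a Koszul twisted complex of length `n` built out of `K'`. The values
of `obj j` for `j > n`, of `a i j` unless `j ≤ i < n` and of `c i j` unless `j < i < n` play no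
role. -/
structure Koszul (K' K : Tw A) where
  n : ℕ
  /-- the objects `K_j` -/
  obj : ℕ → Tw A
  /-- the shifts `s_j` -/
  s : ℕ → ℤ
  /-- the morphisms `a_{i,j} : K_j[s_i] → K_j` of degree zero, with `a_{i,i} = x_i` -/
  a : ∀ i j : ℕ, ((obj j).shift (s i)).Hom (obj j) 0
  /-- the morphisms `c_{i,j} : K_j[s_i + s_j + 1] → K_j` of degree zero -/
  c : ∀ i j : ℕ, ((obj j).shift (s i + s j + 1)).Hom (obj j) 0
  obj_zero : obj 0 = K'
  obj_n : obj n = K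
  closed : ∀ i j, j ≤ i → i < n → IsClosed (a i j)
  /-- `K_{j+1}` is the cone of `x_j : K_j[s_j] → K_j`. -/
  obj_succ : ∀ j (hj : j < n), obj (j + 1) = cone (a j j) (closed j j le_rfl hj)
  /-- For `j < i < n`, the morphism `a_{i,j+1} : K_{j+1}[s_i] → K_{j+1}` is the morphism
  `Cone(x_j)[s_i] → Cone(x_j)` with the matrix given by `a_{i,j}[s_j+1]`, `c_{i,j}`, `a_{i,j}`. -/
  a_succ : ∀ i j (hji : j < i) (hi : i < n),
    (⟨obj (j + 1), a i (j + 1)⟩ : Σ X : Tw A, (X.shift (s i)).Hom X 0) =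
      ⟨cone (a j j) (closed j j le_rfl (hji.trans hi)),
        koszulMatrix (a j j) (closed j j le_rfl (hji.trans hi)) (a i j) (c i j)⟩

/-- The edges `a_{i,0}`, `0 ≤ i < n`. -/
def Koszul.edge {K' K : Tw A} (T : Koszul K' K) (i : ℕ) :
    ((T.obj 0).shift (T.s i)).Hom (T.obj 0) 0 := T.a i 0

end Tw

end

end Ainf

/-!
# Koszul twisted complexes with nilpotent or invertible edges

`muTw` is a sum over all paths through the entries of a chain of matrices with entries of `δ`
inserted. Everything rests on the recursion for such sums by the first step of a path (`tw_nil`,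
`tw_cons`) and on the fact that it determines them (`tw_nil_unique`, `tw_cons_unique`), by induction
along the strictly triangular matrix `δ`. It yields the `A_∞`-relations for `muTw`
(`muTw_relation`), the behaviour of strict units (`muTw_unitLike_eq_zero`, `muTw_idElt_left`), of
shifts (`muTw_shiftSource`, `muTw_shiftTarget_shiftSource`) and of block matrices
(`muTw_ext_inl`, `muTw_ext_mid`, `muTw_ext_to_inr`). Cones are treated as extensions `ext a` of a
twisted complex `Q` by `R` along a closed `a : Q → R` of degree one.

*Invertible edges.* The cone of an invertible morphism is contractible (`contractible_cone`), and
an extension of contractible twisted complexes is contractible (`Contractible.ext`). The cone of the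
morphism `Cone(x)[t] → Cone(x)` with diagonal blocks `a[s+1]` and `a` is, after a permutation of its
four summands, an extension of `Cone(±a)[s+1]` by `Cone(±a)`
(`contractible_cone_koszulMatrix`). So if an edge `a_{i,0}` is invertible, then the cones of
`a_{i,1}, …, a_{i,i} = x_i` are contractible. The last of these is `K_{i+1}`, and every later `K_j`
is an iterated extension of shifts of it.

*Nilpotent edges.* By the octahedral axiom, the cone of a composition is generated by the cones of
the factors. In the strictly unital setting it is even a strict retract of an explicit extension
(`compHom_octIncl_octProj`). So the cone of `a : X[s] → X` generates the cones of all powers of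
`a`, and if one of the iterated powers is zero, then its cone has `X` as a direct summand
(`gen_of_isNilpotent`). On the other hand, the morphisms `a_{i,j}` inherit nilpotency from the edge
`a_{i,0}`: the diagonal blocks of a power of a block triangular matrix are the powers of the
diagonal blocks, and once they vanish, the square of the matrix vanishes
(`isNilpotent_koszulMatrix`). Hence `K_{j+1} = Cone(x_j)` split-generates `K_j`, for
`j = n - 1, …, 0`.
-/

namespace Ainf

universe u v w

noncomputable section

/-! ### Sums over the ways to cut a chain -/

namespace Chain

variable {O : Type*} {E : O → O → Type*} {V : Type*}

theorem append_assoc {W X Y Z : O} (p : Chain E W X)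
    (q : Chain E X Y) (r : Chain E Y Z) : (p.append q).append r = p.append (q.append r) := by
  induction p with
  | nil => rfl
  | cons a c ih => simp only [append, ih]

/-- The part of `sumSplits` in which the beginning is not empty. -/
def sumTail [AddCommMonoid V] : {X Z : O} → Chain E X Z →
    (∀ {Y : O}, Chain E X Y → Chain E Y Z → V) → V
  | _, _, nil _, _ => 0
  | _, _, cons a c, F => sumSplits c (fun p q => F (cons a p) q)

theorem sumSplits_eq_add_sumTail [AddCommMonoid V] {X Z : O} (c : Chain E X Z)
    (F : ∀ {Y : O}, Chain E X Y → Chain E Y Z → V) :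
    c.sumSplits F = F (nil X) c + c.sumTail F := by
  cases c with
  | nil => simp [sumSplits, sumTail]
  | cons a c => rfl

theorem sumSplits_add [AddCommMonoid V] {X Z : O} (c : Chain E X Z) :
    ∀ F G : ∀ {Y : O}, Chain E X Y → Chain E Y Z → V,
    c.sumSplits (fun p q => F p q + G p q) = c.sumSplits F + c.sumSplits G := by
  induction c with
  | nil => intro F G; rfl
  | cons a c ih => intro F G; simp only [sumSplits, ih]; exact add_add_add_comm _ _ _ _

theorem sumSplits_hom {V' : Type*} [AddCommMonoid V] [AddCommMonoid V'] (φ : V →+ V') {X Z : O}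
    (c : Chain E X Z) : ∀ F : ∀ {Y : O}, Chain E X Y → Chain E Y Z → V,
    c.sumSplits (fun p q => φ (F p q)) = φ (c.sumSplits F) := by
  induction c with
  | nil => intro F; rfl
  | cons a c ih => intro F; simp only [sumSplits, ih, map_add]

theorem sumSplits_zsmul [AddCommGroup V] {X Z : O} (c : Chain E X Z) (m : ℤ)
    (F : ∀ {Y : O}, Chain E X Y → Chain E Y Z → V) :
    c.sumSplits (fun p q => m • F p q) = m • c.sumSplits F :=
  sumSplits_hom (DistribSMul.toAddMonoidHom V m) c F

theorem sumSplits_zero [AddCommMonoid V] {X Z : O} (c : Chain E X Z) :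
    c.sumSplits (fun _ _ => (0 : V)) = 0 := by
  induction c with
  | nil => rfl
  | cons a c ih => simp [sumSplits, ih]

theorem sumSplits_sum [AddCommMonoid V] {ι : Type*} (s : Finset ι) {X Z : O} (c : Chain E X Z)
    (F : ι → ∀ {Y : O}, Chain E X Y → Chain E Y Z → V) :
    c.sumSplits (fun p q => ∑ x ∈ s, F x p q) = ∑ x ∈ s, c.sumSplits (F x) := by
  classical
  induction s using Finset.induction_on with
  | empty => simp [sumSplits_zero]
  | insert a s ha ih => simp only [Finset.sum_insert ha, sumSplits_add, ih]

theorem sumSplits_congr [Add V] {X Z : O} (c : Chain E X Z) :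
    ∀ F G : ∀ {Y : O}, Chain E X Y → Chain E Y Z → V,
    (∀ {Y} (p : Chain E X Y) (q : Chain E Y Z), p.append q = c → F p q = G p q) →
    c.sumSplits F = c.sumSplits G := by
  induction c with
  | nil X => intro F G h; exact h _ _ rfl
  | cons a c ih =>
    intro F G h
    simp only [sumSplits]
    rw [h _ _ rfl, ih _ (fun p q => G (cons a p) q) fun p q e => h _ _ (by rw [append, e])]

end Chain

namespace PreTw

variable {k : Type w} [Field k] {N : ℕ} {A : AInfCategory.{u, v, w} k N}

open Chain GradedQuiver

section Paths

/-! ### Sums over paths with insertions of `δ` -/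

/-- The sum of the values of `F` over all paths from `i` to `j` whose steps are entries of the
matrices of the chain `c`, in this order, with arbitrarily many entries of the `δ`'s in between,
with the sign `◁`. For `F = μ` this is `muTw`. -/
def tw {X Y : PreTw A} {V : Y.I → Type v} [∀ j, AddCommGroup (V j)]
    (c : Chain (O := PreTw A) Elt X Y) (i : X.I)
    (F : ∀ j, Chain A.Elt (X.ob i) (Y.ob j) → V j) (j : Y.I) : V j :=
  insertδ c (fun c' => expand c' i F j)

theorem insertδ_hom {V V' : Type v} [AddCommMonoid V] [AddCommMonoid V'] (φ : V →+ V')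
    {X Y : PreTw A} (c : Chain (O := PreTw A) Elt X Y) :
    ∀ F : Chain (O := PreTw A) Elt X Y → V, insertδ c (fun c' => φ (F c')) = φ (insertδ c F) := by
  induction c with
  | nil X => intro F; simp only [insertδ, map_sum]
  | cons f c ih => intro F; simp only [insertδ, map_sum, ih]

theorem insertδ_congr {V : Type v} [AddCommMonoid V] {X Y : PreTw A}
    (c : Chain (O := PreTw A) Elt X Y) :
    ∀ F F' : Chain (O := PreTw A) Elt X Y → V, (∀ c', wdeg c' = wdeg c → F c' = F' c') →
      insertδ c F = insertδ c F' := by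
  induction c with
  | nil X =>
    intro F F' h
    exact Finset.sum_congr rfl fun r _ => h _ (by rw [wdeg_δChain]; rfl)
  | cons f c ih =>
    intro F F' h
    refine Finset.sum_congr rfl fun r _ => ih _ _ fun c' hc' => h _ ?_
    rw [wdeg_append, wdeg_δChain, zero_add, wdeg, wdeg, hc']

theorem insertδ_zero {V : Type v} [AddCommMonoid V] {X Y : PreTw A}
    (c : Chain (O := PreTw A) Elt X Y) : insertδ c (fun _ => (0 : V)) = 0 := by
  induction c with
  | nil X => simp [insertδ]
  | cons f c ih => simp [insertδ, ih]

theorem insertδ_add {V : Type v} [AddCommMonoid V] {X Y : PreTw A}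
    (c : Chain (O := PreTw A) Elt X Y) :
    ∀ F F' : Chain (O := PreTw A) Elt X Y → V,
      insertδ c (fun c' => F c' + F' c') = insertδ c F + insertδ c F' := by
  induction c with
  | nil X => intro F F'; simp only [insertδ, Finset.sum_add_distrib]
  | cons f c ih => intro F F'; simp only [insertδ, ih, Finset.sum_add_distrib]

theorem insertδ_sum {V : Type v} [AddCommMonoid V] {X Y : PreTw A} {ι : Type*} (s : Finset ι)
    (c : Chain (O := PreTw A) Elt X Y) (F : ι → Chain (O := PreTw A) Elt X Y → V) :
      insertδ c (fun c' => ∑ x ∈ s, F x c') = ∑ x ∈ s, insertδ c (F x) := by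
  classical
  induction s using Finset.induction_on with
  | empty => simp [insertδ_zero]
  | insert a s ha ih => simp only [Finset.sum_insert ha, insertδ_add, ih]

theorem expand_add {X Y : PreTw A} (c : Chain (O := PreTw A) Elt X Y) :
    ∀ {V : Y.I → Type v} [∀ j, AddCommGroup (V j)] (i : X.I)
    (F F' : ∀ j, Chain A.Elt (X.ob i) (Y.ob j) → V j) (j : Y.I),
    expand c i (fun j p => F j p + F' j p) j = expand c i F j + expand c i F' j := by
  induction c with
  | nil X =>
    intro V _ i F F' j
    classical
    by_cases h : j = i
    · subst h; simp [expand_nil_self]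
    · simp [expand_nil_ne h]
  | cons f c ih =>
    intro V _ i F F' j
    simp only [expand_cons, ← Finset.sum_add_distrib, ← ih]
    refine Finset.sum_congr rfl fun i₁ _ => ?_
    refine congrFun (congrArg _ (funext fun j => funext fun p => ?_)) j
    simp only [step, smul_add]

variable {X Y Z W : PreTw A} {V : Z.I → Type v} [∀ j, AddCommGroup (V j)]

theorem tw_congr (c : Chain (O := PreTw A) Elt X Z) (i : X.I)
    (F F' : ∀ j, Chain A.Elt (X.ob i) (Z.ob j) → V j)
    (h : ∀ j p, GradedQuiver.rdeg p = wdeg c - (X.sh i : ZMod N) + (Z.sh j : ZMod N) →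
      F j p = F' j p) (j : Z.I) : tw c i F j = tw c i F' j :=
  insertδ_congr c _ _ fun c' hc' => congrFun (expand_congr c' i F F' fun j p hp =>
    h j p (by rw [hp, hc'])) j

theorem tw_hom {V' : Z.I → Type v} [∀ j, AddCommGroup (V' j)]
    (c : Chain (O := PreTw A) Elt X Z) (i : X.I)
    (F : ∀ j, Chain A.Elt (X.ob i) (Z.ob j) → V j) (φ : ∀ j, V j →+ V' j) (j : Z.I) :
    tw c i (fun j p => φ j (F j p)) j = φ j (tw c i F j) := by
  simp only [tw, expand_hom, insertδ_hom]

theorem tw_zsmul (c : Chain (O := PreTw A) Elt X Z) (i : X.I)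
    (F : ∀ j, Chain A.Elt (X.ob i) (Z.ob j) → V j) (m : Z.I → ℤ) (j : Z.I) :
    tw c i (fun j p => m j • F j p) j = m j • tw c i F j :=
  tw_hom c i F (fun j => DistribSMul.toAddMonoidHom (V j) (m j)) j

theorem tw_add (c : Chain (O := PreTw A) Elt X Z) (i : X.I)
    (F F' : ∀ j, Chain A.Elt (X.ob i) (Z.ob j) → V j) (j : Z.I) :
    tw c i (fun j p => F j p + F' j p) j = tw c i F j + tw c i F' j := by
  simp only [tw, expand_add, insertδ_add]

theorem tw_zero (c : Chain (O := PreTw A) Elt X Z) (i : X.I)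
    (F : ∀ j, Chain A.Elt (X.ob i) (Z.ob j) → V j) (h : ∀ j p, F j p = 0) (j : Z.I) :
    tw c i F j = 0 := by
  simp only [tw, expand_zero _ _ _ h, Pi.zero_apply, insertδ_zero]

/-- A step along a vanishing entry contributes nothing. -/
theorem tw_step_zero (c : Chain (O := PreTw A) Elt Y Z) (f : Elt X Y) (i : X.I) (i₁ : Y.I)
    {F : ∀ j, Chain A.Elt (X.ob i) (Z.ob j) → V j} (hF : ∀ j, IsAdditive (F j))
    (h : f.2.1 i i₁ = 0) (j : Z.I) : tw c i₁ (step f i i₁ F) j = 0 :=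
  tw_zero _ _ _ (fun j p => by
    simp only [step]; rw [(hF j).head_zero (entry f i i₁) h, smul_zero]) j

theorem sum_range_card_succ {M : Type*} [AddCommMonoid M] (n : ℕ) (f : ℕ → M) (h : f n = 0) :
    ∑ r ∈ Finset.range n, f r = f 0 + ∑ r ∈ Finset.range n, f (r + 1) := by
  have h1 := Finset.sum_range_succ f n
  rw [Finset.sum_range_succ', h, add_zero] at h1
  rw [← h1, add_comm]

/-- A path along the empty chain is constant or starts with an entry of `δ`. -/
theorem tw_nil (i : Z.I) {F : ∀ j, Chain A.Elt (Z.ob i) (Z.ob j) → V j}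
    (hF : ∀ j, IsAdditive (F j)) (j : Z.I) :
    tw (.nil Z) i F j = expand (.nil Z) i F j +
      ∑ i₁, tw (.nil Z) i₁ (step Z.δElt i i₁ F) j := by
  simp only [tw, insertδ]
  rw [sum_range_card_succ _ (fun r => expand (Z.δChain r) i F j)
    (congrFun (expand_δChain_zero le_rfl i F hF) j)]
  simp only [δChain, expand_cons]
  rw [Finset.sum_comm]

/-- A path starts with an entry of `δ` or of the first matrix of the chain. -/
theorem tw_cons (f : Elt X Y) (c : Chain (O := PreTw A) Elt Y Z) (i : X.I)
    {F : ∀ j, Chain A.Elt (X.ob i) (Z.ob j) → V j} (hF : ∀ j, IsAdditive (F j)) (j : Z.I) :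
    tw (.cons f c) i F j = ∑ i₁, tw (.cons f c) i₁ (step X.δElt i i₁ F) j +
      ∑ i₁, tw c i₁ (step f i i₁ F) j := by
  simp only [tw, insertδ]
  rw [sum_range_card_succ _ (fun r => insertδ c fun c' =>
    expand ((X.δChain r).append (.cons f c')) i F j), add_comm]
  · simp only [δChain, Chain.append, expand_cons, insertδ_sum]
    rw [Finset.sum_comm]
  · simp only [expand_δChain_append_zero _ le_rfl i F hF, Pi.zero_apply, insertδ_zero]

/-- Induction along the nonzero entries of the strictly triangular matrix `δ`. -/
theorem δ_induction (X : PreTw A) {P : X.I → Prop}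
    (h : ∀ i, (∀ i₁, X.δ i i₁ ≠ 0 → P i₁) → P i) (i : X.I) : P i := by
  obtain ⟨rank, hrank⟩ := X.triangular
  have key : ∀ (n : ℕ) (i : X.I), Finset.univ.sup rank ≤ n + rank i → P i := by
    intro n
    induction n with
    | zero =>
      intro i hi
      refine h i fun i₁ h₁ => ?_
      have := hrank _ _ h₁
      have := Finset.le_sup (f := rank) (Finset.mem_univ i₁)
      omega
    | succ n ih =>
      intro i hi
      refine h i fun i₁ h₁ => ih _ ?_
      have := hrank _ _ h₁
      omega
  exact key _ i (Nat.le_add_right _ _)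

end Paths

theorem isAdditive_sumSplits {X Z : A.Ob} {V : Type v} [AddCommGroup V]
    (H : ∀ {Y : A.Ob}, Chain A.Elt X Y → Chain A.Elt Y Z → V)
    (h₁ : ∀ {Y} (r : Chain A.Elt Y Z), IsAdditive (fun q => H q r))
    (h₂ : ∀ {Y} (q : Chain A.Elt X Y), IsAdditive (fun r => H q r)) :
    IsAdditive (fun e : Chain A.Elt X Z => e.sumSplits H) := by
  intro U W p g a b q
  induction p with
  | nil X =>
    simp only [append, sumSplits]
    have e1 := h₂ (nil X) (nil X) g a b q
    have e2 : ∀ {Y} (s : Chain A.Elt W Y) (r : Chain A.Elt Y Z),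
        H (cons ⟨g, a + b⟩ s) r = H (cons ⟨g, a⟩ s) r + H (cons ⟨g, b⟩ s) r :=
      fun s r => h₁ r (nil X) g a b s
    simp only [append] at e1
    rw [e1]
    simp only [e2, sumSplits_add]
    exact add_add_add_comm _ _ _ _
  | cons x p ih =>
    simp only [append, sumSplits]
    have e1 := h₂ (nil _) (cons x p) g a b q
    simp only [append] at e1
    have := ih (fun q r => H (cons x q) r)
      (fun r W Z p g a b q => h₁ r (cons x p) g a b q) (fun q => h₂ (cons x q)) a b
    exact (congrArg₂ (· + ·) e1 this).trans (add_add_add_comm _ _ _ _)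

variable (A) in
theorem exists_projection (X Y : A.Ob) (g : ZMod N) :
    ∃ φ : A.Hom X Y →ₗ[k] A.gr X Y g, ∀ x : A.gr X Y g, φ x = x := by
  obtain ⟨φ, hφ⟩ := LinearMap.exists_leftInverse_of_injective (A.gr X Y g).subtype
    (Submodule.ker_subtype _)
  exact ⟨φ, fun x => LinearMap.congr_fun hφ x⟩

/-- A projection of `y` to the morphisms of degree `g`. It serves to apply functions of homogeneous
morphisms to sums without carrying along proofs of homogeneity. -/
def proj {X Y : A.Ob} (g : ZMod N) (y : A.Hom X Y) : A.Elt X Y :=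
  ⟨g, (exists_projection A X Y g).choose y⟩

theorem proj_coe {X Y : A.Ob} (a : A.Elt X Y) : proj a.1 (a.2 : A.Hom X Y) = a :=
  Sigma.ext rfl (heq_of_eq ((exists_projection A X Y a.1).choose_spec a.2))

theorem proj_of_mem {X Y : A.Ob} {g : ZMod N} {y : A.Hom X Y} (h : y ∈ A.gr X Y g) :
    proj g y = ⟨g, y, h⟩ := proj_coe ⟨g, y, h⟩

/-- An additive function of chains, as a homomorphism in the first entry. -/
def headHom {X Y Z : A.Ob} {V : Type v} [AddCommGroup V] {F : Chain A.Elt X Z → V}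
    (hF : IsAdditive F) (g : ZMod N) (r : Chain A.Elt Y Z) : A.Hom X Y →+ V :=
  AddMonoidHom.mk' (fun y => F (cons (proj g y) r)) fun y y' => by
    simp only [proj, map_add]
    exact hF (nil X) g _ _ r

theorem headHom_apply {X Y Z : A.Ob} {V : Type v} [AddCommGroup V] {F : Chain A.Elt X Z → V}
    (hF : IsAdditive F) (g : ZMod N) (r : Chain A.Elt Y Z) (y : A.Hom X Y) :
    headHom hF g r y = F (cons (proj g y) r) := rfl

theorem IsAdditive.zsmul_const {X Y : A.Ob} {V : Type v} [AddCommGroup V]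
    {F : Chain A.Elt X Y → V} (hF : IsAdditive F) (m : ℤ) :
    IsAdditive (fun p : Chain A.Elt X Y => m • F p) := by
  intro W Z p g x y q
  have := hF p g x y q
  simp only [this, smul_add]

theorem IsAdditive.add {X Y : A.Ob} {V : Type v} [AddCommGroup V]
    {F G : Chain A.Elt X Y → V} (hF : IsAdditive F) (hG : IsAdditive G) :
    IsAdditive (fun p : Chain A.Elt X Y => F p + G p) := by
  intro W Z p g x y q
  have := hF p g x y q
  have := hG p g x y q
  simp only [*]
  exact add_add_add_comm _ _ _ _

/-! ### Cutting the paths of twisted complexes -/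

section Cut

variable {Z : PreTw A} {V : Z.I → Type v} [∀ j, AddCommGroup (V j)] {W : A.Ob}
  {F : ∀ j, Chain A.Elt W (Z.ob j) → V j}

/-- The summand `± F (φ q, r)` belonging to a cut of a chain into `q` and `r`. The entry `φ q` is
given the degree `rdeg q + d`, and `t` accounts for the sign of the steps before the chain. -/
def cutSum {X : A.Ob} (F : ∀ j, Chain A.Elt W (Z.ob j) → V j)
    (φ : ∀ B, Chain A.Elt X B → A.Hom W B) (d t : ZMod N) (j : Z.I)
    {B : A.Ob} (q : Chain A.Elt X B) (r : Chain A.Elt B (Z.ob j)) : V j :=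
  sgn (t * rdeg r) • F j (cons (proj (rdeg q + d) (φ B q)) r)

/-- The sum of `± F (y i₁, r')` over the paths `r'` along the chain `r`, where `i₁` is the start of
`r'`. It is applied to families `y` of sums over the paths that end in `i₁`. -/
def glue (hF : ∀ j, IsAdditive (F j)) (t D : ZMod N) {Y : PreTw A}
    (r : Chain (O := PreTw A) Elt Y Z) (j : Z.I) : (∀ i₁ : Y.I, A.Hom W (Y.ob i₁)) →+ V j :=
  AddMonoidHom.mk' (fun y => ∑ i₁, tw r i₁ (fun j r' => sgn ((t - (Y.sh i₁ : ZMod N)) * rdeg r') •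
    headHom (hF j) (D + (Y.sh i₁ : ZMod N)) r' (y i₁)) j) fun y y' => by
    simp only [Pi.add_apply, map_add, smul_add, tw_add, Finset.sum_add_distrib]

theorem isAdditive_cutSum_left (hF : ∀ j, IsAdditive (F j)) {X : A.Ob}
    {φ : ∀ B, Chain A.Elt X B → A.Hom W B} (hφ : ∀ B, IsAdditive (φ B)) (d t : ZMod N)
    (j : Z.I) {B : A.Ob} (r : Chain A.Elt B (Z.ob j)) :
    IsAdditive (fun q => cutSum F φ d t j q r) := by
  intro U T p g a b q
  simp only [cutSum, ← headHom_apply (hF j), hφ B p g a b q, map_add, smul_add, rdeg_append, rdeg]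

theorem isAdditive_cutSum (hF : ∀ j, IsAdditive (F j)) {X : A.Ob}
    {φ : ∀ B, Chain A.Elt X B → A.Hom W B} (hφ : ∀ B, IsAdditive (φ B)) (d t : ZMod N)
    (j : Z.I) : IsAdditive (fun e : Chain A.Elt X (Z.ob j) => e.sumSplits (cutSum F φ d t j)) :=
  isAdditive_sumSplits _ (isAdditive_cutSum_left hF hφ d t j)
    fun _ => (hF j).cons_sgn _ _

theorem isAdditive_cutSum_tail (hF : ∀ j, IsAdditive (F j)) {X : A.Ob}
    {φ : ∀ B, Chain A.Elt X B → A.Hom W B} (hφ : ∀ B, IsAdditive (φ B)) (d t : ZMod N)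
    (j : Z.I) : IsAdditive (fun e : Chain A.Elt X (Z.ob j) => e.sumTail (cutSum F φ d t j)) := by
  have h1 := (isAdditive_cutSum hF hφ d t j).add
    (((hF j).cons_sgn (proj (rdeg (nil X) + d) (φ X (nil X))) t).zsmul_const (-1))
  refine (congrArg IsAdditive (funext fun e => ?_)).mp h1
  rw [sumSplits_eq_add_sumTail, neg_smul, one_smul, cutSum]
  exact add_neg_cancel_comm _ _

theorem isAdditive_step_fun {X Y : PreTw A} (f : Elt X Y) (i : X.I) (i' : Y.I)
    {φ : ∀ B, Chain A.Elt (X.ob i) B → A.Hom W B} (hφ : ∀ B, IsAdditive (φ B)) (B : A.Ob) :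
    IsAdditive (fun q : Chain A.Elt (Y.ob i') B =>
      sgn (((X.sh i : ZMod N) - (Y.sh i' : ZMod N)) * rdeg q) • φ B (cons (entry f i i') q)) :=
  (hφ B).cons_sgn _ _

theorem step_cutSum_tail (hF : ∀ j, IsAdditive (F j)) {X Y : PreTw A} (f : Elt X Y) (i : X.I)
    (i' : Y.I) (φ : ∀ B, Chain A.Elt (X.ob i) B → A.Hom W B) (d t : ZMod N) :
    step f i i' (fun j (e : Chain A.Elt (X.ob i) (Z.ob j)) => e.sumTail (cutSum F φ d t j)) =
      fun j e => e.sumSplits (cutSum F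
        (fun B q => sgn (((X.sh i : ZMod N) - (Y.sh i' : ZMod N)) * rdeg q) •
          φ B (cons (entry f i i') q))
        ((f.1 - (X.sh i : ZMod N) + (Y.sh i' : ZMod N) - 1) + d)
        (t + ((X.sh i : ZMod N) - (Y.sh i' : ZMod N))) j) := by
  funext j e
  simp only [step, sumTail, ← sumSplits_zsmul]
  refine sumSplits_congr _ _ _ fun p q hpq => ?_
  simp only [cutSum, ← headHom_apply (hF j), map_zsmul, ← hpq, rdeg_append, rdeg, entry,
    add_mul, mul_add, sgn_add A.even_period, smul_smul]
  rw [show rdeg p + (f.1 - (X.sh i : ZMod N) + (Y.sh i' : ZMod N) - 1 + d) =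
    f.1 - (X.sh i : ZMod N) + (Y.sh i' : ZMod N) - 1 + rdeg p + d by ring]
  congr 1
  ring

/-- Cutting all paths along `c` is the same as cutting the chain `c`, with the insertions of `δ`
before the cut and behind it. -/
theorem tw_cutSum {X Z : PreTw A} (c : Chain (O := PreTw A) Elt X Z) :
    ∀ {V : Z.I → Type v} [∀ j, AddCommGroup (V j)] {F : ∀ j, Chain A.Elt W (Z.ob j) → V j}
    (hF : ∀ j, IsAdditive (F j)) (i : X.I)
    (φ : ∀ B, Chain A.Elt (X.ob i) B → A.Hom W B) (_ : ∀ B, IsAdditive (φ B)) (d t : ZMod N)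
    (j : Z.I),
    tw c i (fun j e => e.sumSplits (cutSum F φ d t j)) j =
      c.sumSplits (fun q r => glue hF (t + (X.sh i : ZMod N)) (wdeg q - (X.sh i : ZMod N) + d) r j
        (tw q i (fun _ => φ _))) := by
  -- the part with empty beginning
  have key : ∀ {X : PreTw A} (c : Chain (O := PreTw A) Elt X Z) {V : Z.I → Type v}
      [∀ j, AddCommGroup (V j)] {F : ∀ j, Chain A.Elt W (Z.ob j) → V j}
      (hF : ∀ j, IsAdditive (F j)) (i : X.I) (φ : ∀ B, Chain A.Elt (X.ob i) B → A.Hom W B)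
      (d t : ZMod N) (j : Z.I),
      tw c i (fun j e => cutSum F φ d t j (nil _) e) j =
        glue hF (t + (X.sh i : ZMod N)) (wdeg (nil X) - (X.sh i : ZMod N) + d) c j
          (expand (nil X) i (fun _ => φ _)) := by
    intro X c V _ F hF i φ d t j
    refine Eq.symm ((Finset.sum_eq_single i (fun i₁ _ h => ?_) (by simp)).trans ?_)
    · rw [expand_nil_ne h]
      exact tw_zero _ _ _ (fun j p => by simp) _
    · rw [expand_nil_self]
      simp only [headHom_apply, cutSum, wdeg, rdeg]
      simp only [add_sub_cancel_right, zero_sub, zero_add]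
      rw [show -(X.sh i : ZMod N) + d + (X.sh i : ZMod N) = d by ring]
  -- a vanishing entry of `δ`
  have key0 : ∀ {X : PreTw A} (c : Chain (O := PreTw A) Elt X Z) {V : Z.I → Type v}
      [∀ j, AddCommGroup (V j)] {F : ∀ j, Chain A.Elt W (Z.ob j) → V j}
      (hF : ∀ j, IsAdditive (F j)) (i i' : X.I) (_ : X.δ i i' = 0)
      (φ : ∀ B, Chain A.Elt (X.ob i) B → A.Hom W B) (_ : ∀ B, IsAdditive (φ B)) (t : ZMod N)
      (D : ∀ {Y : PreTw A}, Chain (O := PreTw A) Elt X Y → ZMod N) (j : Z.I),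
      c.sumSplits (fun {Y} q r => glue hF t (D q) r j
        (tw q i' (step (V := fun j : Y.I => A.Hom W (Y.ob j)) X.δElt i i' (fun _ => φ _)))) =
        0 := by
    intro X c V _ F hF i i' h φ hφ t D j
    rw [← sumSplits_zero c]
    refine sumSplits_congr _ _ _ fun q r _ => ?_
    rw [show tw q i' (step X.δElt i i' (fun _ => φ _)) = 0 from
      funext fun l => tw_step_zero _ X.δElt _ _ (fun _ => hφ _) h l, map_zero]
  induction c with
  | nil X =>
    intro V _ F hF i
    induction i using X.δ_induction with
    | h i ih =>
    intro φ hφ d t j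
    have e1 : tw (nil X) i (fun j e => e.sumSplits (cutSum F φ d t j)) j =
      tw (nil X) i (fun j e => cutSum F φ d t j (nil _) e) j +
      tw (nil X) i (fun j e => e.sumTail (cutSum F φ d t j)) j := by
      rw [← tw_add]
      congr 1
      funext j e
      exact sumSplits_eq_add_sumTail e _
    rw [e1, key _ hF, tw_nil i (isAdditive_cutSum_tail hF hφ d t), sumSplits]
    rw [show expand (nil X) i (fun j e => sumTail e (cutSum F φ d t j)) j = 0 by
      by_cases h : j = i
      · subst h; rw [expand_nil_self]; rfl
      · exact expand_nil_ne h _, zero_add]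
    rw [show tw (nil X) i (fun _ => φ _) = expand (nil X) i (fun _ => φ _) +
      ∑ i', tw (nil X) i' (step X.δElt i i' (fun _ => φ _)) from funext fun l => by
        rw [tw_nil i (fun _ => hφ _), Pi.add_apply, Finset.sum_apply], map_add, map_sum]
    congr 1
    refine Finset.sum_congr rfl fun i' _ => ?_
    by_cases h0 : X.δ i i' = 0
    · rw [tw_step_zero _ X.δElt _ _ (isAdditive_cutSum_tail hF hφ d t) h0]
      exact (key0 (nil X) hF i i' h0 φ hφ _ (fun q => wdeg q - _ + d) j).symm
    · rw [step_cutSum_tail hF, ih i' h0 _ (isAdditive_step_fun X.δElt i i' hφ)]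
      simp only [sumSplits, δElt]
      congr 2 <;> ring
  | @cons X Y Z f c ihc =>
    intro V _ F hF i
    induction i using X.δ_induction with
    | h i ih =>
    intro φ hφ d t j
    have e1 : tw (cons f c) i (fun j e => e.sumSplits (cutSum F φ d t j)) j =
      tw (cons f c) i (fun j e => cutSum F φ d t j (nil _) e) j +
      tw (cons f c) i (fun j e => e.sumTail (cutSum F φ d t j)) j := by
      rw [← tw_add]
      congr 1
      funext j e
      exact sumSplits_eq_add_sumTail e _
    rw [e1, key _ hF, tw_cons _ _ i (isAdditive_cutSum_tail hF hφ d t)]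
    rw [sumSplits]
    rw [show tw (nil X) i (fun _ => φ _) = expand (nil X) i (fun _ => φ _) +
      ∑ i', tw (nil X) i' (step X.δElt i i' (fun _ => φ _)) from funext fun l => by
        rw [tw_nil i (fun _ => hφ _), Pi.add_apply, Finset.sum_apply], map_add, map_sum]
    have e2 : ∀ {Y'} (q : Chain (O := PreTw A) Elt Y Y'), tw (cons f q) i (fun _ => φ _) =
        (∑ i', tw (cons f q) i' (step X.δElt i i' (fun _ => φ _))) +
        ∑ i', tw q i' (step f i i' (fun _ => φ _)) := fun q => funext fun l => by
      rw [tw_cons _ _ i (fun _ => hφ _), Pi.add_apply, Finset.sum_apply, Finset.sum_apply]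
    simp only [e2, map_add, map_sum, sumSplits_add, sumSplits_sum]
    rw [add_assoc, ← add_assoc (∑ i', _), ← Finset.sum_add_distrib]
    congr 2
    · refine Finset.sum_congr rfl fun i' _ => ?_
      by_cases h0 : X.δ i i' = 0
      · rw [tw_step_zero _ X.δElt _ _ (isAdditive_cutSum_tail hF hφ d t) h0]
        exact (key0 (cons f c) hF i i' h0 φ hφ _ (fun q => wdeg q - _ + d) j).symm
      · rw [step_cutSum_tail hF, ih i' h0 _ (isAdditive_step_fun X.δElt i i' hφ)]
        simp only [sumSplits, δElt, wdeg]
        congr 2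
        · congr 1 <;> ring
        · funext Y' q r
          congr 2 <;> ring
    · refine Finset.sum_congr rfl fun i' _ => ?_
      rw [step_cutSum_tail hF, ihc @key @key0 hF i' _ (isAdditive_step_fun f i i' hφ)]
      refine sumSplits_congr _ _ _ fun q r _ => ?_
      simp only [wdeg]
      congr 2
      · ring
      · ring

end Cut

/-! ### The `A_∞`-relations for twisted complexes -/

/-- The composition `muTw c` of a chain, with its degree. -/
def muElt {X Y : PreTw A} (c : Chain (O := PreTw A) Elt X Y) : Elt X Y :=
  ⟨wdeg c + 2, muTw c, muTw_mem c⟩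

theorem sgn_add_double {N : ℕ} (hN : Even N) (x d : ZMod N) : sgn (x + (d + d)) = sgn x := by
  rw [sgn_add hN, sgn_add hN d, sgn_mul_self, mul_one]

section Relation

variable {X Z : PreTw A} {V : Z.I → Type v} [∀ j, AddCommGroup (V j)]

/-- The left hand side of the `A_∞`-relation, with `F` in place of the outer `μ`. -/
def relator {W Z : A.Ob} {V : Type v} [AddCommGroup V] (F : Chain A.Elt W Z → V)
    (e : Chain A.Elt W Z) : V :=
  e.sumSplits fun p m => m.sumSplits fun q r =>
    sgn (rdeg p) • F (p.append (cons (proj (rdeg q + 2) (A.mu q)) r))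

theorem isAdditive_relator {W Z : A.Ob} {V : Type v} [AddCommGroup V] {F : Chain A.Elt W Z → V}
    (hF : IsAdditive F) : IsAdditive (relator F) := by
  refine isAdditive_sumSplits _ (fun m => ?_) (fun p => isAdditive_sumSplits _ (fun r => ?_)
    fun q => ?_)
  · intro U T p g a b p'
    rw [← sumSplits_add]
    refine sumSplits_congr _ _ _ fun q r _ => ?_
    simp only [rdeg_append, rdeg, ← smul_add, append_assoc]
    congr 1
    exact hF p g a b _
  · intro U T q g a b q'
    have h1 := A.mu_add q g a b q'
    have h2 : ∀ x : A.gr U T g, rdeg (q.append (cons ⟨g, x⟩ q')) = rdeg q + (g - 1 + rdeg q') :=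
      fun x => rdeg_append _ _
    change sgn (rdeg p) • F (p.append (cons (proj (rdeg (q.append (cons ⟨g, a + b⟩ q')) + 2)
        (A.mu (q.append (cons ⟨g, a + b⟩ q')))) r)) =
      sgn (rdeg p) • F (p.append (cons (proj (rdeg (q.append (cons ⟨g, a⟩ q')) + 2)
        (A.mu (q.append (cons ⟨g, a⟩ q')))) r)) +
      sgn (rdeg p) • F (p.append (cons (proj (rdeg (q.append (cons ⟨g, b⟩ q')) + 2)
        (A.mu (q.append (cons ⟨g, b⟩ q')))) r))
    rw [h2 (a + b), h2 a, h2 b, h1, ← smul_add]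
    simp only [proj, map_add]
    rw [hF]
  · intro U T r g a b r'
    have := hF (p.append (cons (proj (rdeg q + 2) (A.mu q)) r)) g a b r'
    simp only [append_assoc, append] at this
    simp only [this, smul_add]

/-- The part of `relator` in which the inner `μ` does not concern the first entry. -/
def relatorTail {W Z : A.Ob} {V : Type v} [AddCommGroup V] (F : Chain A.Elt W Z → V)
    (e : Chain A.Elt W Z) : V :=
  e.sumTail fun p m => m.sumSplits fun q r =>
    sgn (rdeg p) • F (p.append (cons (proj (rdeg q + 2) (A.mu q)) r))

theorem relator_eq {W : A.Ob} (F : ∀ j, Chain A.Elt W (Z.ob j) → V j) (j : Z.I)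
    (e : Chain A.Elt W (Z.ob j)) :
    relator (F j) e = e.sumSplits (cutSum F (fun _ q => A.mu q) 2 0 j) + relatorTail (F j) e := by
  rw [relator, sumSplits_eq_add_sumTail]
  congr 1
  refine sumSplits_congr _ _ _ fun q r _ => ?_
  simp [cutSum, rdeg, append]

theorem isAdditive_relatorTail {W : A.Ob} {F : ∀ j, Chain A.Elt W (Z.ob j) → V j}
    (hF : ∀ j, IsAdditive (F j)) (j : Z.I) : IsAdditive (relatorTail (F j)) := by
  have h1 := (isAdditive_relator (hF j)).add
    ((isAdditive_cutSum hF (fun _ => isAdditive_mu _ _) 2 0 j).zsmul_const (-1))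
  refine (congrArg IsAdditive (funext fun e => ?_)).mp h1
  rw [relator_eq, neg_smul, one_smul]
  exact add_neg_cancel_comm _ _

theorem step_relatorTail {Y : PreTw A} (f : Elt X Y) (i : X.I) (i' : Y.I)
    (F : ∀ j, Chain A.Elt (X.ob i) (Z.ob j) → V j) :
    step f i i' (fun j e => relatorTail (F j) e) =
      fun j e => sgn (f.1 - 1) • relator (step f i i' F j) e := by
  funext j e
  simp only [step, relatorTail, sumTail, relator, ← sumSplits_zsmul]
  refine sumSplits_congr _ _ _ fun p m hpm => sumSplits_congr _ _ _ fun q r hqr => ?_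
  simp only [append, smul_smul]
  congr 1
  rw [← hpm, ← hqr]
  simp only [rdeg_append, rdeg, proj, entry]
  rw [← sgn_add A.even_period, ← sgn_add A.even_period, ← sgn_add A.even_period]
  rw [show f.1 - 1 + (rdeg p + ((X.sh i : ZMod N) - (Y.sh i' : ZMod N)) *
      (rdeg p + (rdeg q + 2 - 1 + rdeg r))) =
      ((X.sh i : ZMod N) - (Y.sh i' : ZMod N)) * (rdeg p + (rdeg q + rdeg r)) +
      (f.1 - (X.sh i : ZMod N) + (Y.sh i' : ZMod N) - 1 + rdeg p) +
      (((X.sh i : ZMod N) - (Y.sh i' : ZMod N)) + ((X.sh i : ZMod N) - (Y.sh i' : ZMod N))) by ring,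
    sgn_add_double A.even_period]

theorem glue_muTw {Y : PreTw A} (q : Chain (O := PreTw A) Elt X Y)
    (r : Chain (O := PreTw A) Elt Y Z) (i : X.I) {F : ∀ j, Chain A.Elt (X.ob i) (Z.ob j) → V j}
    (hF : ∀ j, IsAdditive (F j)) (j : Z.I) :
    glue hF (0 + (X.sh i : ZMod N)) (wdeg q - (X.sh i : ZMod N) + 2) r j (muTw q i) =
      ∑ i₁, tw r i₁ (step (muElt q) i i₁ F) j := by
  refine Finset.sum_congr rfl fun i₁ _ => congrFun (congrArg (tw r i₁) ?_) j
  funext j r'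
  rw [step, zero_add, headHom_apply]
  have h : proj (wdeg q - (X.sh i : ZMod N) + 2 + (Y.sh i₁ : ZMod N)) (muTw q i i₁) =
      entry (muElt q) i i₁ := by
    rw [show wdeg q - (X.sh i : ZMod N) + 2 + (Y.sh i₁ : ZMod N) = (entry (muElt q) i i₁).1 by
      simp only [entry, muElt]; ring]
    exact proj_coe (entry (muElt q) i i₁)
  rw [h]

/-- The relator, summed over the paths along a chain, by induction on the first step of the paths:
the inner `μ` either concerns the first entry, which is `tw_cutSum`, or it does not. -/
theorem tw_relator {X Z : PreTw A} (c : Chain (O := PreTw A) Elt X Z) :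
    ∀ {V : Z.I → Type v} [∀ j, AddCommGroup (V j)] (i : X.I)
    {F : ∀ j, Chain A.Elt (X.ob i) (Z.ob j) → V j} (_ : ∀ j, IsAdditive (F j)) (j : Z.I),
    tw c i (fun j e => relator (F j) e) j =
      c.sumSplits (fun p m => m.sumSplits fun q r =>
        sgn (wdeg p) • tw (p.append (cons (muElt q) r)) i F j) := by
  have key : ∀ {X : PreTw A} (c : Chain (O := PreTw A) Elt X Z) {V : Z.I → Type v}
      [∀ j, AddCommGroup (V j)] (i : X.I)
      {F : ∀ j, Chain A.Elt (X.ob i) (Z.ob j) → V j} (hF : ∀ j, IsAdditive (F j)) (j : Z.I),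
      tw c i (fun j e => relator (F j) e) j =
        c.sumSplits (fun q r => ∑ i₁, tw r i₁ (step (muElt q) i i₁ F) j) +
        tw c i (fun j e => relatorTail (F j) e) j := by
    intro X c V _ i F hF j
    simp only [relator_eq]
    rw [tw_add, tw_cutSum c hF i _ (fun _ => isAdditive_mu _ _)]
    congr 1
    exact sumSplits_congr _ _ _ fun q r _ => glue_muTw q r i hF j
  have key0 : ∀ {X : PreTw A} (c : Chain (O := PreTw A) Elt X Z) {V : Z.I → Type v}
      [∀ j, AddCommGroup (V j)] (i i' : X.I) (_ : X.δ i i' = 0)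
      {F : ∀ j, Chain A.Elt (X.ob i) (Z.ob j) → V j} (_ : ∀ j, IsAdditive (F j)) (j : Z.I),
      c.sumSplits (fun p m => m.sumSplits fun q r => sgn (wdeg p) •
        tw (p.append (cons (muElt q) r)) i' (step X.δElt i i' F) j) = 0 := by
    intro X c V _ i i' h F hF j
    rw [← sumSplits_zero c]
    refine sumSplits_congr _ _ _ fun p m _ => ?_
    rw [← sumSplits_zero m]
    refine sumSplits_congr _ _ _ fun q r _ => ?_
    rw [tw_step_zero _ X.δElt _ _ hF h, smul_zero]
  induction c with
  | nil X =>
    intro V _ i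
    induction i using X.δ_induction with
    | h i ih =>
    intro F hF j
    rw [key _ i hF, tw_nil i (isAdditive_relatorTail hF)]
    rw [show expand (nil X) i (fun j e => relatorTail (F j) e) j = 0 by
      by_cases h : j = i
      · subst h; rw [expand_nil_self]; rfl
      · exact expand_nil_ne h _, zero_add]
    simp only [sumSplits, append, wdeg, sgn_zero, one_smul]
    rw [tw_cons _ _ i hF, add_comm]
    congr 1
    refine Finset.sum_congr rfl fun i' _ => ?_
    by_cases h0 : X.δ i i' = 0
    · rw [tw_step_zero _ X.δElt _ _ (isAdditive_relatorTail hF) h0,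
        tw_step_zero _ X.δElt _ _ hF h0]
    · rw [step_relatorTail, tw_zsmul _ _ _ (fun _ => _), ih i' h0 (isAdditive_step _ _ _ hF)]
      simp only [sumSplits, append, wdeg, sgn_zero, one_smul, δElt, sub_self]
  | @cons X Y Z f c ihc =>
    intro V _ i
    induction i using X.δ_induction with
    | h i ih =>
    intro F hF j
    rw [key _ i hF, tw_cons _ _ i (isAdditive_relatorTail hF)]
    have e1 : ∀ i', tw (cons f c) i' (step X.δElt i i' fun j e => relatorTail (F j) e) j =
        (cons f c).sumSplits (fun p m => m.sumSplits fun q r => sgn (wdeg p) •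
          tw (p.append (cons (muElt q) r)) i' (step X.δElt i i' F) j) := by
      intro i'
      by_cases h0 : X.δ i i' = 0
      · rw [tw_step_zero _ X.δElt _ _ (isAdditive_relatorTail hF) h0]
        exact (key0 _ i i' h0 hF j).symm
      · rw [step_relatorTail, tw_zsmul _ _ _ (fun _ => _), ih i' h0 (isAdditive_step _ _ _ hF)]
        simp only [δElt, sub_self, sgn_zero, one_smul]
    have e2 : ∀ i', tw c i' (step f i i' fun j e => relatorTail (F j) e) j =
        c.sumSplits (fun p m => m.sumSplits fun q r => sgn (wdeg (cons f p)) •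
          tw (p.append (cons (muElt q) r)) i' (step f i i' F) j) := by
      intro i'
      rw [step_relatorTail, tw_zsmul _ _ _ (fun _ => _), ihc @key @key0 _ (isAdditive_step _ _ _ hF)]
      simp only [← sumSplits_zsmul, smul_smul, wdeg, sgn_add A.even_period]
    simp only [e1, e2]
    rw [show (cons f c).sumSplits (fun p m => m.sumSplits fun q r => sgn (wdeg p) •
          tw (p.append (cons (muElt q) r)) i F j) =
      (cons f c).sumSplits (fun q r => tw (cons (muElt q) r) i F j) +
      c.sumSplits (fun p m => m.sumSplits fun q r => sgn (wdeg (cons f p)) •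
          tw (cons f (p.append (cons (muElt q) r))) i F j) from by
        rw [sumSplits]; simp only [append, wdeg, sgn_zero, one_smul]]
    have e3 : ∀ i', (cons f c).sumSplits (fun p m => m.sumSplits fun q r => sgn (wdeg p) •
          tw (p.append (cons (muElt q) r)) i' (step X.δElt i i' F) j) =
      (cons f c).sumSplits (fun q r => tw (cons (muElt q) r) i' (step X.δElt i i' F) j) +
      c.sumSplits (fun p m => m.sumSplits fun q r => sgn (wdeg (cons f p)) •
          tw (cons f (p.append (cons (muElt q) r))) i' (step X.δElt i i' F) j) := by
      intro i'
      rw [sumSplits]; simp only [append, wdeg, sgn_zero, one_smul]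
    have e4 : ∀ {Y} (q : Chain (O := PreTw A) Elt X Y) r, tw (cons (muElt q) r) i F j = _ :=
      fun q r => tw_cons (muElt q) r i hF j
    have e5 : ∀ {Y'} (q : Chain (O := PreTw A) Elt Y Y') (r : Chain (O := PreTw A) Elt Y' Z),
      tw (cons f (q.append r)) i F j = _ := fun q r => tw_cons f (q.append r) i hF j
    simp only [e3, e4, e5, sumSplits_add, sumSplits_sum, Finset.sum_add_distrib, smul_add,
      Finset.smul_sum]
    abel

/-- The `A_∞`-relations for `muTw`. They hold without the Maurer-Cartan equation if one includes
the terms in which the inner composition is `∑ μ^r(δ, …, δ)`. -/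
theorem muTw_relation {X Z : PreTw A} (c : Chain (O := PreTw A) Elt X Z) (i : X.I) (j : Z.I) :
    c.sumSplits (fun p m => m.sumSplits fun q r =>
      sgn (wdeg p) • muTw (p.append (cons (muElt q) r)) i j) = 0 := by
  refine (tw_relator c i (fun _ => isAdditive_mu _ _) j).symm.trans (tw_zero _ _ _ (fun j e => ?_) _)
  have h := A.relation e
  rw [← h, relator]
  refine sumSplits_congr _ _ _ fun p m _ => sumSplits_congr _ _ _ fun q r _ => ?_
  rw [proj_of_mem (A.mu_mem q)]
  rfl

end Relation

/-! ### Multilinearity and the Leibniz rule -/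

theorem sgn_one {N : ℕ} (hN : Even N) : sgn (1 : ZMod N) = -1 := by
  have := sgn_eq_intCast hN 1
  simpa using this

theorem Elt.ext {X Y : PreTw A} {f g : Elt X Y} (h : f.1 = g.1) (h' : f.2.1 = g.2.1) : f = g := by
  obtain ⟨d, f⟩ := f
  obtain ⟨d', g⟩ := g
  dsimp only at h h'
  subst h
  obtain rfl : f = g := Subtype.ext h'
  rfl

section Unique

variable {X Y Z : PreTw A} {V : Z.I → Type v} [∀ j, AddCommGroup (V j)]

/-- The recursion `tw_nil` determines `tw`. -/
theorem tw_nil_unique (j : Z.I)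
    (R : ∀ i : Z.I, (∀ j, Chain A.Elt (Z.ob i) (Z.ob j) → V j) → V j)
    (h0 : ∀ i, R i (fun _ _ => 0) = 0)
    (h : ∀ i F, (∀ j, IsAdditive (F j)) →
      R i F = expand (.nil Z) i F j + ∑ i₁, R i₁ (step Z.δElt i i₁ F)) (i : Z.I) :
    ∀ F, (∀ j, IsAdditive (F j)) → tw (.nil Z) i F j = R i F := by
  induction i using Z.δ_induction with
  | h i ih =>
  intro F hF
  rw [tw_nil i hF, h i F hF]
  congr 1
  refine Finset.sum_congr rfl fun i₁ _ => ?_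
  by_cases h1 : Z.δ i i₁ = 0
  · rw [tw_step_zero _ Z.δElt _ _ hF h1, ← h0 i₁]
    congr 1
    funext j p
    simp only [step]
    rw [(hF j).head_zero (entry Z.δElt i i₁) h1, smul_zero]
  · exact ih i₁ h1 _ (isAdditive_step _ _ _ hF)

/-- The recursion `tw_cons` determines `tw`. -/
theorem tw_cons_unique (f : Elt X Y) (c : Chain (O := PreTw A) Elt Y Z) (j : Z.I)
    (R : ∀ i : X.I, (∀ j, Chain A.Elt (X.ob i) (Z.ob j) → V j) → V j)
    (h0 : ∀ i, R i (fun _ _ => 0) = 0)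
    (h : ∀ i F, (∀ j, IsAdditive (F j)) →
      R i F = ∑ i₁, R i₁ (step X.δElt i i₁ F) + ∑ i₁, tw c i₁ (step f i i₁ F) j) (i : X.I) :
    ∀ F, (∀ j, IsAdditive (F j)) → tw (.cons f c) i F j = R i F := by
  induction i using X.δ_induction with
  | h i ih =>
  intro F hF
  rw [tw_cons f c i hF, h i F hF]
  congr 1
  refine Finset.sum_congr rfl fun i₁ _ => ?_
  by_cases h1 : X.δ i i₁ = 0
  · rw [tw_step_zero _ X.δElt _ _ hF h1, ← h0 i₁]
    congr 1
    funext j p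
    simp only [step]
    rw [(hF j).head_zero (entry X.δElt i i₁) h1, smul_zero]
  · exact ih i₁ h1 _ (isAdditive_step _ _ _ hF)

end Unique

section Linear

variable {W X Y Z : PreTw A} {V : Z.I → Type v} [∀ j, AddCommGroup (V j)]

theorem step_add {g : ZMod N} (a b : X.Hom Y g) (i : X.I) (i₁ : Y.I)
    {F : ∀ j, Chain A.Elt (X.ob i) (Z.ob j) → V j} (hF : ∀ j, IsAdditive (F j)) :
    step (Z := Z) ⟨g, a + b⟩ i i₁ F =
      fun j p => step ⟨g, a⟩ i i₁ F j p + step ⟨g, b⟩ i i₁ F j p := by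
  funext j p
  simp only [step, ← smul_add]
  congr 1
  exact hF j (.nil _) _ ⟨a.1 i i₁, a.2 i i₁⟩ ⟨b.1 i i₁, b.2 i i₁⟩ p

theorem tw_entry_add (p : Chain (O := PreTw A) Elt W X) (g : ZMod N) (a b : X.Hom Y g)
    (q : Chain (O := PreTw A) Elt Y Z) :
    ∀ (i : W.I) (F : ∀ j, Chain A.Elt (W.ob i) (Z.ob j) → V j) (_ : ∀ j, IsAdditive (F j))
    (j : Z.I), tw (p.append (.cons ⟨g, a + b⟩ q)) i F j =
      tw (p.append (.cons ⟨g, a⟩ q)) i F j + tw (p.append (.cons ⟨g, b⟩ q)) i F j := by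
  induction p with
  | nil X =>
    intro i F hF j
    refine tw_cons_unique _ _ j (fun i F => tw (cons ⟨g, a⟩ q) i F j + tw (cons ⟨g, b⟩ q) i F j)
      (fun i => ?_) (fun i F hF => ?_) i F hF
    · simp only [tw_zero _ _ _ (fun _ _ => rfl), add_zero]
    · refine (congrArg₂ (· + ·) (tw_cons _ q i hF j) (tw_cons _ q i hF j)).trans ?_
      simp only [step_add a b i _ hF, tw_add, Finset.sum_add_distrib]
      abel
  | cons x p ih =>
    intro i F hF j
    refine tw_cons_unique _ _ j (fun i F => tw (cons x (p.append (cons ⟨g, a⟩ q))) i F j +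
      tw (cons x (p.append (cons ⟨g, b⟩ q))) i F j) (fun i => ?_) (fun i F hF => ?_) i F hF
    · simp only [tw_zero _ _ _ (fun _ _ => rfl), add_zero]
    · simp only [tw_cons _ _ i hF, ih a b _ _ (isAdditive_step _ _ _ hF),
        Finset.sum_add_distrib]
      abel

/-- `muTw` is additive in each entry. -/
def muTwHom (p : Chain (O := PreTw A) Elt W X) (g : ZMod N) (q : Chain (O := PreTw A) Elt Y Z) :
    X.Hom Y g →+ ∀ i j, A.Hom (W.ob i) (Z.ob j) :=
  AddMonoidHom.mk' (fun a => muTw (p.append (.cons ⟨g, a⟩ q))) fun a b => by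
    funext i j
    exact tw_entry_add p g a b q i _ (fun _ => isAdditive_mu _ _) j

theorem muTw_entry_zero (p : Chain (O := PreTw A) Elt W X) (f : Elt X Y) (hf : f.2.1 = 0)
    (q : Chain (O := PreTw A) Elt Y Z) : muTw (p.append (.cons f q)) = 0 := by
  obtain ⟨g, f⟩ := f
  obtain rfl : f = 0 := Subtype.ext hf
  exact map_zero (muTwHom p g q)

theorem muTw_entry_zsmul (p : Chain (O := PreTw A) Elt W X) (m : ℤ) (f f' : Elt X Y)
    (h : f'.1 = f.1) (hf : f'.2.1 = m • f.2.1) (q : Chain (O := PreTw A) Elt Y Z) :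
    muTw (p.append (.cons f' q)) = m • muTw (p.append (.cons f q)) := by
  obtain ⟨g, f⟩ := f
  obtain ⟨g', f'⟩ := f'
  dsimp only at h hf
  subst h
  obtain rfl : f' = m • f := Subtype.ext hf
  exact map_zsmul (muTwHom p g' q) m f

theorem muTw_entry_add (p : Chain (O := PreTw A) Elt W X) (f f₁ f₂ : Elt X Y)
    (h₁ : f.1 = f₁.1) (h₂ : f.1 = f₂.1) (hf : f.2.1 = f₁.2.1 + f₂.2.1)
    (q : Chain (O := PreTw A) Elt Y Z) :
    muTw (p.append (.cons f q)) = muTw (p.append (.cons f₁ q)) + muTw (p.append (.cons f₂ q)) := by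
  obtain ⟨g, f⟩ := f
  obtain ⟨g₁, f₁⟩ := f₁
  obtain ⟨g₂, f₂⟩ := f₂
  dsimp only at h₁ h₂ hf
  subst h₁ h₂
  obtain rfl : f = f₁ + f₂ := Subtype.ext hf
  exact map_add (muTwHom p g q) f₁ f₂

theorem MaurerCartan.muElt_nil {X : PreTw A} (hX : X.MaurerCartan) :
    (muElt (.nil X)).2.1 = 0 := funext fun i => funext fun j => hX i j

/-- `μ¹_Tw ∘ μ¹_Tw = 0` -/
theorem muTw_muTw (hX : X.MaurerCartan) (hY : Y.MaurerCartan) (f : Elt X Y) :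
    muTw (single (muElt (single f))) = 0 := by
  funext i j
  have h := muTw_relation (single f) i j
  simp only [single, sumSplits, append, wdeg, sgn_zero, one_smul] at h
  have h1 := muTw_entry_zero (.nil X) _ hX.muElt_nil (cons f (nil Y))
  have h2 := muTw_entry_zero (cons f (nil Y)) _ hY.muElt_nil (nil Y)
  simp only [append] at h1 h2
  simp only [h1, h2, Pi.zero_apply, smul_zero, zero_add, add_zero] at h
  exact h

/-- The Leibniz rule. -/
theorem muTw_leibniz (hX : X.MaurerCartan) (hY : Y.MaurerCartan) (hZ : Z.MaurerCartan)
    (f : Elt X Y) (g : Elt Y Z) :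
    muTw (single (muElt (cons f (single g)))) + muTw (cons (muElt (single f)) (single g)) +
      sgn (f.1 - 1) • muTw (cons f (single (muElt (single g)))) = 0 := by
  funext i j
  have h := muTw_relation (cons f (single g)) i j
  simp only [single, sumSplits, append, wdeg, sgn_zero, one_smul] at h
  have h1 := muTw_entry_zero (.nil X) _ hX.muElt_nil (cons f (cons g (nil Z)))
  have h2 := muTw_entry_zero (cons f (nil Y)) _ hY.muElt_nil (cons g (nil Z))
  have h3 := muTw_entry_zero (cons f (cons g (nil Z))) _ hZ.muElt_nil (nil Z)
  simp only [append] at h1 h2 h3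
  simp only [h1, h2, h3, Pi.zero_apply, smul_zero, zero_add, add_zero] at h
  simp only [single, Pi.add_apply, Pi.smul_apply, Pi.zero_apply]
  rw [← h, add_comm (muTw _ i j)]

end Linear

/-! ### Strict units -/

section Units

variable (U : A.StrictUnits)

/-- The strict units of `A`, as homogeneous morphisms. -/
inductive IsUnitElt : ∀ {X Y : A.Ob}, A.Elt X Y → Prop
  | mk (X : A.Ob) : IsUnitElt (⟨0, U.e X⟩ : A.Elt X X)

/-- Matrices all of whose nonzero entries are strict units. -/
def UnitLike {X Y : PreTw A} (f : Elt X Y) : Prop :=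
  ∀ i j, f.2.1 i j = 0 ∨ IsUnitElt U (entry f i j)

/-- `F` vanishes on chains with a strict unit and at least `n` further entries. -/
def KillsUnits (n : ℕ) {X Y : A.Ob} {V : Type v} [AddCommGroup V] (F : Chain A.Elt X Y → V) :
    Prop :=
  ∀ ⦃B : A.Ob⦄ (p : Chain A.Elt X B) (q : Chain A.Elt B Y), n ≤ p.length + q.length →
    F (p.append (.cons ⟨0, U.e B⟩ q)) = 0

theorem killsUnits_mu (X Y : A.Ob) : KillsUnits U 2 (fun p : Chain A.Elt X Y => A.mu p) :=
  fun _ p q h => U.mu_e_higher p q h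

theorem KillsUnits.cons_isUnitElt {n : ℕ} {X B Y : A.Ob} {V : Type v} [AddCommGroup V]
    {F : Chain A.Elt X Y → V} (h : KillsUnits U n F) {a : A.Elt X B} (ha : IsUnitElt U a)
    (p : Chain A.Elt B Y) (hp : n ≤ p.length) : F (cons a p) = 0 := by
  cases ha
  exact h (nil _) p (by simpa [length] using hp)

variable {X Y Z W : PreTw A} {V : Z.I → Type v} [∀ j, AddCommGroup (V j)]

theorem KillsUnits.step {n m : ℕ} (hm : n ≤ m + 1) {f : Elt X Y} {i : X.I} {i₁ : Y.I}
    {F : ∀ j, Chain A.Elt (X.ob i) (Z.ob j) → V j} (h : ∀ j, KillsUnits U n (F j)) (j : Z.I) :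
    KillsUnits U m (step f i i₁ F j) := by
  intro B p q hpq
  simp only [PreTw.step]
  have := h j (cons (entry f i i₁) p) q (by simp only [length]; omega)
  simp only [append] at this
  rw [this, smul_zero]

/-- All paths along a chain are at least as long as the chain. -/
theorem tw_eq_zero_of_length (c : Chain (O := PreTw A) Elt X Z) :
    ∀ {V : Z.I → Type v} [∀ j, AddCommGroup (V j)] (n : ℕ) (_ : n ≤ c.length) (i : X.I)
    (F : ∀ j, Chain A.Elt (X.ob i) (Z.ob j) → V j) (_ : ∀ j, IsAdditive (F j))
    (_ : ∀ j p, n ≤ p.length → F j p = 0) (j : Z.I), tw c i F j = 0 := by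
  induction c with
  | nil X =>
    intro V _ n hn i F hF h j
    simp only [length, Nat.le_zero] at hn
    exact tw_zero _ _ _ (fun j p => h j p (by omega)) _
  | @cons X Y Z f c ih =>
    intro V _ n hn i
    induction i using X.δ_induction with
    | h i ihi =>
    intro F hF h j
    rw [tw_cons _ _ i hF, Finset.sum_eq_zero fun i₁ _ => ?_, Finset.sum_eq_zero fun i₁ _ => ?_,
      add_zero]
    · refine ih (n - 1) (by simp only [length] at hn; omega) _ _ (isAdditive_step _ _ _ hF) ?_ _
      intro j p hp
      simp only [step]
      rw [h _ _ (by simp only [length]; omega), smul_zero]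
    · by_cases h1 : X.δ i i₁ = 0
      · exact tw_step_zero _ X.δElt _ _ hF h1 _
      refine ihi i₁ h1 _ (isAdditive_step _ _ _ hF) ?_ _
      intro j p hp
      simp only [step]
      rw [h _ _ (by simp only [length]; omega), smul_zero]

theorem tw_unitLike_eq_zero {u : Elt X Y} (hu : UnitLike U u) (p : Chain (O := PreTw A) Elt W X)
    (q : Chain (O := PreTw A) Elt Y Z) :
    ∀ (n : ℕ) (_ : n ≤ p.length + q.length) (i : W.I)
    (F : ∀ j, Chain A.Elt (W.ob i) (Z.ob j) → V j) (_ : ∀ j, IsAdditive (F j))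
    (_ : ∀ j, KillsUnits U n (F j)) (j : Z.I), tw (p.append (.cons u q)) i F j = 0 := by
  induction p with
  | nil X =>
    intro n hn i
    induction i using X.δ_induction with
    | h i ihi =>
    intro F hF h j
    simp only [append] at ihi ⊢
    rw [tw_cons _ _ i hF, Finset.sum_eq_zero fun i₁ _ => ?_, Finset.sum_eq_zero fun i₁ _ => ?_,
      add_zero]
    · obtain h1 | h1 := hu i i₁
      · exact tw_step_zero _ u _ _ hF h1 _
      · refine tw_eq_zero_of_length q n (by simpa [length] using hn) _ _ (isAdditive_step _ _ _ hF)
          (fun j p hp => ?_) _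
        exact (congrArg _ ((h j).cons_isUnitElt U h1 p hp)).trans (smul_zero _)
    · by_cases h1 : X.δ i i₁ = 0
      · exact tw_step_zero _ X.δElt _ _ hF h1 _
      exact ihi i₁ h1 _ (isAdditive_step _ _ _ hF) (KillsUnits.step U (by omega) h) _
  | @cons W W' X f p ih =>
    intro n hn i
    induction i using W.δ_induction with
    | h i ihi =>
    intro F hF h j
    simp only [append] at ihi ⊢
    rw [tw_cons _ _ i hF, Finset.sum_eq_zero fun i₁ _ => ?_, Finset.sum_eq_zero fun i₁ _ => ?_,
      add_zero]
    · exact ih hu (n - 1) (by simp only [length] at hn; omega) _ _ (isAdditive_step _ _ _ hF)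
        (KillsUnits.step U (by omega) h) _
    · by_cases h1 : W.δ i i₁ = 0
      · exact tw_step_zero _ W.δElt _ _ hF h1 _
      exact ihi i₁ h1 _ (isAdditive_step _ _ _ hF) (KillsUnits.step U (by omega) h) _

/-- Chains of length at least three with a matrix of strict units do not contribute. -/
theorem muTw_unitLike_eq_zero {u : Elt X Y} (hu : UnitLike U u) (p : Chain (O := PreTw A) Elt W X)
    (q : Chain (O := PreTw A) Elt Y Z) (h : 2 ≤ p.length + q.length) :
    muTw (p.append (.cons u q)) = 0 := by
  funext i j
  exact tw_unitLike_eq_zero U hu p q 2 h i _ (fun _ => isAdditive_mu _ _)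
    (fun _ => killsUnits_mu U _ _) j

open Classical in
/-- The identity matrix. -/
def idElt (X : PreTw A) : Elt X X :=
  ⟨0, fun i => Pi.single i (U.e (X.ob i)).1, fun i j => by
    change (Pi.single i (U.e (X.ob i)).1 : ∀ l, A.Hom (X.ob i) (X.ob l)) j ∈ _
    by_cases h : j = i
    · subst h
      rw [Pi.single_eq_same]
      exact mem_gr (U.e _).2 (by ring)
    · rw [Pi.single_eq_of_ne h]
      exact zero_mem _⟩

open Classical in
theorem idElt_self (X : PreTw A) (i : X.I) : (idElt U X).2.1 i i = (U.e (X.ob i)).1 := by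
  exact Pi.single_eq_same (M := fun l => A.Hom (X.ob i) (X.ob l)) i _

open Classical in
theorem idElt_ne (X : PreTw A) {i j : X.I} (h : j ≠ i) : (idElt U X).2.1 i j = 0 := by
  exact Pi.single_eq_of_ne (M := fun l => A.Hom (X.ob i) (X.ob l)) h _

theorem entry_idElt (X : PreTw A) (i : X.I) :
    entry (idElt U X) i i = (⟨0, U.e (X.ob i)⟩ : A.Elt _ _) :=
  elt_ext (by simp [entry, idElt]) (idElt_self U X i)

theorem unitLike_idElt (X : PreTw A) : UnitLike U (idElt U X) := by
  intro i j
  by_cases h : j = i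
  · subst h
    right
    rw [entry_idElt]
    exact .mk _
  · exact .inl (idElt_ne U X h)

theorem expand_nil_sum (j : Z.I) (F : ∀ i : Z.I, ∀ j, Chain A.Elt (Z.ob i) (Z.ob j) → V j) :
    ∑ i, expand (.nil Z) i (F i) j = F j j (.nil _) := by
  rw [Finset.sum_eq_single j (fun i _ h => expand_nil_ne h.symm _) (by simp), expand_nil_self]

theorem tw_nil_of_length (i : Z.I) {F : ∀ j, Chain A.Elt (Z.ob i) (Z.ob j) → V j}
    (hF : ∀ j, IsAdditive (F j)) (h : ∀ j p, 1 ≤ p.length → F j p = 0) (j : Z.I) :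
    tw (.nil Z) i F j = expand (.nil Z) i F j := by
  rw [tw_nil i hF, Finset.sum_eq_zero fun i₁ _ => ?_, add_zero]
  exact tw_zero _ _ _ (fun j p => by
    simp only [step]; rw [h _ _ (by simp [length]), smul_zero]) _

theorem step_idElt_self (i : X.I) (F : ∀ j, Chain A.Elt (X.ob i) (Z.ob j) → V j) :
    step (idElt U X) i i F = fun j p => F j (cons ⟨0, U.e (X.ob i)⟩ p) := by
  funext j p
  rw [step, entry_idElt, sub_self, zero_mul, sgn_zero, one_smul]

/-- A step along the identity matrix. -/
theorem sum_tw_step_idElt (c : Chain (O := PreTw A) Elt X Z) (i : X.I)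
    {F : ∀ j, Chain A.Elt (X.ob i) (Z.ob j) → V j} (hF : ∀ j, IsAdditive (F j)) (j : Z.I) :
    ∑ i₁, tw c i₁ (step (idElt U X) i i₁ F) j =
      tw c i (fun j p => F j (cons ⟨0, U.e (X.ob i)⟩ p)) j := by
  rw [Finset.sum_eq_single i (fun i₁ _ h => tw_step_zero _ (idElt U X) _ _ hF
    (idElt_ne U X h) _) (by simp), step_idElt_self]

theorem isAdditive_cons_unit {i : X.I} {F : ∀ j, Chain A.Elt (X.ob i) (Z.ob j) → V j}
    (hF : ∀ j, IsAdditive (F j)) (j : Z.I) :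
    IsAdditive (fun p : Chain A.Elt (X.ob i) (Z.ob j) => F j (cons ⟨0, U.e (X.ob i)⟩ p)) := by
  have := isAdditive_step (idElt U X) i i hF j
  rwa [step_idElt_self] at this

theorem tw_single_idElt (i : Z.I) {F : ∀ j, Chain A.Elt (Z.ob i) (Z.ob j) → V j}
    (hF : ∀ j, IsAdditive (F j)) (h : ∀ j, KillsUnits U 1 (F j)) (j : Z.I) :
    tw (single (idElt U Z)) i F j =
      expand (.nil Z) i (fun j p => F j (cons ⟨0, U.e (Z.ob i)⟩ p)) j := by
  rw [single, tw_cons _ _ i hF, Finset.sum_eq_zero fun i₁ _ => ?_, zero_add,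
    sum_tw_step_idElt U _ i hF, tw_nil_of_length i (isAdditive_cons_unit U hF)]
  · exact fun j p hp => h j (nil _) p (by simpa [length] using hp)
  · exact tw_unitLike_eq_zero U (unitLike_idElt U Z) (nil Z) (nil Z) 0 (Nat.zero_le _) i₁ _
      (isAdditive_step _ _ _ hF) (KillsUnits.step U (by omega) h) j

theorem muTw_idElt (X : PreTw A) : muTw (single (idElt U X)) = 0 := by
  funext i j
  change tw (single (idElt U X)) i (fun _ p => A.mu p) j = 0
  have hF : ∀ j, IsAdditive (fun p : Chain A.Elt (X.ob i) (X.ob j) => A.mu p) :=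
    fun _ => isAdditive_mu _ _
  have hU : ∀ j, KillsUnits U 2 (fun p : Chain A.Elt (X.ob i) (X.ob j) => A.mu p) :=
    fun _ => killsUnits_mu U _ _
  have hG := isAdditive_cons_unit U hF
  rw [single, tw_cons _ _ i hF, sum_tw_step_idElt U _ i hF, tw_nil i hG]
  have e1 : ∀ i₁, tw (cons (idElt U X) (nil X)) i₁ (step X.δElt i i₁ fun _ p => A.mu p) j = _ :=
    fun i₁ => tw_single_idElt U i₁ (isAdditive_step _ _ _ hF) (KillsUnits.step U le_rfl hU) j
  have e2 : ∀ i₁, tw (nil X) i₁ (step X.δElt i i₁ fun _ p => A.mu (cons ⟨0, U.e (X.ob i)⟩ p)) j =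
      _ := fun i₁ => tw_nil_of_length i₁ (isAdditive_step _ _ _ hG) (fun j p hp =>
        (congrArg _ (hU j (nil _) (cons _ p) (by simpa [length] using hp))).trans
          (smul_zero _)) j
  simp only [e1, e2]
  rw [expand_nil_sum, expand_nil_sum]
  have e3 : expand (nil X) i (fun j p => A.mu (cons ⟨0, U.e (X.ob i)⟩ p)) j = 0 := by
    by_cases h : j = i
    · subst h
      rw [expand_nil_self]
      exact U.closed _
    · exact expand_nil_ne h _
  rw [e3, zero_add]
  simp only [step, rdeg, mul_zero, sgn_zero, one_smul]
  have e4 := U.mu_e_left (entry X.δElt i j)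
  have e5 := U.mu_e_right (entry X.δElt i j)
  simp only [single] at e4 e5
  rw [e5, ← e4, ← add_smul]
  have e6 : sgn (((X.sh i : ZMod N) - (X.sh j : ZMod N)) * (0 - 1 + 0)) +
      sgn (entry X.δElt i j).1 = 0 := by
    simp only [entry, δElt]
    rw [show ((X.sh i : ZMod N) - (X.sh j : ZMod N)) * (0 - 1 + 0) =
      1 - (X.sh i : ZMod N) + (X.sh j : ZMod N) - 1 by ring, sgn_sub A.even_period _ 1,
      sgn_one A.even_period]
    ring
  rw [e6, zero_smul]

/-- `μ²_Tw(f, id) = f` -/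
theorem muTw_idElt_left (f : Elt X Y) : muTw (cons (idElt U X) (single f)) = f.2.1 := by
  funext i j
  change tw (cons (idElt U X) (single f)) i (fun _ p => A.mu p) j = f.2.1 i j
  have hF : ∀ j, IsAdditive (fun p : Chain A.Elt (X.ob i) (Y.ob j) => A.mu p) :=
    fun _ => isAdditive_mu _ _
  have hU : ∀ j, KillsUnits U 2 (fun p : Chain A.Elt (X.ob i) (Y.ob j) => A.mu p) :=
    fun _ => killsUnits_mu U _ _
  have hG := isAdditive_cons_unit U hF
  have hl : ∀ j (p : Chain A.Elt (X.ob i) (Y.ob j)), 2 ≤ p.length →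
      A.mu (cons ⟨0, U.e (X.ob i)⟩ p) = 0 := fun j p hp =>
    hU j (nil _) p (by simpa [length] using hp)
  rw [tw_cons _ _ i hF, Finset.sum_eq_zero fun i₁ _ => ?_, zero_add,
    sum_tw_step_idElt U _ i hF, single, tw_cons _ _ i hG, Finset.sum_eq_zero fun i₁ _ => ?_,
    zero_add]
  · have e : ∀ i₁, tw (nil Y) i₁ (step f i i₁ fun _ p => A.mu (cons ⟨0, U.e (X.ob i)⟩ p)) j = _ :=
      fun i₁ => tw_nil_of_length i₁ (isAdditive_step _ _ _ hG) (fun j p hp =>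
        (congrArg _ (hl j (cons _ p) (by simpa [length] using hp))).trans (smul_zero _)) j
    simp only [e]
    rw [expand_nil_sum]
    simp only [step, rdeg, mul_zero, sgn_zero, one_smul]
    exact U.mu_e_right (entry f i j)
  · exact tw_eq_zero_of_length _ 1 le_rfl _ _ (isAdditive_step _ _ _ hG) (fun j p hp =>
      (congrArg _ (hl j (cons _ p) (by simpa [length] using hp))).trans (smul_zero _)) _
  · exact tw_unitLike_eq_zero U (unitLike_idElt U X) (nil X) (single f) 1 le_rfl i₁ _
      (isAdditive_step _ _ _ hF) (KillsUnits.step U le_rfl hU) j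

/-- `μ²_Tw(id, f) = (-1)^|f| f` -/
theorem muTw_idElt_right (f : Elt X Y) :
    muTw (cons f (single (idElt U Y))) = sgn f.1 • f.2.1 := by
  funext i j
  change tw (cons f (single (idElt U Y))) i (fun _ p => A.mu p) j = sgn f.1 • f.2.1 i j
  have hF : ∀ j, IsAdditive (fun p : Chain A.Elt (X.ob i) (Y.ob j) => A.mu p) :=
    fun _ => isAdditive_mu _ _
  have hU : ∀ j, KillsUnits U 2 (fun p : Chain A.Elt (X.ob i) (Y.ob j) => A.mu p) :=
    fun _ => killsUnits_mu U _ _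
  rw [tw_cons _ _ i hF, Finset.sum_eq_zero fun i₁ _ => ?_, zero_add]
  · have e : ∀ i₁, tw (single (idElt U Y)) i₁ (step f i i₁ fun _ p => A.mu p) j = _ :=
      fun i₁ => tw_single_idElt U i₁ (isAdditive_step _ _ _ hF) (KillsUnits.step U le_rfl hU) j
    simp only [e]
    rw [expand_nil_sum]
    simp only [step, rdeg]
    have e4 := U.mu_e_left (entry f i j)
    simp only [single] at e4
    have e5 := congrArg (sgn f.1 • ·) e4
    refine Eq.trans ?_ e5
    refine Eq.trans ?_ (smul_smul _ _ _).symm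
    congr 1
    simp only [entry]
    rw [← sgn_add A.even_period, show f.1 + (f.1 - (X.sh i : ZMod N) + (Y.sh j : ZMod N)) =
      ((X.sh i : ZMod N) - (Y.sh j : ZMod N)) * (0 - 1 + 0) + (f.1 + f.1) by ring,
      sgn_add_double A.even_period]
  · exact tw_unitLike_eq_zero U (unitLike_idElt U Y) (single f) (nil Y) 1 le_rfl i₁ _
      (isAdditive_step _ _ _ hF) (KillsUnits.step U le_rfl hU) j

end Units

/-! ### Changing the grading of an object -/

section Regrade

variable {W X Y Z : PreTw A} {V : Z.I → Type v} [∀ j, AddCommGroup (V j)]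

/-- `f ∈ hom^g(X, Y)` as an element of `hom^(g+m)(X[m], Y)`, with the sign of `shiftHom`. -/
def shiftSource (m : ℤ) (f : Elt X Y) : Elt (X.shift m) Y :=
  ⟨f.1 + m, fun i j => sgn ((m : ZMod N) * ((X.sh i : ZMod N) - (Y.sh j : ZMod N))) • f.2.1 i j,
    fun i j => zsmul_mem (mem_gr (f.2.2 i j) (by push_cast; ring)) _⟩

/-- `f ∈ hom^g(X, Y)` as an element of `hom^(g-m)(X, Y[m])`. -/
def shiftTarget (m : ℤ) (f : Elt X Y) : Elt X (Y.shift m) :=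
  ⟨f.1 - m, f.2.1, fun i j => mem_gr (f.2.2 i j) (by push_cast; ring)⟩

theorem step_δElt_shift (m : ℤ) (i i₁ : X.I)
    {F : ∀ j, Chain A.Elt (X.ob i) (Z.ob j) → V j} (hF : ∀ j, IsAdditive (F j)) :
    step (X.shift m).δElt i i₁ F = fun j p =>
      sgn ((m : ZMod N) * ((X.sh i : ZMod N) - (X.sh i₁ : ZMod N))) • step X.δElt i i₁ F j p := by
  funext j p
  have e1 := (hF j).head_zsmul (sgn ((m : ZMod N) * ((X.sh i : ZMod N) - (X.sh i₁ : ZMod N))))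
    (entry (X.shift m).δElt i i₁) (entry X.δElt i i₁)
    (by simp only [entry, δElt, shift]; push_cast; ring) rfl p
  simp only [step]
  rw [e1, smul_comm]
  push_cast
  ring_nf

theorem step_shiftSource (m : ℤ) (f : Elt X Y) (i : X.I) (i₁ : Y.I)
    {F : ∀ j, Chain A.Elt (X.ob i) (Z.ob j) → V j} (hF : ∀ j, IsAdditive (F j)) :
    step (shiftSource m f) i i₁ F = fun j p =>
      sgn ((m : ZMod N) * ((X.sh i : ZMod N) - (Y.sh i₁ : ZMod N) + rdeg p)) •
        step f i i₁ F j p := by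
  funext j p
  have e1 := (hF j).head_zsmul (sgn ((m : ZMod N) * ((X.sh i : ZMod N) - (Y.sh i₁ : ZMod N))))
    (entry (shiftSource m f) i i₁) (entry f i i₁)
    (by simp only [entry, shiftSource, shift]; push_cast; ring) rfl p
  simp only [step]
  rw [e1, smul_smul, smul_smul, ← sgn_add A.even_period, ← sgn_add A.even_period]
  push_cast
  ring_nf

theorem step_shiftTarget (m : ℤ) (f : Elt X Y) (i : X.I) (i₁ : Y.I)
    (F : ∀ j, Chain A.Elt (X.ob i) (Z.ob j) → V j) :
    step (shiftTarget m f) i i₁ F = fun j p => sgn ((m : ZMod N) * rdeg p) •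
        step f i i₁ F j p := by
  funext j p
  have e1 : entry (shiftTarget m f) i i₁ = entry f i i₁ :=
    elt_ext (by simp only [entry, shiftTarget, shift]; push_cast; ring) rfl
  simp only [step]
  rw [e1, smul_smul, ← sgn_add A.even_period]
  push_cast
  rw [show ((X.sh i : ZMod N) - ((Y.sh i₁ : ZMod N) + (m : ZMod N))) * rdeg p =
    ((m : ZMod N) * rdeg p + ((X.sh i : ZMod N) - (Y.sh i₁ : ZMod N)) * rdeg p) -
      ((m : ZMod N) * rdeg p + (m : ZMod N) * rdeg p) by ring,
    sub_eq_add_neg, neg_add, sgn_add_double A.even_period]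

/-- Steps along `δ` in `Z[m]` carry the sign of `shiftHom`, and the sign `◁` does not change. -/
theorem tw_nil_shift (m : ℤ) (i : Z.I) {F : ∀ j, Chain A.Elt (Z.ob i) (Z.ob j) → V j}
    (hF : ∀ j, IsAdditive (F j)) (j : Z.I) :
    tw (.nil (Z.shift m)) i F j =
      sgn ((m : ZMod N) * ((Z.sh i : ZMod N) - (Z.sh j : ZMod N))) • tw (.nil Z) i F j := by
  refine tw_nil_unique (Z := Z.shift m) j (fun i F =>
    sgn ((m : ZMod N) * ((Z.sh i : ZMod N) - (Z.sh j : ZMod N))) • tw (.nil Z) i F j)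
    (fun i => ?_) (fun i F hF => ?_) i F hF
  · rw [tw_zero _ _ _ (fun _ _ => rfl), smul_zero]
  · refine (congrArg (sgn ((m : ZMod N) * ((Z.sh i : ZMod N) - (Z.sh j : ZMod N))) • ·)
      (tw_nil (Z := Z) i hF j)).trans ?_
    dsimp only
    rw [smul_add, Finset.smul_sum]
    congr 1
    · by_cases h : j = i
      · subst h
        rw [sub_self, mul_zero, sgn_zero, one_smul, expand_nil_self]
        exact (expand_nil_self (X := Z.shift m) _ _).symm
      · rw [expand_nil_ne h, smul_zero]
        exact (expand_nil_ne (X := Z.shift m) h _).symm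
    · refine Finset.sum_congr rfl fun i₁ _ => ?_
      rw [show step (Z.shift m).δElt i i₁ F = _ from step_δElt_shift (X := Z) m i i₁ hF]
      refine Eq.trans ?_ (congrArg _ (tw_zsmul (nil Z) i₁ _ (fun _ => _) j).symm)
      rw [smul_smul, ← sgn_add A.even_period]
      exact congrArg (· • _) (congrArg sgn (by ring))

theorem tw_shiftSource (m : ℤ) (f : Elt X Y) (c : Chain (O := PreTw A) Elt Y Z) (i : X.I)
    {F : ∀ j, Chain A.Elt (X.ob i) (Z.ob j) → V j} (hF : ∀ j, IsAdditive (F j)) (j : Z.I) :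
    tw (.cons (shiftSource m f) c) i F j =
      sgn ((m : ZMod N) * ((X.sh i : ZMod N) - (Z.sh j : ZMod N) + wdeg c)) •
        tw (.cons f c) i F j := by
  refine tw_cons_unique (X := X.shift m) _ c j (fun i F =>
    sgn ((m : ZMod N) * ((X.sh i : ZMod N) - (Z.sh j : ZMod N) + wdeg c)) • tw (.cons f c) i F j)
    (fun i => ?_) (fun i F hF => ?_) i F hF
  · rw [tw_zero _ _ _ (fun _ _ => rfl), smul_zero]
  · refine (congrArg _ (tw_cons f c i hF j)).trans ?_
    rw [smul_add, Finset.smul_sum, Finset.smul_sum]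
    congr 1
    · refine Finset.sum_congr rfl fun i₁ _ => ?_
      rw [show step (X.shift m).δElt i i₁ F = _ from step_δElt_shift (X := X) m i i₁ hF]
      refine Eq.trans ?_ (congrArg _ (tw_zsmul (cons f c) i₁ _ (fun _ => _) j).symm)
      rw [smul_smul, ← sgn_add A.even_period]
      ring_nf
    · refine Finset.sum_congr rfl fun i₁ _ => ?_
      rw [show step (shiftSource m f) i i₁ F = _ from step_shiftSource m f i i₁ hF]
      rw [← tw_zsmul c i₁ _ (fun j =>
        sgn ((m : ZMod N) * ((X.sh i : ZMod N) - (Z.sh j : ZMod N) + wdeg c)))]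
      refine tw_congr _ _ _ _ (fun j p hp => ?_) _
      rw [hp, show (m : ZMod N) * ((X.sh i : ZMod N) - (Y.sh i₁ : ZMod N) +
          (wdeg c - (Y.sh i₁ : ZMod N) + (Z.sh j : ZMod N))) =
        (m : ZMod N) * ((X.sh i : ZMod N) - (Z.sh j : ZMod N) + wdeg c) +
          ((m : ZMod N) * ((Z.sh j : ZMod N) - (Y.sh i₁ : ZMod N)) +
          (m : ZMod N) * ((Z.sh j : ZMod N) - (Y.sh i₁ : ZMod N))) by ring,
        sgn_add_double A.even_period]

theorem tw_shiftTarget_shiftSource (m : ℤ) (f : Elt X Y) (g : Elt Y W)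
    (c : Chain (O := PreTw A) Elt W Z) (i : X.I)
    {F : ∀ j, Chain A.Elt (X.ob i) (Z.ob j) → V j} (hF : ∀ j, IsAdditive (F j)) (j : Z.I) :
    tw (.cons (shiftTarget m f) (.cons (shiftSource m g) c)) i F j =
      sgn ((m : ZMod N) * (g.1 - 1)) • tw (.cons f (.cons g c)) i F j := by
  refine tw_cons_unique (X := X) _ _ j (fun i F =>
    sgn ((m : ZMod N) * (g.1 - 1)) • tw (.cons f (.cons g c)) i F j)
    (fun i => ?_) (fun i F hF => ?_) i F hF
  · rw [tw_zero _ _ _ (fun _ _ => rfl), smul_zero]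
  · refine (congrArg _ (tw_cons f _ i hF j)).trans ?_
    rw [smul_add, Finset.smul_sum, Finset.smul_sum]
    congr 1
    refine Finset.sum_congr rfl fun i₁ _ => ?_
    refine Eq.trans ?_ (tw_shiftSource m g c i₁ (isAdditive_step (shiftTarget m f) i i₁ hF) j).symm
    simp only [step_shiftTarget m f i i₁]
    rw [← tw_zsmul _ i₁ _ (fun j => sgn ((m : ZMod N) * (g.1 - 1))),
      ← tw_zsmul _ i₁ _ (fun j =>
        sgn ((m : ZMod N) * ((Y.sh i₁ : ZMod N) - (Z.sh j : ZMod N) + wdeg c)))]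
    refine tw_congr _ _ _ _ (fun j p hp => ?_) _
    rw [hp, smul_smul, ← sgn_add A.even_period,
      ← sgn_add_double A.even_period _ ((m : ZMod N) * wdeg c)]
    congr 2
    simp only [wdeg]
    ring

theorem tw_shiftTarget (m : ℤ) (p : Chain (O := PreTw A) Elt X Y) (f : Elt Y Z) :
    ∀ (i : X.I) {F : ∀ j, Chain A.Elt (X.ob i) (Z.ob j) → V j} (_ : ∀ j, IsAdditive (F j))
    (j : Z.I), tw (p.append (single (shiftTarget m f))) i F j =
      tw (p.append (single f)) i F j := by
  induction p with
  | nil Y =>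
    intro i F hF j
    refine tw_cons_unique (Z := Z.shift m) _ _ j (fun i F => tw (single f) i F j)
      (fun i => tw_zero _ _ _ (fun _ _ => rfl) _) (fun i F hF => ?_) i F hF
    refine (tw_cons (Z := Z) f (nil Z) i hF j).trans ?_
    congr 1
    refine Finset.sum_congr rfl fun i₁ _ => ?_
    refine Eq.trans ?_ (tw_nil_shift m i₁ (isAdditive_step (shiftTarget m f) i i₁ hF) j).symm
    simp only [step_shiftTarget m f i i₁]
    rw [← tw_zsmul _ i₁ _ (fun j =>
        sgn ((m : ZMod N) * ((Z.sh i₁ : ZMod N) - (Z.sh j : ZMod N))))]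
    refine tw_congr _ _ _ _ (fun j p hp => ?_) _
    rw [hp, smul_smul, ← sgn_add A.even_period]
    simp only [wdeg]
    rw [show (m : ZMod N) * ((Z.sh i₁ : ZMod N) - (Z.sh j : ZMod N)) + (m : ZMod N) *
      (0 - (Z.sh i₁ : ZMod N) + (Z.sh j : ZMod N)) = 0 by ring, sgn_zero, one_smul]
  | cons x p ih =>
    intro i F hF j
    refine tw_cons_unique (Z := Z.shift m) _ _ j
      (fun i F => tw (cons x (p.append (single f))) i F j)
      (fun i => tw_zero _ _ _ (fun _ _ => rfl) _) (fun i F hF => ?_) i F hF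
    refine (tw_cons (Z := Z) x (p.append (single f)) i hF j).trans ?_
    congr 1
    exact Finset.sum_congr rfl fun i₁ _ => (ih f i₁ (isAdditive_step x i i₁ hF) j).symm

theorem muTw_shiftSource (m : ℤ) (f : Elt X Y) (c : Chain (O := PreTw A) Elt Y Z) (i : X.I)
    (j : Z.I) : muTw (.cons (shiftSource m f) c) i j =
      sgn ((m : ZMod N) * ((X.sh i : ZMod N) - (Z.sh j : ZMod N) + wdeg c)) •
        muTw (.cons f c) i j :=
  tw_shiftSource m f c i (fun _ => isAdditive_mu _ _) j

theorem muTw_shiftTarget_shiftSource (m : ℤ) (f : Elt X Y) (g : Elt Y W)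
    (c : Chain (O := PreTw A) Elt W Z) :
    muTw (.cons (shiftTarget m f) (.cons (shiftSource m g) c)) =
      sgn ((m : ZMod N) * (g.1 - 1)) • muTw (.cons f (.cons g c)) := by
  funext i j
  exact tw_shiftTarget_shiftSource m f g c i (fun _ => isAdditive_mu _ _) j

theorem muTw_shiftTarget (m : ℤ) (p : Chain (O := PreTw A) Elt X Y) (f : Elt Y Z) :
    muTw (p.append (single (shiftTarget m f))) = muTw (p.append (single f)) := by
  funext i j
  exact tw_shiftTarget m p f i (fun _ => isAdditive_mu _ _) j

/-- The shift `f[m]`. -/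
def shiftElt (m : ℤ) (f : Elt X Y) : Elt (X.shift m) (Y.shift m) := ⟨f.1, shiftHom f.2 m⟩

theorem shiftElt_eq (m : ℤ) (f : Elt X Y) : shiftElt m f = shiftTarget m (shiftSource m f) :=
  Elt.ext (by simp [shiftElt, shiftTarget, shiftSource]) rfl

theorem muTw_single_shiftElt (m : ℤ) (f : Elt X Y) (i : X.I) (j : Y.I) :
    muTw (single (shiftElt m f)) i j =
      sgn ((m : ZMod N) * ((X.sh i : ZMod N) - (Y.sh j : ZMod N))) • muTw (single f) i j := by
  rw [shiftElt_eq]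
  have h := muTw_shiftTarget m (nil _) (shiftSource m f)
  simp only [append] at h
  rw [h]
  refine (muTw_shiftSource m f (nil Y) i j).trans ?_
  rw [wdeg, add_zero]
  rfl

theorem muTw_pair_shiftElt (m : ℤ) (f : Elt X Y) (g : Elt Y Z) (i : X.I) (j : Z.I) :
    muTw (cons (shiftElt m f) (single (shiftElt m g))) i j =
      sgn ((m : ZMod N) * ((X.sh i : ZMod N) - (Z.sh j : ZMod N))) •
        muTw (cons f (single g)) i j := by
  have h1 := muTw_shiftTarget m (single (shiftElt m f)) (shiftSource m g)
  have h2 := muTw_shiftTarget_shiftSource m (shiftSource m f) g (nil Z)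
  have h3 := muTw_shiftSource m f (single g) i j
  rw [shiftElt_eq m g]
  refine (congrFun (congrFun h1 i) j).trans ?_
  rw [shiftElt_eq m f]
  refine (congrFun (congrFun h2 i) j).trans ?_
  simp only [Pi.smul_apply]
  refine (congrArg _ h3).trans ?_
  rw [smul_smul, ← sgn_add A.even_period]
  simp only [single, wdeg, add_zero]
  rw [show (m : ZMod N) * (g.1 - 1) + (m : ZMod N) * ((X.sh i : ZMod N) - (Z.sh j : ZMod N) +
    (g.1 - 1)) = (m : ZMod N) * ((X.sh i : ZMod N) - (Z.sh j : ZMod N)) +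
    ((m : ZMod N) * (g.1 - 1) + (m : ZMod N) * (g.1 - 1)) by ring, sgn_add_double A.even_period]

end Regrade

/-! ### Extensions -/

section Ext

variable {Q R W Y Z : PreTw A}

/-- The extension of `Q` by `R` with connecting morphism `a` of degree one: the sum `Q ⊕ R` with
the differential given by those of `Q` and `R` and by `a`. -/
@[reducible]
def ext (a : Q.Hom R 1) : PreTw A where
  I := Q.I ⊕ R.I
  ob := Sum.elim Q.ob R.ob
  sh := Sum.elim Q.sh R.sh
  δ
    | .inl i, .inl j => Q.δ i j
    | .inl i, .inr j => a.1 i j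
    | .inr _, .inl _ => 0
    | .inr i, .inr j => R.δ i j
  δ_mem
    | .inl i, .inl j => Q.δ_mem i j
    | .inl i, .inr j => a.2 i j
    | .inr _, .inl _ => zero_mem _
    | .inr i, .inr j => R.δ_mem i j
  triangular := by
    obtain ⟨r, hr⟩ := Q.triangular
    obtain ⟨r', hr'⟩ := R.triangular
    refine ⟨Sum.elim r (fun j => Finset.univ.sup r + 1 + r' j), ?_⟩
    rintro (i | i) (j | j) h
    · exact hr i j h
    · have : r i ≤ Finset.univ.sup r := Finset.le_sup (Finset.mem_univ i)
      simp only [Sum.elim_inl, Sum.elim_inr]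
      omega
    · exact absurd rfl h
    · have := hr' i j h
      simp only [Sum.elim_inr]
      omega

variable {a : Q.Hom R 1}

/-- The block from `Q` of a matrix from the extension. -/
def fromL (f : Elt (ext a) W) : Elt Q W := ⟨f.1, fun i j => f.2.1 (.inl i) j,
  fun i j => f.2.2 (.inl i) j⟩

/-- The block from `R` of a matrix from the extension. -/
def fromR (f : Elt (ext a) W) : Elt R W := ⟨f.1, fun i j => f.2.1 (.inr i) j,
  fun i j => f.2.2 (.inr i) j⟩

/-- The block to `Q` of a matrix to the extension. -/
def toL (f : Elt W (ext a)) : Elt W Q := ⟨f.1, fun i j => f.2.1 i (.inl j),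
  fun i j => f.2.2 i (.inl j)⟩

/-- The block to `R` of a matrix to the extension. -/
def toR (f : Elt W (ext a)) : Elt W R := ⟨f.1, fun i j => f.2.1 i (.inr j),
  fun i j => f.2.2 i (.inr j)⟩

section Tw

variable {V : W.I → Type v} [∀ j, AddCommGroup (V j)]

theorem sum_ext_I {M : Type*} [AddCommMonoid M] (f : (ext a).I → M) :
    ∑ x, f x = ∑ i : Q.I, f (.inl i) + ∑ j : R.I, f (.inr j) := Fintype.sum_sum_type f

theorem step_ext_inr_inl (c : Chain (O := PreTw A) Elt (ext a) W) (j : R.I)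
    {F : ∀ l, Chain A.Elt ((ext a).ob (.inr j)) (W.ob l) → V l} (hF : ∀ l, IsAdditive (F l))
    (l : W.I) : ∑ i : Q.I, tw c (.inl i) (step (ext a).δElt (.inr j) (.inl i) F) l = 0 :=
  Finset.sum_eq_zero fun _ _ => tw_step_zero _ (ext a).δElt _ _ hF rfl _

theorem tw_ext_inr (f : Elt (ext a) Y) (c : Chain (O := PreTw A) Elt Y W) (j : R.I)
    {F : ∀ l, Chain A.Elt ((ext a).ob (.inr j)) (W.ob l) → V l} (hF : ∀ l, IsAdditive (F l))
    (l : W.I) : tw (cons f c) (.inr j) F l = tw (cons (fromR f) c) j F l := by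
  refine (tw_cons_unique (X := R) _ c l (fun j F => tw (cons f c) (.inr j) F l)
    (fun i => tw_zero _ _ _ (fun _ _ => rfl) _) (fun j F hF => ?_) j F hF).symm
  refine (tw_cons f c (.inr j) hF l).trans ?_
  rw [sum_ext_I, step_ext_inr_inl _ _ hF, zero_add]
  rfl

theorem tw_ext_inl (f : Elt (ext a) Y) (c : Chain (O := PreTw A) Elt Y W) (i : Q.I)
    {F : ∀ l, Chain A.Elt ((ext a).ob (.inl i)) (W.ob l) → V l} (hF : ∀ l, IsAdditive (F l))
    (l : W.I) : tw (cons f c) (.inl i) F l =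
      tw (cons (fromL f) c) i F l + tw (cons (toElt a) (cons (fromR f) c)) i F l := by
  refine (sub_eq_iff_eq_add.1 (tw_cons_unique (X := Q) (fromL f) c l (fun i F =>
    tw (cons f c) (.inl i) F l - tw (cons (toElt a) (cons (fromR f) c)) i F l)
    (fun i => ?_) (fun i F hF => ?_) i F hF).symm)
  · rw [tw_zero _ _ _ (fun _ _ => rfl), sub_zero]
    exact tw_zero _ _ _ (fun _ _ => rfl) _
  · refine (congrArg₂ (· - ·) (tw_cons f c (.inl i) hF l) (tw_cons (toElt a) _ i hF l)).trans ?_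
    rw [sum_ext_I, Finset.sum_sub_distrib]
    have h : ∀ j : R.I, tw (cons f c) (.inr j) (step (ext a).δElt (.inl i) (.inr j) F) l =
        tw (cons (fromR f) c) j (step (toElt a) i j F) l := fun j =>
      tw_ext_inr f c j (isAdditive_step (ext a).δElt (.inl i) (.inr j) hF) l
    simp only [h]
    have key : ∀ x y z t : V l, x + y + z - (t + y) = x - t + z := by intros; abel
    exact key _ _ _ _

theorem tw_ext_mid (f : Elt Y (ext a)) (g : Elt (ext a) Z) (c : Chain (O := PreTw A) Elt Z W)
    (i : Y.I) {F : ∀ l, Chain A.Elt (Y.ob i) (W.ob l) → V l} (hF : ∀ l, IsAdditive (F l))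
    (l : W.I) : tw (cons f (cons g c)) i F l =
      tw (cons (toL f) (cons (fromL g) c)) i F l +
      tw (cons (toL f) (cons (toElt a) (cons (fromR g) c))) i F l +
      tw (cons (toR f) (cons (fromR g) c)) i F l := by
  refine tw_cons_unique f _ l (fun i F => tw (cons (toL f) (cons (fromL g) c)) i F l +
      tw (cons (toL f) (cons (toElt a) (cons (fromR g) c))) i F l +
      tw (cons (toR f) (cons (fromR g) c)) i F l) (fun i => ?_) (fun i F hF => ?_) i F hF
  · simp only [tw_zero _ _ _ (fun _ _ => rfl), add_zero]
  · simp only [tw_cons _ _ i hF, Finset.sum_add_distrib]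
    rw [sum_ext_I (a := a)]
    have h1 : ∀ j : R.I, tw (cons g c) (.inr j) (step f i (.inr j) F) l =
        tw (cons (fromR g) c) j (step (toR f) i j F) l := fun j =>
      tw_ext_inr g c j (isAdditive_step f i (.inr j) hF) l
    have h2 : ∀ j : Q.I, tw (cons g c) (.inl j) (step f i (.inl j) F) l =
        tw (cons (fromL g) c) j (step (toL f) i j F) l +
        tw (cons (toElt a) (cons (fromR g) c)) j (step (toL f) i j F) l := fun j =>
      tw_ext_inl g c j (isAdditive_step f i (.inl j) hF) l
    simp only [h1, h2, Finset.sum_add_distrib]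
    abel

end Tw

section TwTarget

variable {V : (ext a).I → Type v} [∀ j, AddCommGroup (V j)]

theorem tw_nil_ext_to_inl (x : (ext a).I) {F : ∀ l, Chain A.Elt ((ext a).ob x) ((ext a).ob l) → V l}
    (hF : ∀ l, IsAdditive (F l)) (l : Q.I) : tw (nil (ext a)) x F (.inl l) =
      match (generalizing := false) x, F with
      | .inl i, F => tw (V := fun l => V (.inl l)) (nil Q) i (fun l => F (.inl l)) l
      | .inr _, _ => 0 := by
  refine tw_nil_unique (Z := ext a) (.inl l) (fun x F => match (generalizing := false) x, F with
      | .inl i, F => tw (V := fun l => V (.inl l)) (nil Q) i (fun l => F (.inl l)) l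
      | .inr _, _ => 0) (fun x => ?_) (fun x F hF => ?_) x F hF
  · obtain i | j := x
    · exact tw_zero _ _ _ (fun _ _ => rfl) _
    · rfl
  · rw [sum_ext_I]
    obtain i | j := x
    · refine (tw_nil (V := fun l => V (.inl l)) i (fun l => hF (.inl l)) l).trans ?_
      dsimp only
      rw [Finset.sum_const_zero, add_zero]
      congr 1
      by_cases h : l = i
      · subst h
        exact (expand_nil_self (V := fun l => V (.inl l)) l _).trans
          (expand_nil_self (X := ext a) _ F).symm
      · exact (expand_nil_ne (V := fun l => V (.inl l)) h _).trans
          (expand_nil_ne (X := ext a) (fun h' => h (Sum.inl_injective h')) F).symm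
    · dsimp only
      rw [Finset.sum_const_zero, add_zero, expand_nil_ne (by simp), zero_add]
      refine (Finset.sum_eq_zero fun i _ => ?_).symm
      refine tw_zero _ _ _ (fun l p => ?_) _
      exact (congrArg (_ • ·) ((hF (.inl l)).head_zero (entry (ext a).δElt (.inr j) (.inl i))
        rfl p)).trans (smul_zero _)

theorem tw_nil_ext_to_inr (x : (ext a).I) {F : ∀ l, Chain A.Elt ((ext a).ob x) ((ext a).ob l) → V l}
    (hF : ∀ l, IsAdditive (F l)) (l : R.I) : tw (nil (ext a)) x F (.inr l) =
      match (generalizing := false) x, F with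
      | .inl i, F => tw (V := fun l => V (.inr l)) (single (toElt a)) i (fun l => F (.inr l)) l
      | .inr j, F => tw (V := fun l => V (.inr l)) (nil R) j (fun l => F (.inr l)) l := by
  refine tw_nil_unique (Z := ext a) (.inr l) (fun x F => match (generalizing := false) x, F with
      | .inl i, F => tw (V := fun l => V (.inr l)) (single (toElt a)) i (fun l => F (.inr l)) l
      | .inr j, F => tw (V := fun l => V (.inr l)) (nil R) j (fun l => F (.inr l)) l)
      (fun x => ?_) (fun x F hF => ?_) x F hF
  · obtain i | j := x <;> exact tw_zero _ _ _ (fun _ _ => rfl) _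
  · rw [sum_ext_I]
    obtain i | j := x
    · refine (tw_cons (V := fun l => V (.inr l)) (toElt a) (nil R) i
        (fun l => hF (.inr l)) l).trans ?_
      rw [expand_nil_ne (by simp), zero_add]
      rfl
    · refine (tw_nil (V := fun l => V (.inr l)) j (fun l => hF (.inr l)) l).trans ?_
      dsimp only
      congr 1
      · by_cases h : l = j
        · subst h
          exact (expand_nil_self (V := fun l => V (.inr l)) l _).trans
            (expand_nil_self (X := ext a) _ F).symm
        · exact (expand_nil_ne (V := fun l => V (.inr l)) h _).trans
            (expand_nil_ne (X := ext a) (fun h' => h (Sum.inr_injective h')) F).symm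
      · refine (zero_add _).symm.trans (congrArg (· + _) ?_)
        refine (Finset.sum_eq_zero fun i _ => ?_).symm
        refine tw_zero _ _ _ (fun l p => ?_) _
        exact (congrArg (_ • ·) ((hF (.inr l)).head_zero (entry (ext a).δElt (.inr j) (.inl i))
          rfl p)).trans (smul_zero _)

theorem tw_ext_to_inl (p : Chain (O := PreTw A) Elt W Y) (f : Elt Y (ext a)) :
    ∀ (i : W.I) {F : ∀ l, Chain A.Elt (W.ob i) ((ext a).ob l) → V l}
    (_ : ∀ l, IsAdditive (F l)) (l : Q.I),
    tw (p.append (single f)) i F (.inl l) =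
      tw (V := fun l => V (.inl l)) (p.append (single (toL f))) i (fun l => F (.inl l)) l := by
  induction p with
  | nil Y =>
    intro i F hF l
    refine tw_cons_unique (Z := ext a) f _ (.inl l) (fun i F =>
      tw (V := fun l => V (.inl l)) (single (toL f)) i (fun l => F (.inl l)) l)
      (fun i => tw_zero _ _ _ (fun _ _ => rfl) _) (fun i F hF => ?_) i F hF
    refine (tw_cons (V := fun l => V (.inl l)) (toL f) (nil Q) i (fun l => hF (.inl l)) l).trans ?_
    congr 1
    rw [sum_ext_I]
    simp only [tw_nil_ext_to_inl _ (isAdditive_step f i _ hF)]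
    rw [Finset.sum_const_zero, add_zero]
    rfl
  | cons x p ih =>
    intro i F hF l
    refine tw_cons_unique (Z := ext a) x _ (.inl l) (fun i F =>
      tw (V := fun l => V (.inl l)) (cons x (p.append (single (toL f)))) i
      (fun l => F (.inl l)) l)
      (fun i => tw_zero _ _ _ (fun _ _ => rfl) _) (fun i F hF => ?_) i F hF
    refine (tw_cons (V := fun l => V (.inl l)) x _ i (fun l => hF (.inl l)) l).trans ?_
    congr 1
    refine Finset.sum_congr rfl fun i₁ _ => ?_
    exact (ih f i₁ (isAdditive_step x i i₁ hF) l).symm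

theorem tw_ext_to_inr (p : Chain (O := PreTw A) Elt W Y) (f : Elt Y (ext a)) :
    ∀ (i : W.I) {F : ∀ l, Chain A.Elt (W.ob i) ((ext a).ob l) → V l}
    (_ : ∀ l, IsAdditive (F l)) (l : R.I),
    tw (p.append (single f)) i F (.inr l) =
      tw (V := fun l => V (.inr l)) (p.append (single (toR f))) i (fun l => F (.inr l)) l +
      tw (V := fun l => V (.inr l)) (p.append (cons (toL f) (single (toElt a)))) i
        (fun l => F (.inr l)) l := by
  induction p with
  | nil Y =>
    intro i F hF l
    refine tw_cons_unique (Z := ext a) f _ (.inr l) (fun i F =>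
      tw (V := fun l => V (.inr l)) (single (toR f)) i (fun l => F (.inr l)) l +
      tw (V := fun l => V (.inr l)) (cons (toL f) (single (toElt a))) i (fun l => F (.inr l)) l)
      (fun i => ?_) (fun i F hF => ?_) i F hF
    · exact (congrArg₂ (· + ·) (tw_zero _ _ _ (fun _ _ => rfl) _)
        (tw_zero _ _ _ (fun _ _ => rfl) _)).trans (add_zero _)
    · refine (congrArg₂ (· + ·)
        (tw_cons (V := fun l => V (.inr l)) (toR f) (nil R) i (fun l => hF (.inr l)) l)
        (tw_cons (V := fun l => V (.inr l)) (toL f) (single (toElt a)) i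
          (fun l => hF (.inr l)) l)).trans ?_
      rw [sum_ext_I]
      simp only [tw_nil_ext_to_inr _ (isAdditive_step f i _ hF)]
      rw [Finset.sum_add_distrib]
      have key : ∀ x y z t : V (.inr l), x + y + (z + t) = x + z + (t + y) := by intros; abel
      exact key _ _ _ _
  | cons x p ih =>
    intro i F hF l
    refine tw_cons_unique (Z := ext a) x _ (.inr l) (fun i F =>
      tw (V := fun l => V (.inr l)) (cons x (p.append (single (toR f)))) i
        (fun l => F (.inr l)) l +
      tw (V := fun l => V (.inr l)) (cons x (p.append (cons (toL f) (single (toElt a))))) i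
        (fun l => F (.inr l)) l)
      (fun i => ?_) (fun i F hF => ?_) i F hF
    · exact (congrArg₂ (· + ·) (tw_zero _ _ _ (fun _ _ => rfl) _)
        (tw_zero _ _ _ (fun _ _ => rfl) _)).trans (add_zero _)
    · refine (congrArg₂ (· + ·)
        (tw_cons (V := fun l => V (.inr l)) x _ i (fun l => hF (.inr l)) l)
        (tw_cons (V := fun l => V (.inr l)) x _ i (fun l => hF (.inr l)) l)).trans ?_
      simp only [ih f _ (isAdditive_step x i _ hF)]
      rw [Finset.sum_add_distrib, Finset.sum_add_distrib]
      exact add_add_add_comm _ _ _ _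

end TwTarget

/-! The blocks of `muTw` for chains that start, end or pass in an extension. -/

theorem muTw_ext_inr (f : Elt (ext a) Y) (c : Chain (O := PreTw A) Elt Y W) (j : R.I) :
    muTw (cons f c) (.inr j) = muTw (cons (fromR f) c) j :=
  funext fun l => tw_ext_inr f c j (fun _ => isAdditive_mu _ _) l

theorem muTw_ext_inl (f : Elt (ext a) Y) (c : Chain (O := PreTw A) Elt Y W) (i : Q.I) :
    muTw (cons f c) (.inl i) =
      muTw (cons (fromL f) c) i + muTw (cons (toElt a) (cons (fromR f) c)) i :=
  funext fun l => tw_ext_inl f c i (fun _ => isAdditive_mu _ _) l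

theorem muTw_ext_mid (f : Elt Y (ext a)) (g : Elt (ext a) Z) (c : Chain (O := PreTw A) Elt Z W) :
    muTw (cons f (cons g c)) = muTw (cons (toL f) (cons (fromL g) c)) +
      muTw (cons (toL f) (cons (toElt a) (cons (fromR g) c))) +
      muTw (cons (toR f) (cons (fromR g) c)) :=
  funext fun i => funext fun l => tw_ext_mid f g c i (fun _ => isAdditive_mu _ _) l

theorem muTw_ext_to_inl (p : Chain (O := PreTw A) Elt W Y) (f : Elt Y (ext a)) (i : W.I)
    (l : Q.I) : muTw (p.append (single f)) i (.inl l) = muTw (p.append (single (toL f))) i l :=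
  tw_ext_to_inl p f i (fun _ => isAdditive_mu _ _) l

theorem muTw_ext_to_inr (p : Chain (O := PreTw A) Elt W Y) (f : Elt Y (ext a)) (i : W.I)
    (l : R.I) : muTw (p.append (single f)) i (.inr l) = muTw (p.append (single (toR f))) i l +
      muTw (p.append (cons (toL f) (single (toElt a)))) i l :=
  tw_ext_to_inr p f i (fun _ => isAdditive_mu _ _) l

theorem MaurerCartan.ext (hQ : Q.MaurerCartan) (hR : R.MaurerCartan)
    (ha : muTw (single (toElt a)) = 0) : (ext a).MaurerCartan := by
  rintro x (l | l)
  · refine (tw_nil_ext_to_inl x (fun _ => isAdditive_mu _ _) l).trans ?_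
    obtain i | j := x
    · exact hQ i l
    · rfl
  · refine (tw_nil_ext_to_inr x (fun _ => isAdditive_mu _ _) l).trans ?_
    obtain i | j := x
    · exact congrFun (congrFun ha i) l
    · exact hR j l

end Ext

/-! ### Contractible twisted complexes -/

section Blocks

variable {Q R X Y Z W : PreTw A} {a : Q.Hom R 1} {g : ZMod N}

/-- The morphism to an extension with the given components. -/
def pairTo (f₁ : W.Hom Q g) (f₂ : W.Hom R g) : W.Hom (ext a) g :=
  ⟨fun
    | i, .inl j => f₁.1 i j
    | i, .inr j => f₂.1 i j,
  fun
    | i, .inl j => f₁.2 i j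
    | i, .inr j => f₂.2 i j⟩

/-- The morphism from an extension with the given components. -/
def pairFrom (f₁ : Q.Hom W g) (f₂ : R.Hom W g) : (ext a).Hom W g :=
  ⟨fun
    | .inl i, j => f₁.1 i j
    | .inr i, j => f₂.1 i j,
  fun
    | .inl i, j => f₁.2 i j
    | .inr i, j => f₂.2 i j⟩

theorem toL_pairTo (f₁ : W.Hom Q g) (f₂ : W.Hom R g) :
    toL (toElt (pairTo (a := a) f₁ f₂)) = toElt f₁ := rfl

theorem toR_pairTo (f₁ : W.Hom Q g) (f₂ : W.Hom R g) :
    toR (toElt (pairTo (a := a) f₁ f₂)) = toElt f₂ := rfl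

theorem fromL_pairFrom (f₁ : Q.Hom W g) (f₂ : R.Hom W g) :
    fromL (toElt (pairFrom (a := a) f₁ f₂)) = toElt f₁ := rfl

theorem fromR_pairFrom (f₁ : Q.Hom W g) (f₂ : R.Hom W g) :
    fromR (toElt (pairFrom (a := a) f₁ f₂)) = toElt f₂ := rfl

theorem muTw_zero₁ (c : Chain (O := PreTw A) Elt Y Z) :
    muTw (cons (toElt (0 : X.Hom Y g)) c) = 0 := muTw_entry_zero (nil X) _ rfl c

theorem muTw_zero₂ (f : Elt W X) (c : Chain (O := PreTw A) Elt Y Z) :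
    muTw (cons f (cons (toElt (0 : X.Hom Y g)) c)) = 0 := muTw_entry_zero (single f) _ rfl c

theorem muTw_zsmul₁ (m : ℤ) (f : X.Hom Y g) (c : Chain (O := PreTw A) Elt Y Z) :
    muTw (cons (toElt (m • f)) c) = m • muTw (cons (toElt f) c) :=
  muTw_entry_zsmul (nil X) m (toElt f) (toElt (m • f)) rfl rfl c

theorem muTw_zsmul₂ (m : ℤ) (e : Elt W X) (f : X.Hom Y g) (c : Chain (O := PreTw A) Elt Y Z) :
    muTw (cons e (cons (toElt (m • f)) c)) = m • muTw (cons e (cons (toElt f) c)) :=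
  muTw_entry_zsmul (single e) m (toElt f) (toElt (m • f)) rfl rfl c

theorem muTw_neg₁ (f : X.Hom Y g) (c : Chain (O := PreTw A) Elt Y Z) :
    muTw (cons (toElt (-f)) c) = -muTw (cons (toElt f) c) :=
  map_neg (muTwHom (nil X) g c) f

theorem muTw_neg₂ (e : Elt W X) (f : X.Hom Y g) (c : Chain (O := PreTw A) Elt Y Z) :
    muTw (cons e (cons (toElt (-f)) c)) = -muTw (cons e (cons (toElt f) c)) :=
  map_neg (muTwHom (single e) g c) f

variable (U : A.StrictUnits)

theorem idElt_ext_inl_inl (i l : Q.I) :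
    (idElt U (ext a)).2.1 (.inl i) (.inl l) = (idElt U Q).2.1 i l := by
  by_cases h : l = i
  · subst h
    exact (idElt_self U (ext a) (.inl l)).trans (idElt_self U Q l).symm
  · exact (idElt_ne U (ext a) (fun h' => h (Sum.inl_injective h'))).trans (idElt_ne U Q h).symm

theorem idElt_ext_inr_inr (i l : R.I) :
    (idElt U (ext a)).2.1 (.inr i) (.inr l) = (idElt U R).2.1 i l := by
  by_cases h : l = i
  · subst h
    exact (idElt_self U (ext a) (.inr l)).trans (idElt_self U R l).symm
  · exact (idElt_ne U (ext a) (fun h' => h (Sum.inr_injective h'))).trans (idElt_ne U R h).symm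

theorem idElt_ext_inl_inr (i : Q.I) (l : R.I) :
    (idElt U (ext a)).2.1 (.inl i) (.inr l) = 0 := idElt_ne U (ext a) (by simp)

theorem idElt_ext_inr_inl (i : R.I) (l : Q.I) :
    (idElt U (ext a)).2.1 (.inr i) (.inl l) = 0 := idElt_ne U (ext a) (by simp)

/-- The identity of `X` is a coboundary, that is, `X` is isomorphic to zero in `H⁰(Tw(A))`. -/
def Contractible (X : PreTw A) : Prop :=
  ∃ h : X.Hom X (-1), muTw (single (toElt h)) = (idElt U X).2.1

/-- An extension is contractible if its identity is, up to a coboundary, a morphism `n` that factors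
through the projection to `Q` and the inclusion of `R`: then `n ∘ n = 0`. -/
theorem contractible_of_offDiagonal (hZ : (ext a).MaurerCartan) (h : (ext a).Hom (ext a) (-1))
    (h₁ : ∀ i l, muTw (single (toElt h)) (.inl i) (.inl l) = (idElt U Q).2.1 i l)
    (h₂ : ∀ i l, muTw (single (toElt h)) (.inr i) (.inl l) = 0)
    (h₃ : ∀ i l, muTw (single (toElt h)) (.inr i) (.inr l) = (idElt U R).2.1 i l) :
    Contractible U (ext a) := by
  have hd : wdeg (single (toElt h)) + 2 = 0 := by simp only [single, wdeg, toElt]; ring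
  let n : (ext a).Hom (ext a) 0 :=
    ⟨muTw (single (toElt h)), by have := muTw_mem (single (toElt h)); rwa [hd] at this⟩ -
      ⟨(idElt U (ext a)).2.1, (idElt U (ext a)).2.2⟩
  have hn' : (muElt (single (toElt h))).2.1 = (toElt n).2.1 + (idElt U (ext a)).2.1 :=
    (sub_add_cancel (muTw (single (toElt h))) (idElt U (ext a)).2.1).symm
  have hR : fromR (toElt n) = toElt (0 : R.Hom (ext a) 0) := by
    refine Elt.ext rfl (funext fun i => funext fun l => ?_)
    obtain l | l := l
    · exact sub_eq_zero.2 ((h₂ i l).trans (idElt_ext_inr_inl U i l).symm)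
    · exact sub_eq_zero.2 ((h₃ i l).trans (idElt_ext_inr_inr U i l).symm)
  have hL : toL (fromL (toElt n)) = toElt (0 : Q.Hom Q 0) :=
    Elt.ext rfl (funext fun i => funext fun l =>
      sub_eq_zero.2 ((h₁ i l).trans (idElt_ext_inl_inl U i l).symm))
  -- `n` factors through the projection to `Q` and the inclusion of `R`
  have hnn : muTw (cons (toElt n) (single (toElt n))) = 0 := by
    funext i
    obtain i | i := i
    · rw [muTw_ext_inl, hR, muTw_zero₂, single, muTw_ext_mid, hL, hR]
      simp only [muTw_zero₁, muTw_zero₂, add_zero, Pi.zero_apply]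
      rfl
    · rw [muTw_ext_inr, hR, muTw_zero₁]
      rfl
  have hd' : (muElt (single (toElt h))).1 = 0 := hd
  have hMn : muTw (single (toElt n)) = 0 := by
    have h4 := muTw_entry_add (nil _) _ (toElt n) (idElt U (ext a)) hd' hd' hn' (nil _)
    have h5 := muTw_muTw hZ hZ (toElt h)
    have h6 := muTw_idElt U (ext a)
    simp only [append, single] at h4 h5 h6
    rw [h5, h6, add_zero] at h4
    exact h4.symm
  -- By the Leibniz rule, `μ¹(μ²(n, h)) = -μ²(n, id + n) = -n`, so that `μ²(n, h)` corrects `h`.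
  have h7 := muTw_leibniz hZ hZ hZ (toElt h) (toElt n)
  have h8 := muTw_entry_zero (single (toElt h)) (muElt (single (toElt n))) hMn (nil _)
  have h9 := muTw_entry_add (nil _) _ (toElt n) (idElt U (ext a)) hd' hd' hn' (single (toElt n))
  simp only [append, single] at h7 h8 h9 hnn
  have h10 := muTw_idElt_left U (toElt n)
  rw [single] at h10
  rw [h8, smul_zero, add_zero, h9, hnn, zero_add, h10] at h7
  have hd2 : wdeg (cons (toElt h) (single (toElt n))) + 2 = -1 := by
    simp only [single, wdeg, toElt]; ring
  let h' : (ext a).Hom (ext a) (-1) := h + ⟨muTw (cons (toElt h) (single (toElt n))), by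
    have := muTw_mem (cons (toElt h) (single (toElt n))); rwa [hd2] at this⟩
  refine ⟨h', ?_⟩
  have h11 := muTw_entry_add (nil _) (toElt h') (toElt h)
    (muElt (cons (toElt h) (single (toElt n)))) rfl hd2.symm rfl (nil _)
  simp only [append, single] at h11 ⊢
  rw [h11, eq_neg_of_add_eq_zero_left h7]
  exact (sub_eq_add_neg _ _).symm.trans
    (sub_sub_cancel (muTw (single (toElt h))) (idElt U (ext a)).2.1)

/-- An extension of contractible twisted complexes is contractible. -/
theorem Contractible.ext (hZ : (ext a).MaurerCartan) (hQ : Contractible U Q)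
    (hR : Contractible U R) : Contractible U (ext a) := by
  obtain ⟨h₁, e₁⟩ := hQ
  obtain ⟨h₂, e₂⟩ := hR
  refine contractible_of_offDiagonal U hZ (pairFrom (pairTo h₁ 0) (pairTo 0 h₂)) ?_ ?_ ?_
  · intro i l
    rw [single, muTw_ext_inl, fromL_pairFrom, fromR_pairFrom, Pi.add_apply]
    refine (congrArg₂ (· + ·) (muTw_ext_to_inl (nil Q) _ i l)
      (muTw_ext_to_inl (single (toElt a)) _ i l)).trans ?_
    rw [toL_pairTo, toL_pairTo]
    simp only [append, single, muTw_zero₂, Pi.zero_apply]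
    exact (add_zero _).trans (congrFun (congrFun e₁ i) l)
  · intro i l
    rw [single, muTw_ext_inr, fromR_pairFrom]
    refine (muTw_ext_to_inl (nil R) _ i l).trans ?_
    rw [toL_pairTo]
    simp only [append, single, muTw_zero₁, Pi.zero_apply]
    rfl
  · intro i l
    rw [single, muTw_ext_inr, fromR_pairFrom]
    refine (muTw_ext_to_inr (nil R) _ i l).trans ?_
    rw [toR_pairTo, toL_pairTo]
    simp only [append, single, muTw_zero₁, Pi.zero_apply]
    exact (add_zero _).trans (congrFun (congrFun e₂ i) l)

/-! ### Cones as extensions -/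

/-- The connecting morphism `-f[1] : X[1] → Y` of the cone of `f`. -/
def coneHom (f : X.Hom Y 0) : (X.shift 1).Hom Y 1 :=
  ⟨fun i j => (cone f).δ (.inl i) (.inr j), fun i j => (cone f).δ_mem (.inl i) (.inr j)⟩

theorem cone_eq_ext (f : X.Hom Y 0) : cone f = ext (coneHom f) := by
  unfold cone ext
  congr 1
  funext i j
  rcases i with i | i <;> rcases j with j | j <;> rfl

theorem coneHom_deg (f : X.Hom Y 0) : (toElt (coneHom f)).1 = (shiftSource 1 (toElt f)).1 := by
  simp [toElt, shiftSource]

theorem coneHom_eq (f : X.Hom Y 0) :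
    (toElt (coneHom f)).2.1 = (-1 : ℤ) • (shiftSource 1 (toElt f)).2.1 := by
  funext i j
  change -(sgn _ • f.1 i j) = (-1 : ℤ) • (sgn _ • f.1 i j)
  rw [neg_smul, one_smul]
  push_cast
  rw [one_mul]

theorem muTw_coneHom (p : Chain (O := PreTw A) Elt W (X.shift 1)) (f : X.Hom Y 0)
    (q : Chain (O := PreTw A) Elt Y Z) :
    muTw (p.append (cons (toElt (coneHom f)) q)) =
      -muTw (p.append (cons (shiftSource 1 (toElt f)) q)) := by
  rw [muTw_entry_zsmul p (-1) _ _ (coneHom_deg f) (coneHom_eq f) q, neg_smul, one_smul]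

theorem isClosed_coneHom {f : X.Hom Y 0} (hf : IsClosed f) :
    muTw (single (toElt (coneHom f))) = 0 := by
  have h1 := muTw_coneHom (nil (X.shift 1)) f (nil Y)
  simp only [append] at h1
  rw [single, h1]
  funext i j
  have h2 := muTw_shiftSource 1 (toElt f) (nil Y) i j
  have h3 : muTw (cons (toElt f) (nil Y)) i j = 0 := congrFun (congrFun hf i) j
  rw [h3, smul_zero] at h2
  exact (congrArg Neg.neg h2).trans neg_zero

/-- The cone of a morphism that is invertible up to homotopy is contractible. -/
theorem contractible_cone (hX : X.MaurerCartan) (hY : Y.MaurerCartan) (f : X.Hom Y 0)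
    (hf : IsClosed f) (g : Y.Hom X 0) (hg : IsClosed g) (h₁ : X.Hom X (-1)) (h₂ : Y.Hom Y (-1))
    (e₁ : muTw (cons (toElt f) (single (toElt g))) - (idElt U X).2.1 = muTw (single (toElt h₁)))
    (e₂ : muTw (cons (toElt g) (single (toElt f))) - (idElt U Y).2.1 = muTw (single (toElt h₂))) :
    Contractible U (cone f) := by
  rw [cone_eq_ext]
  have hZ : (ext (coneHom f)).MaurerCartan := (hX.shift 1).ext hY (isClosed_coneHom hf)
  let g' : Y.Hom (X.shift 1) (-1) := ⟨g.1, fun i j => mem_gr (g.2 i j) (by push_cast; ring)⟩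
  have hg' : toElt g' = shiftTarget 1 (toElt g) :=
    Elt.ext (by simp [toElt, shiftTarget]) rfl
  -- the inverse `g : Y → X[1]`, with diagonal blocks that make up for the homotopies
  refine contractible_of_offDiagonal U hZ
    (pairFrom (pairTo (-shiftHom h₁ 1) 0) (pairTo g' (-h₂))) ?_ ?_ ?_
  · intro i l
    rw [single, muTw_ext_inl, fromL_pairFrom, fromR_pairFrom, Pi.add_apply]
    refine (congrArg₂ (· + ·) (muTw_ext_to_inl (nil _) _ i l)
      (muTw_ext_to_inl (single (toElt (coneHom f))) _ i l)).trans ?_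
    rw [toL_pairTo, toL_pairTo, hg']
    have e3 := muTw_coneHom (nil _) f (single (shiftTarget 1 (toElt g)))
    have e4 := muTw_shiftTarget 1 (single (toElt f)) (toElt g)
    have e5 := muTw_shiftSource 1 (toElt f) (single (shiftTarget 1 (toElt g))) i l
    have e6 := muTw_single_shiftElt 1 (toElt h₁) i l
    simp only [append, single] at e3 e4 e5 e6 ⊢
    rw [e3, muTw_neg₁, Pi.neg_apply, Pi.neg_apply, Pi.neg_apply, Pi.neg_apply, e5, e4]
    refine (congrArg (- · + _) e6).trans ?_
    have e7 : muTw (cons (toElt f) (cons (toElt g) (nil X))) i l - (idElt U X).2.1 i l =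
      muTw (cons (toElt h₁) (nil X)) i l := congrFun (congrFun e₁ i) l
    rw [← e7]
    have e8 : sgn (((1 : ℤ) : ZMod N) * ((X.sh i : ZMod N) - ((X.shift 1).sh l : ZMod N) +
        wdeg (cons (shiftTarget 1 (toElt g)) (nil (X.shift 1))))) =
        -sgn (((1 : ℤ) : ZMod N) * ((X.sh i : ZMod N) - (X.sh l : ZMod N))) := by
      simp only [wdeg, shiftTarget, toElt]
      push_cast
      rw [show (1 : ZMod N) * ((X.sh i : ZMod N) - ((X.sh l : ZMod N) + 1) + (0 - 1 - 1 + 0)) =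
        1 * ((X.sh i : ZMod N) - (X.sh l : ZMod N)) - 1 - (1 + 1) by ring, sub_eq_add_neg _ (1 + 1),
        neg_add, sgn_add_double A.even_period, sgn_sub A.even_period _ 1, sgn_one A.even_period]
      ring
    rw [e8]
    by_cases h : l = i
    · subst h
      rw [idElt_self, idElt_self, sub_self, mul_zero, sgn_zero, neg_smul, one_smul]
      have key : ∀ x e : A.Hom (X.ob l) (X.ob l), -(x - e) + - -((1 : ℤ) • x) = e := by
        intro x e
        rw [one_smul]
        abel
      exact key _ _
    · rw [idElt_ne U X h, idElt_ne U _ h, sub_zero, neg_smul, neg_neg]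
      exact neg_add_cancel _
  · intro i l
    rw [single, muTw_ext_inr, fromR_pairFrom]
    refine (muTw_ext_to_inl (nil _) _ i l).trans ?_
    rw [toL_pairTo, hg', muTw_shiftTarget]
    exact congrFun (congrFun hg i) l
  · intro i l
    rw [single, muTw_ext_inr, fromR_pairFrom]
    refine (muTw_ext_to_inr (nil _) _ i l).trans ?_
    rw [toR_pairTo, toL_pairTo, hg']
    have e3 := muTw_coneHom (single (shiftTarget 1 (toElt g))) f (nil Y)
    have e4 := muTw_shiftTarget_shiftSource 1 (toElt g) (toElt f) (nil Y)
    simp only [append, single] at e3 e4 ⊢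
    rw [e3, e4, muTw_neg₁]
    have e7 : muTw (cons (toElt g) (cons (toElt f) (nil Y))) i l - (idElt U Y).2.1 i l =
      muTw (cons (toElt h₂) (nil Y)) i l := congrFun (congrFun e₂ i) l
    have e8 : sgn (((1 : ℤ) : ZMod N) * ((toElt f).1 - 1)) = -1 := by
      simp only [toElt]
      rw [Int.cast_one, one_mul, zero_sub, sgn_neg A.even_period, sgn_one A.even_period]
    rw [e8, neg_smul, neg_neg, one_smul, Pi.neg_apply, Pi.neg_apply, ← e7]
    exact neg_add_eq_iff_eq_add.2 (sub_add_cancel _ _).symm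

theorem Contractible.shift {X : PreTw A} (h : Contractible U X) (m : ℤ) :
    Contractible U (X.shift m) := by
  obtain ⟨h, e⟩ := h
  refine ⟨shiftHom h m, funext fun i => funext fun j => ?_⟩
  refine (muTw_single_shiftElt m (toElt h) i j).trans ?_
  rw [e]
  by_cases hij : j = i
  · subst hij
    rw [sub_self, mul_zero, sgn_zero, one_smul]
    exact (idElt_self U X j).trans (idElt_self U (X.shift m) j).symm
  · rw [idElt_ne U X hij, smul_zero]
    exact (idElt_ne U (X.shift m) hij).symm

end Blocks

/-! ### Reindexing -/

/-- Twisted complexes are equal if they have the same index set and equal data. -/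
theorem mk_congr {I : Type} [Fintype I] {ob ob' : I → A.Ob} {sh sh' : I → ℤ}
    {δ : ∀ i j, A.Hom (ob i) (ob j)} {δ' : ∀ i j, A.Hom (ob' i) (ob' j)} {hδ hδ' tr tr'}
    (hob : ∀ i, ob i = ob' i) (hsh : ∀ i, sh i = sh' i) (h : ∀ i j, HEq (δ i j) (δ' i j)) :
    (⟨I, ob, sh, δ, hδ, tr⟩ : PreTw A) = ⟨I, ob', sh', δ', hδ', tr'⟩ := by
  obtain rfl : ob = ob' := funext hob
  obtain rfl : sh = sh' := funext hsh
  obtain rfl : δ = δ' := funext fun i => funext fun j => eq_of_heq (h i j)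
  rfl

/-- The formal direct sum with the differential of `Z` between the summands given by `e`. -/
@[reducible]
def restrict (Z : PreTw A) {J : Type} [Fintype J] (e : J → Z.I) : PreTw A where
  I := J
  ob i := Z.ob (e i)
  sh i := Z.sh (e i)
  δ i j := Z.δ (e i) (e j)
  δ_mem i j := Z.δ_mem (e i) (e j)
  triangular := by
    obtain ⟨r, hr⟩ := Z.triangular
    exact ⟨fun i => r (e i), fun i j h => hr _ _ h⟩

section Restrict

variable {Z : PreTw A} {J : Type} [Fintype J] (e : J ≃ Z.I)

/-- The matrix `f` with rows and columns indexed by `J`. -/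
def restrictElt (f : Elt Z Z) : Elt (Z.restrict e) (Z.restrict e) :=
  ⟨f.1, fun i j => f.2.1 (e i) (e j), fun i j => f.2.2 (e i) (e j)⟩

variable {V : Z.I → Type v} [∀ j, AddCommGroup (V j)]

theorem tw_nil_restrict (i : J) :
    ∀ {F : ∀ j, Chain A.Elt (Z.ob (e i)) (Z.ob j) → V j} (_ : ∀ j, IsAdditive (F j)) (j : J),
    tw (V := fun j => V (e j)) (nil (Z.restrict e)) i (fun j => F (e j)) j =
      tw (nil Z) (e i) F (e j) := by
  refine (Z.restrict e).δ_induction (P := fun i =>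
    ∀ {F : ∀ j, Chain A.Elt (Z.ob (e i)) (Z.ob j) → V j} (_ : ∀ j, IsAdditive (F j)) (j : J),
    tw (V := fun j => V (e j)) (nil (Z.restrict e)) i (fun j => F (e j)) j =
      tw (nil Z) (e i) F (e j)) (fun i ih F hF j => ?_) i
  refine (tw_nil (Z := Z.restrict e) (V := fun j => V (e j)) i (fun j => hF (e j)) j).trans ?_
  rw [tw_nil _ hF]
  congr 1
  · by_cases h : j = i
    · subst h
      exact (expand_nil_self (X := Z.restrict e) (V := fun j => V (e j)) j _).trans (expand_nil_self (X := Z) _ F).symm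
    · exact (expand_nil_ne (X := Z.restrict e) (V := fun j => V (e j)) h _).trans
        (expand_nil_ne (X := Z) (fun h' => h (e.injective h')) F).symm
  · rw [← e.sum_comp]
    refine Finset.sum_congr rfl fun i₁ _ => ?_
    by_cases h1 : Z.δ (e i) (e i₁) = 0
    · rw [tw_step_zero _ Z.δElt _ _ hF h1]
      exact tw_step_zero (Z := Z.restrict e) (V := fun j => V (e j)) _ (Z.restrict e).δElt i i₁
        (fun j => hF (e j)) h1 _
    · exact ih i₁ h1 (isAdditive_step Z.δElt _ _ hF) j

theorem tw_single_restrictElt (f : Elt Z Z) (i : J) :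
    ∀ {F : ∀ j, Chain A.Elt (Z.ob (e i)) (Z.ob j) → V j} (_ : ∀ j, IsAdditive (F j)) (j : J),
    tw (V := fun j => V (e j)) (single (restrictElt e f)) i (fun j => F (e j)) j =
      tw (single f) (e i) F (e j) := by
  refine (Z.restrict e).δ_induction (P := fun i =>
    ∀ {F : ∀ j, Chain A.Elt (Z.ob (e i)) (Z.ob j) → V j} (_ : ∀ j, IsAdditive (F j)) (j : J),
    tw (V := fun j => V (e j)) (single (restrictElt e f)) i (fun j => F (e j)) j =
      tw (single f) (e i) F (e j)) (fun i ih F hF j => ?_) i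
  refine (tw_cons (Z := Z.restrict e) (V := fun j => V (e j)) _ _ i (fun j => hF (e j)) j).trans ?_
  rw [single, tw_cons _ _ _ hF]
  congr 1
  · rw [← e.sum_comp]
    refine Finset.sum_congr rfl fun i₁ _ => ?_
    by_cases h1 : Z.δ (e i) (e i₁) = 0
    · rw [tw_step_zero _ Z.δElt _ _ hF h1]
      exact tw_step_zero (Z := Z.restrict e) (V := fun j => V (e j)) _ (Z.restrict e).δElt i i₁
        (fun j => hF (e j)) h1 _
    · exact ih i₁ h1 (isAdditive_step Z.δElt _ _ hF) j
  · rw [← e.sum_comp]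
    exact Finset.sum_congr rfl fun i₁ _ => tw_nil_restrict e i₁ (isAdditive_step f _ _ hF) j

theorem MaurerCartan.restrict (hZ : Z.MaurerCartan) : (Z.restrict e).MaurerCartan :=
  fun i j => (tw_nil_restrict e i (fun _ => isAdditive_mu _ _) j).trans (hZ (e i) (e j))

variable (U : A.StrictUnits)

/-- A contraction of the reindexed complex, with its indices renamed, is a contraction. -/
theorem Contractible.of_restrict (h : Contractible U (Z.restrict e)) : Contractible U Z := by
  obtain ⟨h', he⟩ := h
  let h : ∀ x y, A.Hom (Z.ob x) (Z.ob y) :=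
    Equiv.piCongrLeft (fun x => ∀ y, A.Hom (Z.ob x) (Z.ob y)) e fun i =>
      Equiv.piCongrLeft (fun y => A.Hom (Z.ob (e i)) (Z.ob y)) e (h'.1 i)
  have hh : ∀ i j, h (e i) (e j) = h'.1 i j := fun i j => by
    simp only [h, Equiv.piCongrLeft_apply_apply]
  let h₁ : Z.Hom Z (-1) := ⟨h, fun x y => by
    obtain ⟨i, rfl⟩ := e.surjective x
    obtain ⟨j, rfl⟩ := e.surjective y
    rw [hh]
    exact h'.2 i j⟩
  have hr : restrictElt e (toElt h₁) = toElt h' :=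
    Elt.ext rfl (funext fun i => funext fun j => hh i j)
  refine ⟨h₁, funext fun x => funext fun y => ?_⟩
  obtain ⟨i, rfl⟩ := e.surjective x
  obtain ⟨j, rfl⟩ := e.surjective y
  refine (tw_single_restrictElt e (toElt h₁) i (fun _ => isAdditive_mu _ _) j).symm.trans ?_
  rw [hr]
  refine (congrFun (congrFun he i) j).trans ?_
  by_cases hij : j = i
  · subst hij
    exact (idElt_self U (Z.restrict e) j).trans (idElt_self U Z (e j)).symm
  · exact (idElt_ne U (Z.restrict e) hij).trans
      (idElt_ne U Z (fun h' => hij (e.injective h'))).symm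

end Restrict

/-- If the summands indexed by `J₂` form a contractible subcomplex and those indexed by `J₁` a
contractible quotient, then the whole twisted complex is contractible. -/
theorem contractible_of_partition (U : A.StrictUnits) {Z : PreTw A} (hZ : Z.MaurerCartan)
    {J₁ J₂ : Type} [Fintype J₁] [Fintype J₂] (e : J₁ ⊕ J₂ ≃ Z.I)
    (h0 : ∀ i j, Z.δ (e (.inr i)) (e (.inl j)) = 0)
    (h₁ : Contractible U (Z.restrict fun i => e (.inl i)))
    (h₂ : Contractible U (Z.restrict fun i => e (.inr i))) : Contractible U Z := by
  let ψ : (Z.restrict fun i => e (.inl i)).Hom (Z.restrict fun i => e (.inr i)) 1 :=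
    ⟨fun i j => Z.δ (e (.inl i)) (e (.inr j)), fun i j => Z.δ_mem (e (.inl i)) (e (.inr j))⟩
  have hψ : Z.restrict e = PreTw.ext ψ := by
    refine mk_congr ?_ ?_ ?_
    · rintro (i | i) <;> rfl
    · rintro (i | i) <;> rfl
    · rintro (i | i) (j | j)
      · rfl
      · rfl
      · exact heq_of_eq (h0 i j)
      · rfl
  refine Contractible.of_restrict e U ?_
  have hM := hZ.restrict e
  rw [hψ] at hM ⊢
  exact Contractible.ext U hM h₁ h₂

/-! ### Block matrices -/

section BlockMatrices

variable {Q R W X Y Z : PreTw A} {a : Q.Hom R 1} {g g' : ZMod N}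

/-- The matrix to an extension with the given blocks. -/
def rowBlk (a : Q.Hom R 1) (u : ∀ i j, A.Hom (W.ob i) (Q.ob j))
    (v : ∀ i j, A.Hom (W.ob i) (R.ob j)) : ∀ i j, A.Hom (W.ob i) ((ext a).ob j)
  | i, .inl j => u i j
  | i, .inr j => v i j

/-- The matrix from an extension with the given blocks. -/
def colBlk (a : Q.Hom R 1) (u : ∀ i j, A.Hom (Q.ob i) (W.ob j))
    (v : ∀ i j, A.Hom (R.ob i) (W.ob j)) : ∀ i j, A.Hom ((ext a).ob i) (W.ob j)
  | .inl i, j => u i j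
  | .inr i, j => v i j

theorem rowBlk_zero : rowBlk a (0 : ∀ i j, A.Hom (W.ob i) (Q.ob j)) 0 = 0 := by
  funext i j
  rcases j with j | j <;> rfl

theorem colBlk_zero : colBlk a (0 : ∀ i j, A.Hom (Q.ob i) (W.ob j)) 0 = 0 := by
  funext i j
  rcases i with i | i <;> rfl

theorem rowBlk_add (u u' : ∀ i j, A.Hom (W.ob i) (Q.ob j)) (v v' : ∀ i j, A.Hom (W.ob i) (R.ob j)) :
    rowBlk a u v + rowBlk a u' v' = rowBlk a (u + u') (v + v') := by
  funext i j
  rcases j with j | j <;> rfl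

theorem colBlk_add (u u' : ∀ i j, A.Hom (Q.ob i) (W.ob j)) (v v' : ∀ i j, A.Hom (R.ob i) (W.ob j)) :
    colBlk a u v + colBlk a u' v' = colBlk a (u + u') (v + v') := by
  funext i j
  rcases i with i | i <;> rfl

theorem muTw_pairTo (p : Chain (O := PreTw A) Elt W X) (f₁ : X.Hom Q g) (f₂ : X.Hom R g) :
    muTw (p.append (single (toElt (pairTo (a := a) f₁ f₂)))) =
      rowBlk a (muTw (p.append (single (toElt f₁))))
        (muTw (p.append (single (toElt f₂))) +
          muTw (p.append (cons (toElt f₁) (single (toElt a))))) := by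
  funext i j
  rcases j with j | j
  · exact muTw_ext_to_inl p _ i j
  · exact muTw_ext_to_inr p _ i j

theorem muTw_pairFrom (f₁ : Q.Hom X g) (f₂ : R.Hom X g) (c : Chain (O := PreTw A) Elt X W) :
    muTw (cons (toElt (pairFrom (a := a) f₁ f₂)) c) =
      colBlk a (muTw (cons (toElt f₁) c) + muTw (cons (toElt a) (cons (toElt f₂) c)))
        (muTw (cons (toElt f₂) c)) := by
  funext i
  rcases i with i | i
  · exact muTw_ext_inl _ c i
  · exact muTw_ext_inr _ c i

theorem muTw_pairTo_pairFrom (f₁ : X.Hom Q g) (f₂ : X.Hom R g) (h₁ : Q.Hom Y g') (h₂ : R.Hom Y g')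
    (c : Chain (O := PreTw A) Elt Y W) :
    muTw (cons (toElt (pairTo (a := a) f₁ f₂)) (cons (toElt (pairFrom h₁ h₂)) c)) =
      muTw (cons (toElt f₁) (cons (toElt h₁) c)) +
      muTw (cons (toElt f₁) (cons (toElt a) (cons (toElt h₂) c))) +
      muTw (cons (toElt f₂) (cons (toElt h₂) c)) :=
  muTw_ext_mid _ _ c

theorem muTw_pairTo₁ (f₁ : X.Hom Q g) (f₂ : X.Hom R g) :
    muTw (cons (toElt (pairTo (a := a) f₁ f₂)) (nil _)) = rowBlk a (muTw (cons (toElt f₁) (nil _)))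
      (muTw (cons (toElt f₂) (nil _)) + muTw (cons (toElt f₁) (cons (toElt a) (nil _)))) :=
  muTw_pairTo (nil X) f₁ f₂

theorem muTw_pairTo₂ (e : Elt W X) (f₁ : X.Hom Q g) (f₂ : X.Hom R g) :
    muTw (cons e (cons (toElt (pairTo (a := a) f₁ f₂)) (nil _))) =
      rowBlk a (muTw (cons e (cons (toElt f₁) (nil _))))
      (muTw (cons e (cons (toElt f₂) (nil _))) +
        muTw (cons e (cons (toElt f₁) (cons (toElt a) (nil _))))) :=
  muTw_pairTo (single e) f₁ f₂

theorem muTw_zero₃ (e : Elt W X) (e' : Elt X Y) (c : Chain (O := PreTw A) Elt Z Q) :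
    muTw (cons e (cons e' (cons (toElt (0 : Y.Hom Z g)) c))) = 0 :=
  muTw_entry_zero (cons e (single e')) _ rfl c

variable (U : A.StrictUnits)

/-- The identity. -/
def idHom (X : PreTw A) : X.Hom X 0 := (idElt U X).2

theorem muTw_idHom₁ : muTw (cons (toElt (idHom U X)) (nil _)) = 0 := muTw_idElt U X

theorem muTw_idHom_left (f : X.Hom Y g) :
    muTw (cons (toElt (idHom U X)) (cons (toElt f) (nil _))) = f.1 := muTw_idElt_left U (toElt f)

theorem muTw_idHom_right₀ (f : X.Hom Y 0) :
    muTw (cons (toElt f) (cons (toElt (idHom U Y)) (nil _))) = f.1 := by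
  have := muTw_idElt_right U (toElt f)
  refine this.trans ?_
  simp only [toElt]
  rw [sgn_zero, one_smul]

theorem muTw_idHom_right₁ (f : X.Hom Y 1) :
    muTw (cons (toElt f) (cons (toElt (idHom U Y)) (nil _))) = -f.1 := by
  have := muTw_idElt_right U (toElt f)
  refine this.trans ?_
  simp only [toElt]
  rw [sgn_one A.even_period, neg_smul, one_smul]

theorem idHom_ext : (idHom U (ext a)).1 = colBlk a (rowBlk a (idHom U Q).1 0)
    (rowBlk a 0 (idHom U R).1) := by
  funext i j
  rcases i with i | i <;> rcases j with j | j
  · exact idElt_ext_inl_inl U i j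
  · exact idElt_ext_inl_inr U i j
  · exact idElt_ext_inr_inl U i j
  · exact idElt_ext_inr_inr U i j

variable {U}

theorem unitLike_idHom : UnitLike U (toElt (idHom U X)) := unitLike_idElt U X

theorem unitLike_zero : UnitLike U (toElt (0 : X.Hom Y g)) := fun _ _ => .inl rfl

theorem UnitLike.pairTo {f₁ : X.Hom Q g} {f₂ : X.Hom R g} (h₁ : UnitLike U (toElt f₁))
    (h₂ : UnitLike U (toElt f₂)) : UnitLike U (toElt (PreTw.pairTo (a := a) f₁ f₂)) := by
  rintro i (j | j)
  · exact h₁ i j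
  · exact h₂ i j

theorem UnitLike.muTw₁ {f : Elt X Y} (h : UnitLike U f) (e : Elt Y Z) (e' : Elt Z W) :
    muTw (cons f (cons e (cons e' (nil _)))) = 0 :=
  muTw_unitLike_eq_zero U h (nil X) (cons e (single e')) (by simp [length, single])

theorem UnitLike.muTw₂ {f : Elt X Y} (h : UnitLike U f) (e : Elt Z X) (e' : Elt Y W) :
    muTw (cons e (cons f (cons e' (nil _)))) = 0 :=
  muTw_unitLike_eq_zero U h (single e) (single e') (by simp [length, single])

theorem UnitLike.muTw₃ {f : Elt X Y} (h : UnitLike U f) (e : Elt Z W) (e' : Elt W X) :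
    muTw (cons e (cons e' (cons f (nil _)))) = 0 :=
  muTw_unitLike_eq_zero U h (cons e (single e')) (nil Y) (by simp [length, single])

end BlockMatrices

/-! ### The octahedral axiom -/

section Octahedral

variable {X Y Z : PreTw A}

/-- The composition of `f` and `g`. -/
def compHom (f : X.Hom Y 0) (g : Y.Hom Z 0) : X.Hom Z 0 :=
  ⟨muTw (cons (toElt f) (single (toElt g))), by
    have h := muTw_mem (cons (toElt f) (single (toElt g)))
    have e : wdeg (cons (toElt f) (single (toElt g))) + 2 = 0 := by
      simp only [wdeg, toElt, single]; ring
    rwa [e] at h⟩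

theorem isClosed_compHom (hX : X.MaurerCartan) (hY : Y.MaurerCartan) (hZ : Z.MaurerCartan)
    {f : X.Hom Y 0} {g : Y.Hom Z 0} (hf : IsClosed f) (hg : IsClosed g) :
    IsClosed (compHom f g) := by
  have h := muTw_leibniz hX hY hZ (toElt f) (toElt g)
  have h1 := muTw_entry_zero (nil X) (muElt (single (toElt f))) hf (single (toElt g))
  have h2 := muTw_entry_zero (single (toElt f)) (muElt (single (toElt g))) hg (nil Z)
  simp only [append, single] at h h1 h2
  rw [h1, h2, smul_zero, add_zero, add_zero] at h
  have h3 : toElt (compHom f g) = muElt (cons (toElt f) (single (toElt g))) := by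
    refine Elt.ext ?_ rfl
    simp only [muElt, wdeg, toElt, single]; ring
  change muTw (single (toElt (compHom f g))) = 0
  rw [h3]
  exact h

theorem isClosed_shiftHom {f : X.Hom Y 0} (hf : IsClosed f) (m : ℤ) :
    IsClosed (shiftHom f m) := by
  funext i j
  refine (muTw_single_shiftElt m (toElt f) i j).trans ?_
  exact (congrArg _ (congrFun (congrFun hf i) j)).trans (smul_zero _)

theorem coneHom_apply (f : X.Hom Y 0) (i : X.I) (j : Y.I) :
    (coneHom f).1 i j = -(sgn ((X.sh i : ZMod N) - (Y.sh j : ZMod N)) • f.1 i j) := rfl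

/-- The connecting morphism `-(gf)[1]` of the cone of `gf`, as `f[1]` followed by `-g[1]`. -/
theorem muTw_shiftHom_coneHom (f : X.Hom Y 0) (g : Y.Hom Z 0) :
    muTw (cons (toElt (shiftHom f 1)) (cons (toElt (coneHom g)) (nil _))) =
      (coneHom (compHom f g)).1 := by
  have h1 := muTw_coneHom (single (toElt (shiftHom f 1))) g (nil _)
  simp only [append, single] at h1
  rw [h1]
  funext i j
  have h2 : toElt (shiftHom f 1) = shiftTarget 1 (shiftSource 1 (toElt f)) :=
    shiftElt_eq 1 (toElt f)
  rw [h2, muTw_shiftTarget_shiftSource]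
  have h3 := muTw_shiftSource 1 (toElt f) (single (toElt g)) i j
  refine (congrArg (fun x => -(sgn (((1 : ℤ) : ZMod N) * ((toElt g).1 - 1)) • x)) h3).trans ?_
  rw [coneHom_apply, smul_smul, ← sgn_add A.even_period]
  simp only [wdeg, single, toElt, Int.cast_one]
  have e : (1 : ZMod N) * (0 - 1) + 1 * ((X.sh i : ZMod N) - (Z.sh j : ZMod N) + (0 - 1 + 0)) =
    (X.sh i : ZMod N) - (Z.sh j : ZMod N) + (-1 + -1) := by ring
  rw [e, sgn_add_double A.even_period]
  rfl

/-- The connecting morphism `-(gf)[1]` of the cone of `gf`, up to sign, as `-f[1]` followed by `g`. -/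
theorem muTw_coneHom_left (f : X.Hom Y 0) (g : Y.Hom Z 0) :
    muTw (cons (toElt (coneHom f)) (cons (toElt g) (nil _))) = -(coneHom (compHom f g)).1 := by
  have h1 := muTw_coneHom (nil _) f (single (toElt g))
  simp only [append, single] at h1
  rw [h1]
  funext i j
  have h3 := muTw_shiftSource 1 (toElt f) (single (toElt g)) i j
  refine (congrArg Neg.neg h3).trans ?_
  rw [Pi.neg_apply, Pi.neg_apply, coneHom_apply, neg_neg, ← neg_smul]
  simp only [wdeg, single, toElt, Int.cast_one]
  have e : (1 : ZMod N) * ((X.sh i : ZMod N) - (Z.sh j : ZMod N) + (0 - 1 + 0)) =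
    (X.sh i : ZMod N) - (Z.sh j : ZMod N) - 1 := by ring
  rw [e, sgn_sub A.even_period, sgn_one A.even_period, mul_neg_one, neg_neg]
  rfl

variable (U : A.StrictUnits)

theorem compHom_id_right (f : X.Hom Y 0) : compHom f (idHom U Y) = f :=
  Subtype.ext (muTw_idHom_right₀ U f)

theorem compHom_id_left (f : X.Hom Y 0) : compHom (idHom U X) f = f :=
  Subtype.ext (muTw_idHom_left U f)

/-- The identity as a morphism `Y[1] → Y` of degree one. -/
def suspension (Y : PreTw A) : (Y.shift 1).Hom Y 1 := -coneHom (idHom U Y)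

theorem unitLike_suspension : UnitLike U (toElt (suspension U Y)) := by
  intro i j
  by_cases h : j = i
  · subst h
    right
    have e : entry (toElt (suspension U Y)) j j = (⟨0, U.e (Y.ob j)⟩ : A.Elt _ _) := by
      refine elt_ext ?_ ?_
      · simp [entry, toElt]
      · change - -(sgn ((Y.sh j : ZMod N) - (Y.sh j : ZMod N)) • (idElt U Y).2.1 j j) = _
        rw [sub_self, sgn_zero, one_smul, neg_neg, idElt_self]
    rw [e]
    exact .mk _
  · left
    change - -(sgn ((Y.sh i : ZMod N) - (Y.sh j : ZMod N)) • (idElt U Y).2.1 i j) = _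
    rw [idElt_ne U Y h, smul_zero, neg_zero, neg_zero]

theorem muTw_suspension : muTw (cons (toElt (suspension U Y)) (nil _)) = 0 := by
  rw [suspension, muTw_neg₁]
  exact (congrArg Neg.neg (isClosed_coneHom (muTw_idElt U Y))).trans neg_zero

theorem muTw_shiftHom_suspension (f : X.Hom Y 0) :
    muTw (cons (toElt (shiftHom f 1)) (cons (toElt (suspension U Y)) (nil _))) =
      -(coneHom f).1 := by
  rw [suspension, muTw_neg₂, muTw_shiftHom_coneHom, compHom_id_right]

theorem muTw_suspension_left (g : Y.Hom Z 0) :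
    muTw (cons (toElt (suspension U Y)) (cons (toElt g) (nil _))) = (coneHom g).1 := by
  rw [suspension, muTw_neg₁, muTw_coneHom_left, compHom_id_left, neg_neg]

/-- The connecting morphism `Cone(g) → Cone(f)` of degree one of the octahedron. It identifies the
summand `Y[1]` of `Cone(g)` with the summand `Y` of `Cone(f)`. -/
def octConn (f : X.Hom Y 0) (g : Y.Hom Z 0) : (ext (coneHom g)).Hom (ext (coneHom f)) 1 :=
  pairFrom (pairTo 0 (suspension U Y)) 0

/-- The inclusion of the cone of the composition in the extension of `Cone(g)` by `Cone(f)`: the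
summand `X[1]` is mapped identically and by `f[1]` to `Y[1]`, the summand `Z` identically. -/
def octIncl (f : X.Hom Y 0) (g : Y.Hom Z 0) :
    (ext (coneHom (compHom f g))).Hom (ext (octConn U f g)) 0 :=
  pairFrom (pairTo (pairTo (shiftHom f 1) 0) (pairTo (idHom U _) 0))
    (pairTo (pairTo 0 (idHom U _)) 0)

/-- The projection to the cone of the composition: it is the identity on `X[1]` and `Z`, zero on
`Y[1]` and `g` on `Y`. -/
def octProj (f : X.Hom Y 0) (g : Y.Hom Z 0) :
    (ext (octConn U f g)).Hom (ext (coneHom (compHom f g))) 0 :=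
  pairFrom (pairFrom 0 (pairTo 0 (idHom U _))) (pairFrom (pairTo (idHom U _) 0) (pairTo 0 g))

theorem isClosed_octConn (f : X.Hom Y 0) (g : Y.Hom Z 0) : IsClosed (octConn U f g) := by
  change muTw (cons (toElt (pairFrom _ _)) (nil _)) = 0
  simp only [muTw_pairFrom, muTw_pairTo₁, muTw_zero₁, muTw_zero₂, muTw_suspension, add_zero,
    rowBlk_zero, colBlk_zero]

theorem isClosed_octIncl (f : X.Hom Y 0) (g : Y.Hom Z 0) (hf : IsClosed f) :
    IsClosed (octIncl U f g) := by
  change muTw (cons (toElt (pairFrom _ _)) (nil _)) = 0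
  have hf' : muTw (cons (toElt (shiftHom f 1)) (nil _)) = 0 := isClosed_shiftHom hf 1
  have h3 : muTw (cons (toElt (coneHom (compHom f g)))
      (cons (toElt (pairTo (a := coneHom g) 0 (idHom U Z)))
        (cons (toElt (octConn U f g)) (nil _)))) = 0 :=
    (unitLike_zero.pairTo unitLike_idHom).muTw₂ _ _
  rw [octConn] at h3 ⊢
  simp only [muTw_pairFrom, muTw_pairTo_pairFrom, muTw_pairTo₁, muTw_pairTo₂, muTw_zero₁,
    muTw_zero₂, muTw_zero₃, muTw_idHom₁, muTw_idHom_left, muTw_idHom_right₁, hf', h3,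
    muTw_shiftHom_coneHom, muTw_shiftHom_suspension, rowBlk_add, add_neg_cancel,
    add_zero, zero_add, rowBlk_zero, colBlk_zero]

theorem isClosed_octProj (f : X.Hom Y 0) (g : Y.Hom Z 0) (hg : IsClosed g) :
    IsClosed (octProj U f g) := by
  change muTw (cons (toElt (pairFrom _ _)) (nil _)) = 0
  have hg' : muTw (cons (toElt g) (nil _)) = 0 := hg
  rw [octConn]
  simp only [muTw_pairFrom, muTw_pairTo_pairFrom, muTw_pairTo₁, muTw_pairTo₂, muTw_zero₁,
    muTw_zero₂, muTw_idHom₁, muTw_idHom_left, muTw_idHom_right₁, hg',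
    muTw_coneHom_left, muTw_suspension_left,
    rowBlk_add, add_neg_cancel, ZeroMemClass.coe_zero, neg_zero,
    add_zero, zero_add, rowBlk_zero, colBlk_zero]
  refine (congrArg (fun x => colBlk _ x 0) ((colBlk_add _ _ _ _).trans ?_)).trans colBlk_zero
  rw [rowBlk_add, neg_add_cancel, add_zero, rowBlk_zero, add_zero, colBlk_zero]

theorem compHom_octIncl_octProj (f : X.Hom Y 0) (g : Y.Hom Z 0) :
    compHom (octIncl U f g) (octProj U f g) = idHom U _ := by
  refine Subtype.ext ?_
  change muTw (cons (toElt (pairFrom _ _)) (cons (toElt (pairFrom _ _)) (nil _))) = _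
  rw [octConn]
  simp only [muTw_pairFrom, muTw_pairTo_pairFrom, muTw_pairTo₂, muTw_zero₁,
    muTw_zero₂, muTw_zero₃, muTw_idHom_left,
    (unitLike_zero.pairTo unitLike_idHom : UnitLike U _).muTw₃,
    (unitLike_idHom : UnitLike U (toElt (idHom U (X.shift 1)))).muTw₁,
    (unitLike_zero.pairTo (unitLike_suspension U)).muTw₂,
    ((unitLike_zero.pairTo unitLike_idHom).pairTo unitLike_zero : UnitLike U _).muTw₂,
    add_zero, zero_add, rowBlk_zero, idHom_ext]

/-! ### Split-generation -/

/-- `X` satisfies the Maurer-Cartan equation and is split-generated by `K`. Unlike `SplitGenerates`,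
this can be rewritten along equalities in `PreTw A`. -/
def Gen (K : Tw A) (X : PreTw A) : Prop :=
  ∃ hX : X.MaurerCartan, Tw.SplitGenerates U K ⟨X, hX⟩

variable {U} {K : Tw A}

theorem Gen.shift (h : Gen U K X) (m : ℤ) : Gen U K (X.shift m) :=
  ⟨h.1.shift m, .shift h.2 m⟩

theorem Gen.cone (hX : Gen U K X) (hY : Gen U K Y) (f : X.Hom Y 0) (hf : IsClosed f) :
    Gen U K (cone f) :=
  ⟨hX.1.cone f hY.1 hf, .cone hX.2 hY.2 f hf⟩

theorem Gen.summand (hY : Gen U K Y) (hX : X.MaurerCartan) (i : X.Hom Y 0) (p : Y.Hom X 0)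
    (hi : IsClosed i) (hp : IsClosed p) (h : compHom i p = idHom U X) : Gen U K X := by
  refine ⟨hX, .summand hY.2 ⟨i, p, hi, hp, 0, ?_⟩⟩
  have h' : (compHom i p).1 = (idHom U X).1 := congrArg Subtype.val h
  exact (sub_eq_zero.2 h').trans (muTw_zero₁ _).symm

/-- Every extension is a cone. -/
theorem cone_shiftSource_neg_one (a : X.Hom Y 1) (b : (X.shift (-1)).Hom Y 0)
    (hb : ∀ i j, b.1 i j = sgn ((X.sh i : ZMod N) - (Y.sh j : ZMod N)) • a.1 i j) :
    PreTw.cone b = ext a := by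
  refine mk_congr ?_ ?_ ?_
  · rintro (i | i) <;> rfl
  · rintro (i | i)
    · change X.sh i + -1 + 1 = X.sh i
      ring
    · rfl
  · rintro (i | i) (j | j)
    · refine heq_of_eq ?_
      change sgn (((1 : ℤ) : ZMod N) * (((X.sh i + -1 : ℤ) : ZMod N) -
        ((X.sh j + -1 : ℤ) : ZMod N))) •
        sgn (((-1 : ℤ) : ZMod N) * ((X.sh i : ZMod N) - (X.sh j : ZMod N))) • X.δ i j = X.δ i j
      rw [smul_smul, ← sgn_add A.even_period]
      push_cast
      rw [show (1 : ZMod N) * ((X.sh i : ZMod N) + -1 - (X.sh j + -1)) +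
        -1 * ((X.sh i : ZMod N) - X.sh j) = 0 by ring, sgn_zero, one_smul]
    · refine heq_of_eq ?_
      change -(sgn (((X.sh i + -1 : ℤ) : ZMod N) - (Y.sh j : ZMod N)) • b.1 i j) = a.1 i j
      rw [hb, smul_smul, ← sgn_add A.even_period, ← neg_smul]
      push_cast
      rw [show ((X.sh i : ZMod N) + -1 - Y.sh j) + ((X.sh i : ZMod N) - Y.sh j) =
        -1 + (((X.sh i : ZMod N) - Y.sh j) + ((X.sh i : ZMod N) - Y.sh j)) by ring,
        sgn_add_double A.even_period, sgn_neg A.even_period, sgn_one A.even_period, neg_neg,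
        one_smul]
    · rfl
    · rfl

theorem Gen.ext (hX : Gen U K X) (hY : Gen U K Y) (a : X.Hom Y 1) (ha : IsClosed a) :
    Gen U K (PreTw.ext a) := by
  let b : (X.shift (-1)).Hom Y 0 :=
    ⟨(shiftSource (-1) (toElt a)).2.1, fun i j => mem_gr ((shiftSource (-1) (toElt a)).2.2 i j)
      (by simp [shiftSource, toElt])⟩
  have hb : toElt b = shiftSource (-1) (toElt a) := Elt.ext (by simp [shiftSource, toElt]) rfl
  have h := (hX.shift (-1)).cone hY b (by
    change muTw (single (toElt b)) = 0
    rw [hb]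
    funext i j
    exact (muTw_shiftSource (-1) (toElt a) (nil Y) i j).trans
      ((congrArg _ (congrFun (congrFun ha i) j)).trans (smul_zero _)))
  rwa [cone_shiftSource_neg_one a b] at h
  intro i j
  change sgn (((-1 : ℤ) : ZMod N) * ((X.sh i : ZMod N) - (Y.sh j : ZMod N))) • a.1 i j = _
  push_cast
  rw [neg_one_mul, sgn_neg A.even_period]

/-- The octahedral axiom: the cone of a composition is generated by the cones of the factors. -/
theorem Gen.cone_compHom (hX : X.MaurerCartan) (hY : Y.MaurerCartan) (hZ : Z.MaurerCartan)
    {f : X.Hom Y 0} {g : Y.Hom Z 0} (hf : IsClosed f) (hg : IsClosed g)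
    (h₁ : Gen U K (PreTw.cone f)) (h₂ : Gen U K (PreTw.cone g)) :
    Gen U K (PreTw.cone (compHom f g)) := by
  have hC := hX.cone (compHom f g) hZ (isClosed_compHom hX hY hZ hf hg)
  rw [cone_eq_ext] at h₁ h₂ hC ⊢
  exact (h₂.ext h₁ _ (isClosed_octConn U f g)).summand hC _ _ (isClosed_octIncl U f g hf)
    (isClosed_octProj U f g hg) (compHom_octIncl_octProj U f g)

/-- A contractible twisted complex is a summand of `K`: the zero morphisms are an inclusion and a
projection. -/
theorem Gen.of_contractible (hX : X.MaurerCartan) (h : Contractible U X) : Gen U K X := by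
  obtain ⟨h, e⟩ := h
  refine ⟨hX, .summand .self ⟨0, 0, muTw_zero₁ _, muTw_zero₁ _, -h, ?_⟩⟩
  change muTw (cons (toElt 0) (single (toElt 0))) - (idElt U X).2.1 =
    muTw (cons (toElt (-h)) (nil _))
  rw [muTw_zero₁, muTw_neg₁, zero_sub, ← e]
  rfl

/-- The cone of `-f = f ∘ (-id)` is generated by the cone of `f`, as that of `-id` is contractible. -/
theorem Gen.cone_zsmul (hX : X.MaurerCartan) (hY : Y.MaurerCartan) {f : X.Hom Y 0}
    (hf : IsClosed f) (h : Gen U K (PreTw.cone f)) {m : ℤ} (hm : m * m = 1) :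
    Gen U K (PreTw.cone (m • f)) := by
  have hid : IsClosed (m • idHom U X) :=
    (muTw_zsmul₁ m _ (nil _)).trans ((congrArg (m • ·) (muTw_idElt U X)).trans (smul_zero _))
  have e : muTw (cons (toElt (m • idHom U X)) (single (toElt (m • idHom U X)))) -
      (idElt U X).2.1 = muTw (single (toElt (0 : X.Hom X (-1)))) := by
    simp only [single, muTw_zsmul₁, muTw_zsmul₂, smul_smul, hm, one_smul, muTw_zero₁]
    exact sub_eq_zero.2 (muTw_idHom_left U (idHom U X))
  have h1 := contractible_cone U hX hX (m • idHom U X) hid (m • idHom U X) hid 0 0 e e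
  have h2 := Gen.cone_compHom (K := K) hX hX hY hid hf
    (.of_contractible (hX.cone _ hX hid) h1) h
  have h3 : compHom (m • idHom U X) f = m • f := by
    refine Subtype.ext ?_
    exact (muTw_zsmul₁ m _ _).trans (congrArg (m • ·) (muTw_idHom_left U f))
  rwa [h3] at h2

/-- The target of a zero morphism is a summand of its cone. -/
theorem Gen.of_cone_zero (hX : X.MaurerCartan) (h : Gen U K (PreTw.cone (0 : Y.Hom X 0))) :
    Gen U K X := by
  rw [cone_eq_ext] at h
  have h0 : coneHom (0 : Y.Hom X 0) = 0 := by
    refine Subtype.ext (funext fun i => funext fun j => ?_)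
    change -(sgn _ • (0 : A.Hom (Y.ob i) (X.ob j))) = 0
    rw [smul_zero, neg_zero]
  rw [h0] at h
  refine h.summand hX (pairTo 0 (idHom U X)) (pairFrom 0 (idHom U X)) ?_ ?_ ?_
  · change muTw (cons (toElt (pairTo _ _)) (nil _)) = 0
    simp only [muTw_pairTo₁, muTw_zero₁, muTw_idHom₁, add_zero, rowBlk_zero]
  · change muTw (cons (toElt (pairFrom _ _)) (nil _)) = 0
    simp only [muTw_pairFrom, muTw_zero₁, muTw_idHom₁, add_zero, colBlk_zero]
  · refine Subtype.ext ?_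
    change muTw (cons (toElt (pairTo _ _)) (cons (toElt (pairFrom _ _)) (nil _))) = _
    simp only [muTw_pairTo_pairFrom, muTw_zero₁, zero_add, muTw_idHom_left]

end Octahedral

/-! ### Triangular matrices -/

section Triangular

variable {Q R Q₁ R₁ Q₂ R₂ Q₃ R₃ W X Y Z : PreTw A}

theorem tw_ext_append_mid {V : W.I → Type v} [∀ j, AddCommGroup (V j)] {a : Q.Hom R 1}
    (p : Chain (O := PreTw A) Elt X Y) (f : Elt Y (ext a)) (g : Elt (ext a) Z)
    (c : Chain (O := PreTw A) Elt Z W) :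
    ∀ (i : X.I) {F : ∀ l, Chain A.Elt (X.ob i) (W.ob l) → V l} (_ : ∀ l, IsAdditive (F l))
    (l : W.I), tw (p.append (cons f (cons g c))) i F l =
      tw (p.append (cons (toL f) (cons (fromL g) c))) i F l +
      tw (p.append (cons (toL f) (cons (toElt a) (cons (fromR g) c)))) i F l +
      tw (p.append (cons (toR f) (cons (fromR g) c))) i F l := by
  induction p with
  | nil Y => exact fun i F hF l => tw_ext_mid f g c i hF l
  | cons x p ih =>
    intro i F hF l
    refine tw_cons_unique x _ l
      (fun i F => tw (cons x (p.append (cons (toL f) (cons (fromL g) c)))) i F l +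
      tw (cons x (p.append (cons (toL f) (cons (toElt a) (cons (fromR g) c))))) i F l +
      tw (cons x (p.append (cons (toR f) (cons (fromR g) c)))) i F l)
      (fun i => ?_) (fun i F hF => ?_) i F hF
    · simp only [tw_zero _ _ _ (fun _ _ => rfl), add_zero]
    · simp only [tw_cons _ _ i hF, ih f _ (isAdditive_step _ _ _ hF), Finset.sum_add_distrib]
      abel

theorem muTw_ext_mid₂ {a : Q.Hom R 1} (e : Elt X Y) (f : Elt Y (ext a)) (g : Elt (ext a) Z)
    (c : Chain (O := PreTw A) Elt Z W) :
    muTw (cons e (cons f (cons g c))) = muTw (cons e (cons (toL f) (cons (fromL g) c))) +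
      muTw (cons e (cons (toL f) (cons (toElt a) (cons (fromR g) c)))) +
      muTw (cons e (cons (toR f) (cons (fromR g) c))) :=
  funext fun i => funext fun l =>
    tw_ext_append_mid (single e) f g c i (fun _ => isAdditive_mu _ _) l

variable {a₁ : Q₁.Hom R₁ 1} {a₂ : Q₂.Hom R₂ 1} {a₃ : Q₃.Hom R₃ 1}
  {f : Elt (ext a₁) (ext a₂)} {g : Elt (ext a₂) (ext a₃)}

theorem muTw_triangular_inr (hf : (toL (fromR f)).2.1 = 0) (i : R₁.I) :
    muTw (cons f (single g)) (.inr i) = muTw (cons (toR (fromR f)) (single (fromR g))) i := by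
  have h1 := muTw_entry_zero (nil _) _ hf (single (fromL g))
  have h2 := muTw_entry_zero (nil _) _ hf (cons (toElt a₂) (single (fromR g)))
  simp only [append, single] at h1 h2 ⊢
  rw [muTw_ext_inr, muTw_ext_mid, h1, h2, zero_add, zero_add]

theorem muTw_triangular_inr_inl (hf : (toL (fromR f)).2.1 = 0) (hg : (toL (fromR g)).2.1 = 0)
    (i : R₁.I) (j : Q₃.I) : muTw (cons f (single g)) (.inr i) (.inl j) = 0 := by
  rw [muTw_triangular_inr hf]
  refine (muTw_ext_to_inl (single (toR (fromR f))) (fromR g) i j).trans ?_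
  exact congrFun (congrFun (muTw_entry_zero (single _) _ hg (nil _)) i) j

theorem muTw_triangular_inr_inr (hf : (toL (fromR f)).2.1 = 0) (hg : (toL (fromR g)).2.1 = 0)
    (i : R₁.I) (j : R₃.I) : muTw (cons f (single g)) (.inr i) (.inr j) =
      muTw (cons (toR (fromR f)) (single (toR (fromR g)))) i j := by
  rw [muTw_triangular_inr hf]
  refine (muTw_ext_to_inr (single (toR (fromR f))) (fromR g) i j).trans ?_
  refine (congrArg (_ + ·) (congrFun (congrFun
    (muTw_entry_zero (single _) _ hg (single (toElt a₃))) i) j)).trans ?_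
  exact add_zero _

theorem muTw_triangular_inl_inl (hf : (toL (fromR f)).2.1 = 0) (hg : (toL (fromR g)).2.1 = 0)
    (i : Q₁.I) (j : Q₃.I) : muTw (cons f (single g)) (.inl i) (.inl j) =
      muTw (cons (toL (fromL f)) (single (toL (fromL g)))) i j := by
  have hg' : (fromR (toL g)).2.1 = 0 := hg
  have h1 := muTw_entry_zero (cons (toL (fromL f)) (single (toElt a₂))) _ hg' (nil _)
  have h2 := muTw_entry_zero (single (toR (fromL f))) _ hg' (nil _)
  have h3 := muTw_entry_zero (single (toElt a₁)) _ hf (single (fromL (toL g)))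
  have h4 := muTw_entry_zero (single (toElt a₁)) _ hf (cons (toElt a₂) (single (fromR (toL g))))
  have h5 := muTw_entry_zero (cons (toElt a₁) (single (toR (fromR f)))) _ hg' (nil _)
  simp only [append, single] at h1 h2 h3 h4 h5 ⊢
  rw [muTw_ext_inl, Pi.add_apply]
  refine (congrArg₂ (· + ·) (muTw_ext_to_inl (single (fromL f)) g i j)
    (muTw_ext_to_inl (cons (toElt a₁) (single (fromR f))) g i j)).trans ?_
  simp only [append, single]
  rw [muTw_ext_mid, muTw_ext_mid₂, h1, h2, h3, h4, h5]
  simp only [add_zero]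
  exact add_zero _

/-- Compositions of matrices with a single nonzero block, from `Q` to `R`, vanish. -/
theorem muTw_offDiagonal (hf : (fromR f).2.1 = 0) (hf' : (toL (fromL f)).2.1 = 0)
    (hg : (fromR g).2.1 = 0) : muTw (cons f (single g)) = 0 := by
  have h1 := muTw_entry_zero (nil _) _ hf (single g)
  have h2 := muTw_entry_zero (single (toElt a₁)) _ hf (single g)
  have h3 := muTw_entry_zero (nil _) _ hf' (single (fromL g))
  have h4 := muTw_entry_zero (nil _) _ hf' (cons (toElt a₂) (single (fromR g)))
  have h5 := muTw_entry_zero (single (toR (fromL f))) _ hg (nil _)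
  simp only [append, single] at h1 h2 h3 h4 h5 ⊢
  funext i
  rcases i with i | i
  · rw [muTw_ext_inl, muTw_ext_mid, h2, h3, h4, h5]
    simp only [add_zero]
    exact add_zero _
  · rw [muTw_ext_inr, h1]
    rfl

end Triangular

/-! ### Transport along equalities of twisted complexes -/

theorem shift_shift (X : PreTw A) (m n : ℤ) : (X.shift m).shift n = X.shift (m + n) := by
  obtain ⟨I, ob, sh, δ, hδ, ht⟩ := X
  refine mk_congr (fun _ => rfl) (fun i => add_assoc _ _ _) (fun i j => heq_of_eq ?_)
  simp only [smul_smul, ← sgn_add A.even_period]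
  push_cast
  ring_nf

theorem shift_ext {Q R : PreTw A} (a : Q.Hom R 1) (m : ℤ) :
    (ext a).shift m = ext (shiftHom a m) := by
  refine mk_congr (fun _ => rfl) ?_ ?_
  · rintro (i | i) <;> rfl
  · rintro (i | i) (j | j)
    · rfl
    · rfl
    · exact heq_of_eq (smul_zero (M := ℤ) (A := A.Hom (R.ob i) (Q.ob j)) _)
    · rfl

theorem Elt.heq {X X' Y Y' : PreTw A} (hX : X = X') (hY : Y = Y') {f : Elt X Y} {f' : Elt X' Y'}
    (h : f.1 = f'.1) (h' : HEq f.2.1 f'.2.1) : HEq f f' := by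
  subst hX hY
  exact heq_of_eq (Elt.ext h (eq_of_heq h'))

theorem muTw_heq {X X' Y Y' Z Z' : PreTw A} (hX : X = X') (hY : Y = Y') (hZ : Z = Z')
    {f : Elt X Y} {f' : Elt X' Y'} {g : Elt Y Z} {g' : Elt Y' Z'} (hf : HEq f f')
    (hg : HEq g g') : HEq (muTw (cons f (single g))) (muTw (cons f' (single g'))) := by
  subst hX hY hZ
  rw [eq_of_heq hf, eq_of_heq hg]

/-- Properties of morphisms pass to morphisms with the same matrix on an equal source. -/
theorem hom_transport {X X' Y : PreTw A} {P : ∀ X : PreTw A, X.Hom Y 0 → Prop} (h : X = X')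
    {f : X.Hom Y 0} {f' : X'.Hom Y 0} (hf : HEq f.1 f'.1) (hP : P X f) : P X' f' := by
  subst h
  rwa [← Subtype.ext (eq_of_heq hf)]

theorem cone_shiftHom {X Y : PreTw A} (f : X.Hom Y 0) (m : ℤ) :
    PreTw.cone (shiftHom f m) = (PreTw.cone (sgn (m : ZMod N) • f)).shift m := by
  refine mk_congr ?_ ?_ ?_
  · rintro (i | i) <;> rfl
  · rintro (i | i)
    · change X.sh i + m + 1 = X.sh i + 1 + m
      ring
    · rfl
  · rintro (i | i) (j | j)
    · refine heq_of_eq ?_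
      change sgn (((1 : ℤ) : ZMod N) * (((X.sh i + m : ℤ) : ZMod N) - ((X.sh j + m : ℤ) : ZMod N))) •
        sgn ((m : ZMod N) * ((X.sh i : ZMod N) - (X.sh j : ZMod N))) • X.δ i j =
        sgn ((m : ZMod N) * (((X.sh i + 1 : ℤ) : ZMod N) - ((X.sh j + 1 : ℤ) : ZMod N))) •
        sgn (((1 : ℤ) : ZMod N) * ((X.sh i : ZMod N) - (X.sh j : ZMod N))) • X.δ i j
      simp only [smul_smul, ← sgn_add A.even_period]
      push_cast
      ring_nf
    · refine heq_of_eq ?_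
      change -(sgn (((X.sh i + m : ℤ) : ZMod N) - ((Y.sh j + m : ℤ) : ZMod N)) •
        sgn ((m : ZMod N) * ((X.sh i : ZMod N) - (Y.sh j : ZMod N))) • f.1 i j) =
        sgn ((m : ZMod N) * (((X.sh i + 1 : ℤ) : ZMod N) - ((Y.sh j : ℤ) : ZMod N))) •
        -(sgn ((X.sh i : ZMod N) - (Y.sh j : ZMod N)) • sgn (m : ZMod N) • f.1 i j)
      rw [smul_neg]
      simp only [smul_smul, ← sgn_add A.even_period]
      push_cast
      rw [← sgn_add_double A.even_period _ (m : ZMod N)]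
      ring_nf
    · exact heq_of_eq (smul_zero (M := ℤ) (A := A.Hom (Y.ob i) (X.ob j)) _).symm
    · rfl

end PreTw

namespace Tw

variable {k : Type w} [Field k] {N : ℕ} {A : AInfCategory.{u, v, w} k N}

open PreTw Chain

/-! ### Invertible edges -/

theorem isClosed_zsmul {X Y : PreTw A} (m : ℤ) {f : X.Hom Y 0} (hf : IsClosed f) :
    IsClosed (m • f) :=
  (muTw_zsmul₁ m f (nil _)).trans ((congrArg (m • ·) hf).trans (smul_zero _))

/-- The cone of `koszulMatrix` is an extension of a shift of the cone of `a`, up to sign, by the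
cone of `a`. -/
theorem contractible_cone_koszulMatrix (U : A.StrictUnits) {P : Tw A} {s t : ℤ}
    (x : (P.shift s).Hom P 0) (hx : IsClosed x) (a : (P.shift t).Hom P 0)
    (c : (P.shift (t + s + 1)).Hom P 0) (hF : IsClosed (koszulMatrix x hx a c))
    (ha : ∀ m : ℤ, m * m = 1 → Contractible U (PreTw.cone (m • a))) (m : ℤ) (hm : m * m = 1) :
    Contractible U (PreTw.cone (m • koszulMatrix x hx a c)) := by
  have hcl := isClosed_zsmul m hF
  have hMC := ((cone x hx).shift t).maurerCartan.cone (m • koszulMatrix x hx a c)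
    (cone x hx).maurerCartan hcl
  refine contractible_of_partition U hMC (Equiv.sumSumSumComm P.I P.I P.I P.I) ?_ ?_ ?_
  · rintro (i | i) (j | j)
    · change sgn _ • sgn _ • (0 : A.Hom (P.ob i) (P.ob j)) = 0
      rw [smul_zero, smul_zero]
    · change -(sgn _ • m • (0 : A.Hom (P.ob i) (P.ob j))) = 0
      rw [smul_zero, smul_zero, neg_zero]
    · rfl
    · rfl
  -- the shift by `s + 1` of the connecting morphism of the cone of `a` has the sign `(-1)^(s+1)`
  · have h := (ha (m * sgn ((s : ZMod N) + 1)) (by rw [mul_mul_mul_comm, hm, sgn_mul_self,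
      one_mul])).shift U (s + 1)
    refine cast (congrArg (Contractible U) (mk_congr ?_ ?_ ?_)) h
    · rintro (i | i) <;> rfl
    · rintro (i | i)
      · change P.sh i + t + 1 + (s + 1) = P.sh i + s + 1 + t + 1
        ring
      · change P.sh i + (s + 1) = P.sh i + s + 1
        ring
    · rintro (i | i) (j | j)
      · refine heq_of_eq ?_
        change sgn (((s + 1 : ℤ) : ZMod N) * (((P.sh i + t + 1 : ℤ) : ZMod N) -
            ((P.sh j + t + 1 : ℤ) : ZMod N))) •
          sgn (((1 : ℤ) : ZMod N) * (((P.sh i + t : ℤ) : ZMod N) - ((P.sh j + t : ℤ) : ZMod N))) •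
          sgn ((t : ZMod N) * ((P.sh i : ZMod N) - (P.sh j : ZMod N))) • P.δ i j =
          sgn (((1 : ℤ) : ZMod N) * (((P.sh i + s + 1 + t : ℤ) : ZMod N) -
            ((P.sh j + s + 1 + t : ℤ) : ZMod N))) •
          sgn ((t : ZMod N) * (((P.sh i + s + 1 : ℤ) : ZMod N) -
            ((P.sh j + s + 1 : ℤ) : ZMod N))) •
          sgn (((1 : ℤ) : ZMod N) * (((P.sh i + s : ℤ) : ZMod N) - ((P.sh j + s : ℤ) : ZMod N))) •
          sgn ((s : ZMod N) * ((P.sh i : ZMod N) - (P.sh j : ZMod N))) • P.δ i j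
        simp only [smul_smul, ← sgn_add A.even_period]
        push_cast
        ring_nf
      · refine heq_of_eq ?_
        change sgn (((s + 1 : ℤ) : ZMod N) * (((P.sh i + t + 1 : ℤ) : ZMod N) -
            ((P.sh j : ℤ) : ZMod N))) •
          -(sgn (((P.sh i + t : ℤ) : ZMod N) - (P.sh j : ZMod N)) •
            (m * sgn ((s : ZMod N) + 1)) • a.1 i j) =
          -(sgn (((P.sh i + s + 1 + t : ℤ) : ZMod N) - ((P.sh j + s + 1 : ℤ) : ZMod N)) •
            m • sgn (((s + 1 : ℤ) : ZMod N) * (((P.sh i + t : ℤ) : ZMod N) -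
            ((P.sh j : ℤ) : ZMod N))) • a.1 i j)
        rw [smul_neg]
        simp only [smul_smul]
        congr 2
        have h1 : ((s + 1 : ℤ) : ZMod N) * (((P.sh i + t + 1 : ℤ) : ZMod N) -
            ((P.sh j : ℤ) : ZMod N)) = ((s + 1 : ℤ) : ZMod N) * (((P.sh i + t : ℤ) : ZMod N) -
            ((P.sh j : ℤ) : ZMod N)) + ((s : ZMod N) + 1) := by push_cast; ring
        have h2 : ((P.sh i + s + 1 + t : ℤ) : ZMod N) - ((P.sh j + s + 1 : ℤ) : ZMod N) =
            ((P.sh i + t : ℤ) : ZMod N) - (P.sh j : ZMod N) := by push_cast; ring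
        have h3 := sgn_mul_self ((s : ZMod N) + 1)
        rw [h1, h2, sgn_add A.even_period _ ((s : ZMod N) + 1)]
        linear_combination (sgn (((s + 1 : ℤ) : ZMod N) * (((P.sh i + t : ℤ) : ZMod N) -
            ((P.sh j : ℤ) : ZMod N))) * sgn (((P.sh i + t : ℤ) : ZMod N) - (P.sh j : ZMod N)) *
            m) * h3
      · exact heq_of_eq (smul_zero (M := ℤ) (A := A.Hom (P.ob i) (P.ob j)) _)
      · refine heq_of_eq ?_
        change sgn (((s + 1 : ℤ) : ZMod N) * ((P.sh i : ZMod N) - (P.sh j : ZMod N))) • P.δ i j =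
          sgn (((1 : ℤ) : ZMod N) * (((P.sh i + s : ℤ) : ZMod N) - ((P.sh j + s : ℤ) : ZMod N))) •
          sgn ((s : ZMod N) * ((P.sh i : ZMod N) - (P.sh j : ZMod N))) • P.δ i j
        simp only [smul_smul, ← sgn_add A.even_period]
        push_cast
        ring_nf
  · refine cast (congrArg (Contractible U) (mk_congr ?_ ?_ ?_)) (ha m hm)
    · rintro (i | i) <;> rfl
    · rintro (i | i) <;> rfl
    · rintro (i | i) (j | j) <;> rfl

theorem contractible_cone_of_isQuasiIso (U : A.StrictUnits) {X Y : Tw A} {f : X.Hom Y 0}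
    (hf : IsQuasiIso U f) (m : ℤ) (hm : m * m = 1) : Contractible U (PreTw.cone (m • f)) := by
  obtain ⟨hf, g, hg, ⟨h₁, e₁⟩, h₂, e₂⟩ := hf
  refine contractible_cone U X.maurerCartan Y.maurerCartan (m • f) (isClosed_zsmul m hf) (m • g)
    (isClosed_zsmul m hg) h₁ h₂ ?_ ?_
  · rw [single, muTw_zsmul₁, muTw_zsmul₂, smul_smul, hm, one_smul]
    exact e₁
  · rw [single, muTw_zsmul₁, muTw_zsmul₂, smul_smul, hm, one_smul]
    exact e₂

/-- The zero morphisms are inverse to each other up to homotopy. -/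
theorem quasiIsomorphic_zero (U : A.StrictUnits) {X : Tw A} (h : Contractible U X.toPreTw) :
    QuasiIsomorphic U X (zero A) := by
  obtain ⟨h, e⟩ := h
  refine ⟨0, muTw_zero₁ _, 0, muTw_zero₁ _, ⟨-h, ?_⟩, 0, funext fun i => i.elim⟩
  change muTw (cons (toElt 0) (single (toElt 0))) - (idElt U X.toPreTw).2.1 =
    muTw (cons (toElt (-h)) (nil _))
  rw [muTw_zero₁, muTw_neg₁, zero_sub, ← e]
  rfl

/-- If the edge `a_{i,0}` is invertible, then the cones of all `a_{i,j}` are contractible, among them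
`K_{i+1}`, and with it all further objects. -/
theorem Koszul.contractible (U : A.StrictUnits) {K' K : Tw A} (T : Koszul K' K) {i : ℕ}
    (hi : i < T.n) (h : IsQuasiIso U (T.edge i)) : Contractible U K.toPreTw := by
  have key : ∀ j ≤ i, ∀ m : ℤ, m * m = 1 → Contractible U (PreTw.cone (m • T.a i j)) := by
    intro j
    induction j with
    | zero => exact fun _ m hm => contractible_cone_of_isQuasiIso U h m hm
    | succ j ih =>
      intro hj
      have hF : IsClosed (koszulMatrix (T.a j j) (T.closed j j le_rfl (lt_trans hj hi)) (T.a i j)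
          (T.c i j)) := by
        have := T.closed i (j + 1) hj hi
        exact (T.a_succ i j hj hi).rec (motive := fun (p : Σ X : Tw A, (X.shift (T.s i)).Hom X 0) _ =>
          IsClosed p.2) this
      have h1 := contractible_cone_koszulMatrix U (T.a j j) (T.closed j j le_rfl (lt_trans hj hi))
        (T.a i j) (T.c i j) hF (ih (Nat.le_of_succ_le hj))
      exact (T.a_succ i j hj hi).symm.rec
        (motive := fun (p : Σ X : Tw A, (X.shift (T.s i)).Hom X 0) _ =>
          ∀ m : ℤ, m * m = 1 → Contractible U (PreTw.cone (m • p.2))) h1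
  have key2 : ∀ j, i + 1 ≤ j → j ≤ T.n → Contractible U (T.obj j).toPreTw := by
    intro j hj
    induction j, hj using Nat.le_induction with
    | base =>
      intro _
      rw [T.obj_succ i hi]
      have := key i le_rfl 1 (one_mul 1)
      rwa [one_smul] at this
    | succ j hj ih =>
      intro hjn
      have h1 := ih (Nat.le_of_succ_le hjn)
      rw [T.obj_succ j hjn]
      have h2 := (cone (T.a j j) (T.closed j j le_rfl hjn)).maurerCartan
      change Contractible U (PreTw.cone (T.a j j))
      change (PreTw.cone (T.a j j)).MaurerCartan at h2
      rw [cone_eq_ext] at h2 ⊢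
      exact Contractible.ext U h2 ((h1.shift U _).shift U 1) h1
  have := key2 T.n hi le_rfl
  rwa [T.obj_n] at this

/-! ### Powers -/

section Powers

variable {U : A.StrictUnits} {K X : Tw A}

/-- By the octahedral axiom for `a^(m+1) = μ²(a, a^m[s])`. -/
theorem gen_cone_powSucc {s : ℤ} {a : (X.shift s).Hom X 0} (ha : IsClosed a)
    (h : Gen U K (PreTw.cone a)) (m : ℕ) :
    IsClosed (powSucc a m) ∧ Gen U K (PreTw.cone (powSucc a m)) := by
  induction m with
  | zero =>
    refine hom_transport (P := fun Y f => IsClosed f ∧ Gen U K (PreTw.cone f)) (X := X.toPreTw.shift s)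
      (f := a) ?_ HEq.rfl ⟨ha, h⟩
    simp
  | succ m ih =>
    obtain ⟨ih₁, ih₂⟩ := ih
    have hX := X.maurerCartan
    let n : ℤ := ((m + 1 : ℕ) : ℤ) * s
    have h1 : IsClosed (PreTw.shiftHom (powSucc a m) s) := isClosed_shiftHom ih₁ s
    have h2 : Gen U K (PreTw.cone (PreTw.shiftHom (powSucc a m) s)) := by
      rw [cone_shiftHom]
      exact (Gen.cone_zsmul (hX.shift n) hX ih₁ ih₂ (sgn_mul_self _)).shift s
    have hXn := (hX.shift n).shift s
    have h3 := isClosed_compHom hXn (hX.shift s) hX h1 ha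
    have h4 := Gen.cone_compHom hXn (hX.shift s) hX h1 ha h2 h
    refine hom_transport (P := fun Y f => IsClosed f ∧ Gen U K (PreTw.cone f))
      (X := (X.toPreTw.shift n).shift s) ?_ HEq.rfl ⟨h3, h4⟩
    rw [PreTw.shift_shift]
    simp only [n]
    congr 1
    push_cast
    ring

theorem gen_cone_odot (ms : List ℕ) : ∀ (a : Σ s : ℤ, (X.shift s).Hom X 0) (_ : IsClosed a.2)
    (_ : Gen U K (PreTw.cone a.2)), Gen U K (PreTw.cone (odot a ms).2) := by
  induction ms with
  | nil => exact fun a _ h => h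
  | cons m ms ih =>
    intro a ha h
    obtain ⟨h1, h2⟩ := gen_cone_powSucc ha h m
    exact ih ⟨_, powSucc a.2 m⟩ h1 h2

/-- The cone of a nilpotent morphism `X[s] → X` split-generates `X`. -/
theorem gen_of_isNilpotent {s : ℤ} {a : (X.shift s).Hom X 0} (ha : IsClosed a)
    (hn : IsNilpotent a) (h : Gen U K (PreTw.cone a)) : Gen U K X.toPreTw := by
  obtain ⟨ms, hms⟩ := hn
  have h1 := gen_cone_odot ms ⟨s, a⟩ ha h
  rw [hms] at h1
  exact Gen.of_cone_zero X.maurerCartan h1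

end Powers

/-! ### Inheritance of nilpotency -/

section Inheritance

variable {P : Tw A} {s : ℤ}

/-- The matrix `F` on the sum of `P[s + 1]` and `P` is block triangular, and its diagonal blocks
are `G[s + 1]` and `G`, where `G : P[t] → P`. The entries from `P[s + 1]` to `P` are arbitrary. -/
structure Tri (P : Tw A) (s t : ℤ)
    (F : ∀ i j : P.I ⊕ P.I, A.Hom (Sum.elim P.ob P.ob i) (Sum.elim P.ob P.ob j))
    (G : ∀ i j : P.I, A.Hom (P.ob i) (P.ob j)) : Prop where
  inl_inl : ∀ i j, F (.inl i) (.inl j) =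
    sgn (((s + 1 : ℤ) : ZMod N) * (((P.sh i + t : ℤ) : ZMod N) - (P.sh j : ZMod N))) • G i j
  inr_inl : ∀ i j, F (.inr i) (.inl j) = 0
  inr_inr : ∀ i j, F (.inr i) (.inr j) = G i j

section

variable {X Y : PreTw A} {x : X.Hom Y 0} {t t' : ℤ}

/-- A morphism `g : Cone(x)[t] → Cone(x)`, between extensions. -/
def shiftExtHom (g : ((PreTw.cone x).shift t).Hom (PreTw.cone x) 0) :
    (ext (PreTw.shiftHom (coneHom x) t)).Hom (ext (coneHom x)) 0 :=
  ⟨g.1, fun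
    | .inl i, .inl j => g.2 (.inl i) (.inl j)
    | .inl i, .inr j => g.2 (.inl i) (.inr j)
    | .inr i, .inl j => g.2 (.inr i) (.inl j)
    | .inr i, .inr j => g.2 (.inr i) (.inr j)⟩

/-- The shift by `t` of a morphism `f : Cone(x)[t'] → Cone(x)`, between extensions. -/
def shiftShiftExtHom (t : ℤ) (f : ((PreTw.cone x).shift t').Hom (PreTw.cone x) 0) :
    (ext (PreTw.shiftHom (PreTw.shiftHom (coneHom x) t') t)).Hom
      (ext (PreTw.shiftHom (coneHom x) t)) 0 :=
  ⟨(PreTw.shiftHom f t).1, fun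
    | .inl i, .inl j => (PreTw.shiftHom f t).2 (.inl i) (.inl j)
    | .inl i, .inr j => (PreTw.shiftHom f t).2 (.inl i) (.inr j)
    | .inr i, .inl j => (PreTw.shiftHom f t).2 (.inr i) (.inl j)
    | .inr i, .inr j => (PreTw.shiftHom f t).2 (.inr i) (.inr j)⟩

theorem muTw_shiftExtHom (f : ((PreTw.cone x).shift t').Hom (PreTw.cone x) 0)
    (g : ((PreTw.cone x).shift t).Hom (PreTw.cone x) 0) :
    muTw (cons (toElt (PreTw.shiftHom f t)) (single (toElt g))) =
      muTw (cons (toElt (shiftShiftExtHom t f)) (single (toElt (shiftExtHom g)))) := by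
  have h1 : (PreTw.cone x).shift t = ext (PreTw.shiftHom (coneHom x) t) := by
    rw [cone_eq_ext, shift_ext]
  have h2 : ((PreTw.cone x).shift t').shift t =
      ext (PreTw.shiftHom (PreTw.shiftHom (coneHom x) t') t) := by
    rw [cone_eq_ext, shift_ext, shift_ext]
  exact eq_of_heq (muTw_heq h2 h1 (cone_eq_ext x) (Elt.heq h2 h1 rfl HEq.rfl)
    (Elt.heq h1 (cone_eq_ext x) rfl HEq.rfl))

end

variable {x : (P.shift s).Hom P 0} {hx : IsClosed x} {t' t : ℤ}
  {f : ((cone x hx).shift t').Hom (cone x hx) 0} {g : ((cone x hx).shift t).Hom (cone x hx) 0}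
  {f₀ : (P.shift t').Hom P 0} {g₀ : (P.shift t).Hom P 0}

/-- If `F` and `G` are the shifts by `s + 1` of `f₀[t] : P[t'][t] → P[t]` and `g₀ : P[t] → P`, up to
the order in which `P` is shifted, then so is their composition. -/
theorem muTw_shifted_block (F : Elt ((((P.toPreTw.shift s).shift 1).shift t').shift t)
      (((P.toPreTw.shift s).shift 1).shift t))
    (G : Elt (((P.toPreTw.shift s).shift 1).shift t) ((P.toPreTw.shift s).shift 1))
    (hF₁ : F.1 = 0) (hF : ∀ i j, F.2.1 i j = sgn ((t : ZMod N) * (((P.sh i + s + 1 + t' : ℤ) :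
      ZMod N) - ((P.sh j + s + 1 : ℤ) : ZMod N))) • sgn (((s + 1 : ℤ) : ZMod N) *
        (((P.sh i + t' : ℤ) : ZMod N) - (P.sh j : ZMod N))) • f₀.1 i j)
    (hG₁ : G.1 = 0) (hG : ∀ i j, G.2.1 i j = sgn (((s + 1 : ℤ) : ZMod N) *
        (((P.sh i + t : ℤ) : ZMod N) - (P.sh j : ZMod N))) • g₀.1 i j) (i j : P.I) :
    muTw (cons F (single G)) i j =
      sgn (((s + 1 : ℤ) : ZMod N) * (((P.sh i + (t' + t) : ℤ) : ZMod N) - (P.sh j : ZMod N))) •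
        muTw (cons (toElt (PreTw.shiftHom f₀ t)) (single (toElt g₀))) i j := by
  have h3 : (P.toPreTw.shift s).shift 1 = P.toPreTw.shift (s + 1) := PreTw.shift_shift _ _ _
  have h2 : ((P.toPreTw.shift s).shift 1).shift t = (P.toPreTw.shift t).shift (s + 1) := by
    rw [h3, PreTw.shift_shift, PreTw.shift_shift, add_comm]
  have h1 : (((P.toPreTw.shift s).shift 1).shift t').shift t =
      ((P.toPreTw.shift t').shift t).shift (s + 1) := by
    rw [h3, PreTw.shift_shift, PreTw.shift_shift, PreTw.shift_shift, PreTw.shift_shift]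
    congr 1
    ring
  have h4 : muTw (cons F (single G)) = muTw (cons
      (shiftElt (s + 1) (toElt (PreTw.shiftHom f₀ t))) (single (shiftElt (s + 1) (toElt g₀)))) := by
    refine eq_of_heq (muTw_heq h1 h2 h3 (Elt.heq h1 h2 hF₁ (heq_of_eq ?_))
      (Elt.heq h2 h3 hG₁ (heq_of_eq ?_)))
    · funext i j
      refine (hF i j).trans ?_
      change _ = sgn (((s + 1 : ℤ) : ZMod N) * (((P.sh i + t' + t : ℤ) : ZMod N) -
        ((P.sh j + t : ℤ) : ZMod N))) • sgn ((t : ZMod N) * (((P.sh i + t' : ℤ) : ZMod N) -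
        (P.sh j : ZMod N))) • f₀.1 i j
      simp only [smul_smul, ← sgn_add A.even_period]
      push_cast
      ring_nf
    · funext i j
      exact hG i j
  rw [h4]
  refine (muTw_pair_shiftElt (s + 1) (toElt (PreTw.shiftHom f₀ t)) (toElt g₀) i j).trans ?_
  change sgn (((s + 1 : ℤ) : ZMod N) * (((P.sh i + t' + t : ℤ) : ZMod N) - (P.sh j : ZMod N))) • _ = _
  rw [add_assoc (P.sh i)]

theorem zsmul_eq_zero_of {M : Type*} [AddCommGroup M] (n : ℤ) {y : M} (h : y = 0) : n • y = 0 := by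
  rw [h, smul_zero]

theorem Tri.toL_fromR {t₀ : ℤ} {G} (hf : Tri P s t₀ f.1 G) :
    (toL (fromR (toElt (shiftShiftExtHom (x := x) t f)))).2.1 = 0 :=
  funext fun i => funext fun j =>
    zsmul_eq_zero_of (M := A.Hom (P.ob i) (P.ob j)) _ (hf.inr_inl i j)

theorem Tri.comp (hf : Tri P s t' f.1 f₀.1) (hg : Tri P s t g.1 g₀.1) :
    Tri P s (t' + t) (comp g (shiftHom f t)).1 (comp g₀ (shiftHom f₀ t)).1 := by
  have e : (Tw.comp g (Tw.shiftHom f t)).1 =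
      muTw (cons (toElt (shiftShiftExtHom (x := x) t f)) (single (toElt (shiftExtHom (x := x) g)))) :=
    muTw_shiftExtHom (x := x) f g
  have hf0 := hf.toL_fromR (x := x) (t := t)
  have hg0 : (toL (fromR (toElt (shiftExtHom (x := x) g)))).2.1 = 0 :=
    funext fun i => funext fun j => hg.inr_inl i j
  have e₀ := muTw_triangular_inr_inl hf0 hg0
  rw [e]
  refine ⟨fun i j => ?_, fun i j => e₀ i j, fun i j => ?_⟩
  · refine (muTw_triangular_inl_inl hf0 hg0 i j).trans ?_
    refine muTw_shifted_block (f₀ := f₀) (g₀ := g₀)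
      (toL (fromL (toElt (shiftShiftExtHom (x := x) t f))))
      (toL (fromL (toElt (shiftExtHom (x := x) g)))) rfl (fun i j => ?_) rfl (fun i j => ?_) i j
    · rw [← hf.inl_inl i j]
      rfl
    · exact hg.inl_inl i j
  · refine (muTw_triangular_inr_inr hf0 hg0 i j).trans ?_
    have e1 : toR (fromR (toElt (shiftShiftExtHom (x := x) t f))) =
        toElt (PreTw.shiftHom f₀ t) := by
      refine Elt.ext rfl (funext fun i => funext fun j => ?_)
      exact congrArg (sgn _ • ·) (hf.inr_inr i j)
    have e2 : toR (fromR (toElt (shiftExtHom (x := x) g))) = toElt g₀ :=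
      Elt.ext rfl (funext fun i => funext fun j => hg.inr_inr i j)
    rw [e1, e2]
    rfl

/-- Matrices whose diagonal blocks vanish have composition zero. -/
theorem Tri.comp_eq_zero {t₀ : ℤ} (hf : Tri P s t₀ f.1 0) (hg : Tri P s t₀ g.1 0) :
    (Tw.comp g (Tw.shiftHom f t)).1 = 0 := by
  refine (muTw_shiftExtHom (x := x) f g).trans (muTw_offDiagonal ?_ ?_ ?_)
  · funext i j
    rcases j with j | j
    · exact zsmul_eq_zero_of (M := A.Hom (P.ob i) (P.ob j)) _ (hf.inr_inl i j)
    · exact zsmul_eq_zero_of (M := A.Hom (P.ob i) (P.ob j)) _ (hf.inr_inr i j)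
  · funext i j
    exact zsmul_eq_zero_of (M := A.Hom (P.ob i) (P.ob j)) _
      ((hf.inl_inl i j).trans (zsmul_eq_zero_of (M := A.Hom (P.ob i) (P.ob j)) _ rfl))
  · funext i j
    rcases j with j | j
    · exact hg.inr_inl i j
    · exact hg.inr_inr i j

theorem Tri.of_eq {t₀ t₁ : ℤ} {F G} (h : t₀ = t₁) (hF : Tri P s t₀ F G) : Tri P s t₁ F G := h ▸ hF

theorem Tri.powSucc (hf : Tri P s t' f.1 f₀.1) (m : ℕ) :
    Tri P s (((m + 1 : ℕ) : ℤ) * t') (powSucc f m).1 (powSucc f₀ m).1 := by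
  induction m with
  | zero => exact Tri.of_eq (P := P) (s := s) (t₀ := t') (F := f.1) (G := f₀.1) (by simp) hf
  | succ m ih => exact Tri.of_eq (by push_cast; ring) (ih.comp hf)

theorem Tri.odot (ms : List ℕ) : ∀ {t : ℤ} {f : ((cone x hx).shift t).Hom (cone x hx) 0}
    {f₀ : (P.shift t).Hom P 0} (_ : Tri P s t f.1 f₀.1),
    Tri P s (odot ⟨t, f₀⟩ ms).1 (odot ⟨t, f⟩ ms).2.1 (odot ⟨t, f₀⟩ ms).2.1 := by
  induction ms with
  | nil => exact fun h => h
  | cons m ms ih => exact fun h => ih (h.powSucc m)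

theorem odot_append {X : Tw A} (ms ms' : List ℕ) : ∀ a : Σ s : ℤ, (X.shift s).Hom X 0,
    odot a (ms ++ ms') = odot (odot a ms) ms' := by
  induction ms with
  | nil => exact fun _ => rfl
  | cons m ms ih => exact fun a => ih _

/-- If `a` is nilpotent, so is `koszulMatrix x hx a c`: a power of it has the diagonal blocks zero, and
then its square vanishes. -/
theorem isNilpotent_koszulMatrix {a : (P.shift t).Hom P 0} (c : (P.shift (t + s + 1)).Hom P 0)
    (ha : IsNilpotent a) : IsNilpotent (koszulMatrix x hx a c) := by
  obtain ⟨ms, h⟩ := ha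
  refine ⟨ms ++ [1], ?_⟩
  have h0 : Tri P s t (koszulMatrix x hx a c).1 a.1 :=
    ⟨fun _ _ => rfl, fun _ _ => rfl, fun _ _ => rfl⟩
  have h1 := h0.odot ms
  rw [h] at h1
  rw [odot_append]
  generalize odot ⟨t, koszulMatrix x hx a c⟩ ms = b at h1
  obtain ⟨t₁, b⟩ := b
  exact Subtype.ext (Tri.comp_eq_zero (f := (Tw.powSucc b 0)) (g := b) h1 h1)

/-- The matrices of a Koszul twisted complex inherit nilpotency from the edges. -/
theorem Koszul.isNilpotent {K' K : Tw A} (T : Koszul K' K) {i : ℕ} (hi : i < T.n)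
    (h : IsNilpotent (T.edge i)) : ∀ j ≤ i, IsNilpotent (T.a i j) := by
  intro j
  induction j with
  | zero => exact fun _ => h
  | succ j ih =>
    intro hj
    exact (T.a_succ i j hj hi).symm.rec
      (motive := fun (p : Σ X : Tw A, (X.shift (T.s i)).Hom X 0) _ => IsNilpotent p.2)
      (isNilpotent_koszulMatrix (T.c i j) (ih (Nat.le_of_succ_le hj)))

/-- `K_{j+1}` is the cone of the nilpotent morphism `x_j` and split-generates `K_j`; descend from
`K_n = K` to `K_0 = K'`. -/
theorem Koszul.gen (U : A.StrictUnits) {K' K : Tw A} (T : Koszul K' K)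
    (h : ∀ i < T.n, IsNilpotent (T.edge i)) : SplitGenerates U K K' := by
  have key : ∀ d j, j + d = T.n → Gen U K (T.obj j).toPreTw := by
    intro d
    induction d with
    | zero =>
      rintro j hj
      rw [add_zero] at hj
      rw [hj, T.obj_n]
      exact ⟨K.maurerCartan, .self⟩
    | succ d ih =>
      intro j hj
      have hjn : j < T.n := by omega
      have h1 := ih (j + 1) (by omega)
      rw [T.obj_succ j hjn] at h1
      exact gen_of_isNilpotent (T.closed j j le_rfl hjn) (T.isNilpotent hjn (h j hjn) j le_rfl) h1
  have h1 := key T.n 0 (zero_add _)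
  rw [T.obj_zero] at h1
  exact h1.2

end Inheritance

end Tw

end

end Ainf

theorem mainTheorem5 {k : Type*} [Field k] {N : ℕ} (A : Ainf.AInfCategory k N)
    (U : A.StrictUnits) (K' K : Ainf.Tw A) (T : Ainf.Tw.Koszul K' K) :
    ((∀ i < T.n, Ainf.Tw.IsNilpotent (T.edge i)) → Ainf.Tw.SplitGenerates U K K') ∧
    ((∃ i < T.n, Ainf.Tw.IsQuasiIso U (T.edge i)) →
      Ainf.Tw.QuasiIsomorphic U K (Ainf.Tw.zero A)) :=
  ⟨T.gen U, fun ⟨_, hi, h⟩ => Ainf.Tw.quasiIsomorphic_zero U (T.contractible U hi h)⟩
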